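/- Let $d\ge 2$ and let $(\tau_e)_{e\in E(\mathbb Z^d)}$ be i.i.d., nonnegative, nondegenerate random weights on the nearest-neighbour edges of $\mathbb Z^d$ with $\mathbb P(\tau_e\le C)=1$ for some $C<\infty$ and $\mathbb P(\tau_e=0)<p_c(d)$, where $p_c(d)$ is the critical probability of Bernoulli bond percolation on $\mathbb Z^d$. For $\mathbf x,\mathbf y\in\mathbb R^d$ and $A\subset\mathbb R^d$, let $T_A(\mathbf x,\mathbf y)$ be the infimum of $\sum_{e\in\gamma}\tau_e$ over the lattice paths $\gamma$ in $A$ from $\lfloor\mathbf x\rfloor$ to $\lfloor\mathbf y\rfloor$ (coordinatewise integer parts; $\inf\emptyset=\infty$), and let $T=T_{\mathbb R^d}$. Let $\mu(\mathbf x)=\lim_{N\to\infty}N^{-1}\mathbb E\,T(\mathbf 0,N\mathbf x)$, $\mathbf x\in\mathbb R^d$, be the time constant. Fix $\mathbf u\in\mathbb R^d$ with $|\mathbf u|=1$, a tangent (supporting) hyperplane $H_{\mathbf u}$ at $\mathbf u$ of $\{\mathbf x:\mu(\mathbf x)\le\mu(\mathbf u)\}$, and an orthonormal basis $\tilde{\mathbf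 u}_1,\dots,\tilde{\mathbf u}_d$ of $\mathbb R^d$ with $\tilde{\mathbf u}_1\cdot\mathbf u>0$ and $H_{\mathbf u}=\mathbf u+\mathrm{span}\{\tilde{\mathbf u}_2,\dots,\tilde{\mathbf u}_d\}$. For $\mathbf v\in H_{\mathbf u}$, $I\subset\mathbb R$ and $h>0$ put $$\mathrm{Cyl}_{\mathbf v}(I,h)=\Big\{y_1\mathbf v+\sum_{i=2}^d y_i\tilde{\mathbf u}_i:\ y_1\in I,\ |y_i|\le h\ (2\le i\le d)\Big\}.$$ Let $\overline\chi\in(0,1)$ and assume the following. (A1) There are $\theta_0>0$ and $c_0>0$ such that for all sufficiently large $K\in\mathbb N$, all $a\in[\overline\chi,1]$ and all $\mathbf v\in H_{\mathbf u}$ with $|K\mathbf v-K\mathbf u|<K^{\frac{\overline\chi+1+c_0}{2}}$, $$\mathbb P\Big(T_{\mathrm{Cyl}_{\mathbf v}([-2K,2K],\,K^{(a+1)/2})}(\mathbf 0,K\mathbf v)>K\mu(\mathbf v)+K^a\Big)\le e^{-K^{\theta_0(a-\overline\chi)}}.$$ (A2) There is $C'>0$ with $\mu(\mathbf u+\mathbf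 w)-\mu(\mathbf u)\le C'|\mathbf w|^2$ for all $\mathbf w\in\mathrm{span}\{\tilde{\mathbf u}_2,\dots,\tilde{\mathbf u}_d\}$. Then: (1) For every $\varepsilon>0$ there is $\delta>0$ such that for all sufficiently large $N\in\mathbb N$, all $a\in[\overline\chi+\varepsilon,1]$ and all $\mathbf v\in H_{\mathbf u}$ with $|N\mathbf v-N\mathbf u|<N^{\frac{\overline\chi+1+\delta}{2}}$, $$\mathbb P\Big(T_{\mathrm{Cyl}_{\mathbf v}(\mathbb R,\,N^{(a+1)/2})}(\mathbf 0,N\mathbf v)>N\mu(\mathbf v)+N^a\Big)\le e^{-N^{\frac{d(1-\varepsilon)}{1-\overline\chi}(a-\overline\chi)}}.$$ In particular, for every $\varepsilon>0$, for all sufficiently large $N\in\mathbb N$ and all $a\in[\overline\chi+\varepsilon,1]$, $$\mathbb P\big(T(\mathbf 0,N\mathbf u)>N\mu(\mathbf u)+N^a\big)\le e^{-N^{\frac{d(1-\varepsilon)}{1-\overline\chi}(a-\overline\chi)}}.$$ (2) For every $\varepsilon>0$ there is $\zeta_0>0$ such that for all $\zeta\in(0,\zeta_0)$, $$\limsup_{N\to\infty}N^{-d}\log\mathbb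 P\big(T(\mathbf 0,N\mathbf u)>N\mu(\mathbf u)+\zeta N\big)\le-\zeta^{(1+\varepsilon)\frac{d}{1-\overline\chi}}\qquad(\log 0=-\infty).$$ -/

import Mathlib

open MeasureTheory ProbabilityTheory Filter Topology
open scoped NNReal ENNReal

namespace FPP

noncomputable section

/-- The nearest-neighbour graph on `ℤ^d`. -/
def lattice (d : ℕ) : SimpleGraph (Fin d → ℤ) where
  Adj x y := ∑ i, |x i - y i| = 1
  symm := ⟨fun x y h => by simpa only [abs_sub_comm] using h⟩
  loopless := ⟨fun x h => by simp at h⟩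

/-- The set `E(ℤ^d)` of nearest-neighbour edges, as a type. -/
abbrev Edge (d : ℕ) : Type := (lattice d).edgeSet

/-- Euclidean space `ℝ^d`. -/
abbrev Space (d : ℕ) : Type := EuclideanSpace ℝ (Fin d)

/-- The inclusion `ℤ^d → ℝ^d`. -/
def toSpace {d : ℕ} (z : Fin d → ℤ) : Space d := WithLp.toLp 2 (fun i => (z i : ℝ))

/-- `⌊x⌋`, the point of `ℤ^d` with `x ∈ ⌊x⌋ + [0,1)^d`. -/
def floorPt {d : ℕ} (x : Space d) : Fin d → ℤ := fun i => ⌊x i⌋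

/-! ### Bernoulli bond percolation -/

/-- The probability, in Bernoulli bond percolation on `ℤ^d` with parameter `p`, that the open
cluster of the origin is infinite. -/
def percolationProb (d : ℕ) (p : unitInterval) : ℝ≥0∞ :=
  setBernoulli (lattice d).edgeSet p
    {S : Set (Sym2 (Fin d → ℤ)) | {y | (SimpleGraph.fromEdgeSet S).Reachable 0 y}.Infinite}

/-- The critical probability `p_c(d)` of Bernoulli bond percolation on `ℤ^d`. -/
def criticalProb (d : ℕ) : ℝ :=
  sInf {p : ℝ | ∃ h : p ∈ unitInterval, 0 < percolationProb d ⟨p, h⟩}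

/-! ### Passage times -/

/-- The passage time `T(γ)` of a lattice path `γ` for the edge weights `t`. -/
def pathTime {d : ℕ} (t : Edge d → ℝ≥0) {x y : Fin d → ℤ} (γ : (lattice d).Walk x y) : ℝ≥0 :=
  (γ.darts.map (fun e => t ⟨e.edge, e.edge_mem⟩)).sum

/-- `T_A(x, y)`: the infimum of the passage times of the lattice paths from `⌊x⌋` to `⌊y⌋` that
have all their vertices in `A` (it is `∞` if there is no such path). For the convex sets `A` used
below, such a path runs inside `A` together with its edges. -/
def restrictedTime {d : ℕ} (t : Edge d → ℝ≥0) (A : Set (Space d)) (x y : Space d) : ℝ≥0∞ :=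
  ⨅ (γ : (lattice d).Walk (floorPt x) (floorPt y)) (_ : ∀ z ∈ γ.support, toSpace z ∈ A),
    (pathTime t γ : ℝ≥0∞)

/-- The first-passage time `T(x, y)`, for `x y ∈ ℝ^d`. -/
def passageTime {d : ℕ} (t : Edge d → ℝ≥0) (x y : Space d) : ℝ≥0∞ :=
  restrictedTime t Set.univ x y

/-- The standing assumptions on the edge weights: they are i.i.d., not almost surely constant,
almost surely bounded, and vanish with probability less than `p_c(d)`. -/
structure IsWeights {d : ℕ} {Ω : Type*} [MeasurableSpace Ω] (P : Measure Ω)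
    (τ : Edge d → Ω → ℝ≥0) : Prop where
  measurable : ∀ e, Measurable (τ e)
  indep : iIndepFun τ P
  identDistrib : ∀ e e', IdentDistrib (τ e) (τ e') P P
  nondegenerate : ∀ e, ¬ ∃ c : ℝ≥0, ∀ᵐ ω ∂P, τ e ω = c
  subcritical : ∀ e, P.real {ω | τ e ω = 0} < criticalProb d
  bounded : ∃ C : ℝ≥0, ∀ e, ∀ᵐ ω ∂P, τ e ω ≤ C

/-- The time constant `μ(x) = lim_N 𝔼[T(0, N x)] / N`, for every `x ∈ ℝ^d`. -/
def timeConstant {d : ℕ} {Ω : Type*} [MeasurableSpace Ω] (P : Measure Ω)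
    (τ : Edge d → Ω → ℝ≥0) (x : Space d) : ℝ :=
  limUnder atTop (fun N : ℕ =>
    (∫ ω, (passageTime (fun e => τ e ω) 0 ((N : ℝ) • x)).toReal ∂P) / (N : ℝ))

/-! ### Tangent hyperplanes and tilted cylinders

An orthonormal basis `ũ_1, …, ũ_d` is indexed here by `Fin d`, so that `ũ_1` is `b 0`. -/

/-- The linear span of `ũ_2, …, ũ_d`. -/
def tangentSpace {d : ℕ} [NeZero d] (b : OrthonormalBasis (Fin d) ℝ (Space d)) :
    Submodule ℝ (Space d) :=
  Submodule.span ℝ (b '' {i | i ≠ 0})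

/-- The hyperplane `H_u = u + span {ũ_2, …, ũ_d}`. -/
def tangentPlane {d : ℕ} [NeZero d] (b : OrthonormalBasis (Fin d) ℝ (Space d)) (u : Space d) :
    Set (Space d) :=
  {x | x - u ∈ tangentSpace b}

/-- `b` is adapted to `u`: one has `ũ_1 · u > 0`, and `u + span {ũ_2, …, ũ_d}` is a tangent
(supporting) hyperplane at `u` of `{x | μ x ≤ μ u}`, the dilate by `μ u` of the limit shape
`{x | μ x ≤ 1}`. -/
def IsTangentFrame {d : ℕ} [NeZero d] (μ : Space d → ℝ) (u : Space d)
    (b : OrthonormalBasis (Fin d) ℝ (Space d)) : Prop :=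
  0 < inner ℝ (b 0) u ∧ ∀ x, μ x ≤ μ u → inner ℝ (b 0) x ≤ inner ℝ (b 0) u

/-- The tilted cylinder `Cyl_v(I, h)`. -/
def cyl {d : ℕ} [NeZero d] (b : OrthonormalBasis (Fin d) ℝ (Space d)) (v : Space d)
    (I : Set ℝ) (h : ℝ) : Set (Space d) :=
  {x | ∃ y : Fin d → ℝ, y 0 ∈ I ∧ (∀ i, i ≠ 0 → |y i| ≤ h) ∧
    x = y 0 • v + ∑ i ∈ Finset.univ.erase 0, y i • b i}

/-! ### The two assumptions -/

/-- Upper tail concentration with exponent `χ` in tilted cylinders. -/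
def UpperTailConcentration {d : ℕ} [NeZero d] {Ω : Type*} [MeasurableSpace Ω] (P : Measure Ω)
    (τ : Edge d → Ω → ℝ≥0) (u : Space d) (b : OrthonormalBasis (Fin d) ℝ (Space d))
    (χ : ℝ) : Prop :=
  ∃ θ₀ > (0 : ℝ), ∃ c₀ > (0 : ℝ), ∃ K₀ : ℕ, ∀ K : ℕ, K₀ ≤ K → ∀ a ∈ Set.Icc χ 1,
    ∀ v ∈ tangentPlane b u,
      ‖(K : ℝ) • v - (K : ℝ) • u‖ < (K : ℝ) ^ ((χ + 1 + c₀) / 2) →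
      P.real {ω | ENNReal.ofReal (K * timeConstant P τ v + (K : ℝ) ^ a) <
          restrictedTime (fun e => τ e ω)
            (cyl b v (Set.Icc (-2 * (K : ℝ)) (2 * K)) ((K : ℝ) ^ ((a + 1) / 2)))
            0 ((K : ℝ) • v)}
        ≤ Real.exp (-(K : ℝ) ^ (θ₀ * (a - χ)))

/-- Directional finite curvature of the limit shape at `u`. -/
def FiniteCurvature {d : ℕ} [NeZero d] (μ : Space d → ℝ) (u : Space d)
    (b : OrthonormalBasis (Fin d) ℝ (Space d)) : Prop :=
  ∃ C > (0 : ℝ), ∀ w ∈ tangentSpace b, μ (u + w) - μ u ≤ C * ‖w‖ ^ 2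

end

end FPP

namespace FPP

/-! ### Passage times between lattice points -/

/-- The infimum of the passage times of the lattice paths from `x` to `y` with vertices in `S`. -/
noncomputable def ptTime {d : ℕ} (t : Edge d → ℝ≥0) (S : Set (Fin d → ℤ)) (x y : Fin d → ℤ) :
    ℝ≥0∞ :=
  ⨅ (γ : (lattice d).Walk x y) (_ : ∀ z ∈ γ.support, z ∈ S), (pathTime t γ : ℝ≥0∞)

lemma restrictedTime_eq_ptTime {d : ℕ} (t : Edge d → ℝ≥0) (A : Set (Space d)) (x y : Space d) :
    restrictedTime t A x y = ptTime t (toSpace ⁻¹' A) (floorPt x) (floorPt y) := rfl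

lemma ptTime_le {d : ℕ} (t : Edge d → ℝ≥0) {S : Set (Fin d → ℤ)} {x y : Fin d → ℤ}
    (γ : (lattice d).Walk x y) (h : ∀ z ∈ γ.support, z ∈ S) :
    ptTime t S x y ≤ pathTime t γ := iInf₂_le γ h

lemma ptTime_anti {d : ℕ} (t : Edge d → ℝ≥0) {S S' : Set (Fin d → ℤ)} (h : S ⊆ S')
    (x y : Fin d → ℤ) : ptTime t S' x y ≤ ptTime t S x y :=
  le_iInf₂ fun γ hγ => ptTime_le t γ fun z hz => h (hγ z hz)

lemma pathTime_append {d : ℕ} (t : Edge d → ℝ≥0) {x y z : Fin d → ℤ}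
    (γ : (lattice d).Walk x y) (γ' : (lattice d).Walk y z) :
    pathTime t (γ.append γ') = pathTime t γ + pathTime t γ' := by
  simp [pathTime, SimpleGraph.Walk.darts_append]

lemma ptTime_triangle {d : ℕ} (t : Edge d → ℝ≥0) (S : Set (Fin d → ℤ)) (x y z : Fin d → ℤ) :
    ptTime t S x z ≤ ptTime t S x y + ptTime t S y z := by
  simp only [ptTime, ENNReal.iInf_add, ENNReal.add_iInf]
  refine le_iInf fun γ' => le_iInf fun h' => le_iInf fun γ => le_iInf fun h => ?_
  rw [← ENNReal.coe_add, ← pathTime_append]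
  refine ptTime_le t _ fun w hw => ?_
  rcases (SimpleGraph.Walk.mem_support_append_iff _ _).1 hw with hw | hw
  · exact h w hw
  · exact h' w hw

/-- The `ℓ¹` distance on `ℤ^d`. -/
def l1 {d : ℕ} (x y : Fin d → ℤ) : ℤ := ∑ i, |x i - y i|

lemma exists_walk_l1 {d : ℕ} (t : Edge d → ℝ≥0) {C : ℝ≥0} (hC : ∀ e, t e ≤ C)
    (x : Fin d → ℤ) (n : ℕ) : ∀ y, l1 x y = n → ∃ γ : (lattice d).Walk x y,
      pathTime t γ ≤ C * n ∧ ∀ z ∈ γ.support, l1 x z ≤ n := by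
  induction n with
  | zero =>
    intro y hy
    have hxy : x = y := by
      ext i
      have h := (Finset.sum_eq_zero_iff_of_nonneg (fun i _ => abs_nonneg (x i - y i))).1
        (by simpa [l1] using hy) i (Finset.mem_univ i)
      linarith [abs_eq_zero.1 h]
    subst hxy
    refine ⟨SimpleGraph.Walk.nil, by simp [pathTime], ?_⟩
    simp [l1]
  | succ n ih =>
    intro y hy
    obtain ⟨i, hi⟩ : ∃ i, x i ≠ y i := by
      by_contra! h
      have : l1 x y = 0 := by simp [l1, h]
      omega
    obtain ⟨s, hs, hs'⟩ : ∃ s : ℤ, |s| = 1 ∧ |x i - (y i + s)| = |x i - y i| - 1 := by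
      rcases lt_or_gt_of_ne hi with h | h
      · exact ⟨-1, by simp, by rw [abs_of_nonpos, abs_of_neg] <;> omega⟩
      · exact ⟨1, by simp, by rw [abs_of_nonneg, abs_of_pos] <;> omega⟩
    have hsum : ∀ f : Fin d → ℤ, ∑ j, f j = f i + ∑ j ∈ Finset.univ.erase i, f j := fun f =>
      (Finset.add_sum_erase _ _ (Finset.mem_univ i)).symm
    set y' := Function.update y i (y i + s) with hy'
    have hrest : ∀ j ∈ Finset.univ.erase i, y' j = y j := fun j hj => by
      rw [hy', Function.update_of_ne (Finset.ne_of_mem_erase hj)]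
    have hl : l1 x y' = n := by
      have h1 : l1 x y = |x i - y i| + ∑ j ∈ Finset.univ.erase i, |x j - y j| := hsum _
      have h2 : l1 x y' = |x i - y' i| + ∑ j ∈ Finset.univ.erase i, |x j - y' j| := hsum _
      rw [Finset.sum_congr rfl (fun j hj => by rw [hrest j hj])] at h2
      have h3 : y' i = y i + s := by simp [hy']
      rw [h3, hs'] at h2
      push_cast at hy
      linarith
    obtain ⟨γ, hγ, hγ'⟩ := ih y' hl
    have hadj : (lattice d).Adj y' y := by
      change ∑ j, |y' j - y j| = 1
      rw [hsum, Finset.sum_eq_zero (fun j hj => by rw [hrest j hj]; simp)]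
      simp [hy', hs]
    refine ⟨γ.append (.cons hadj .nil), ?_, ?_⟩
    · rw [pathTime_append]
      push_cast
      rw [mul_add, mul_one]
      refine add_le_add hγ ?_
      simpa [pathTime] using hC _
    · intro z hz
      rcases (SimpleGraph.Walk.mem_support_append_iff _ _).1 hz with hz | hz
      · have := hγ' z hz
        push_cast; linarith
      · simp only [SimpleGraph.Walk.support_cons, SimpleGraph.Walk.support_nil, List.mem_cons,
          List.not_mem_nil, or_false] at hz
        rcases hz with rfl | rfl
        · rw [hl]; push_cast; linarith
        · exact hy.le

lemma l1_nonneg {d : ℕ} (x y : Fin d → ℤ) : 0 ≤ l1 x y :=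
  Finset.sum_nonneg fun _ _ => abs_nonneg _

lemma ptTime_le_l1 {d : ℕ} {t : Edge d → ℝ≥0} {C : ℝ≥0} (hC : ∀ e, t e ≤ C)
    {S : Set (Fin d → ℤ)} {x y : Fin d → ℤ} (h : ∀ z, l1 x z ≤ l1 x y → z ∈ S) :
    ptTime t S x y ≤ ENNReal.ofReal (C * l1 x y) := by
  obtain ⟨n, hn⟩ := Int.eq_ofNat_of_zero_le (l1_nonneg x y)
  obtain ⟨γ, hγ, hγ'⟩ := exists_walk_l1 t hC x n y hn
  refine (ptTime_le t γ fun z hz => h z (by rw [hn]; exact hγ' z hz)).trans ?_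
  rw [hn]
  have : ((C : ℝ) * ((n : ℤ) : ℝ)) = ((C * n : ℝ≥0) : ℝ) := by push_cast; rfl
  rw [this, ENNReal.ofReal_coe_nnreal]
  exact_mod_cast hγ

/-! ### Translations -/

/-- Translation by `z`, as an endomorphism of the lattice. -/
def shiftHom {d : ℕ} (z : Fin d → ℤ) : lattice d →g lattice d where
  toFun x := x + z
  map_rel' {x y} h := by
    change ∑ i, |(x + z) i - (y + z) i| = 1
    have h' : ∑ i, |x i - y i| = 1 := h
    simpa using h'

/-- The translated edge. -/
def shiftEdge {d : ℕ} (z : Fin d → ℤ) : Edge d → Edge d := (shiftHom z).mapEdgeSet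

lemma shiftEdge_injective {d : ℕ} (z : Fin d → ℤ) : Function.Injective (shiftEdge z) :=
  SimpleGraph.Hom.mapEdgeSet.injective _ (fun _ _ h => add_right_cancel h)

lemma pathTime_map {d : ℕ} (t : Edge d → ℝ≥0) (z : Fin d → ℤ) {x y : Fin d → ℤ}
    (γ : (lattice d).Walk x y) :
    pathTime t (γ.map (shiftHom z)) = pathTime (fun e => t (shiftEdge z e)) γ := by
  simp only [pathTime, SimpleGraph.Walk.darts_map, List.map_map]
  rfl

lemma ptTime_shift_le {d : ℕ} (t : Edge d → ℝ≥0) (z : Fin d → ℤ) (S : Set (Fin d → ℤ))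
    (x y : Fin d → ℤ) :
    ptTime t {w | w - z ∈ S} (x + z) (y + z) ≤ ptTime (fun e => t (shiftEdge z e)) S x y := by
  refine le_iInf₂ fun γ hγ => ?_
  rw [← pathTime_map]
  refine ptTime_le t _ fun w hw => ?_
  have hw2 : w ∈ (γ.map (shiftHom z)).support := hw
  rw [SimpleGraph.Walk.support_map, List.mem_map] at hw2
  obtain ⟨w', hw', rfl⟩ := hw2
  change w' + z - z ∈ S
  rw [add_sub_cancel_right]
  exact hγ w' hw'

lemma shiftEdge_shiftEdge_neg {d : ℕ} (z : Fin d → ℤ) (e : Edge d) :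
    shiftEdge z (shiftEdge (-z) e) = e := by
  apply Subtype.ext
  obtain ⟨e, he⟩ := e
  induction e with
  | _ a b => simp [shiftEdge, SimpleGraph.Hom.mapEdgeSet, shiftHom]

lemma ptTime_shift {d : ℕ} (t : Edge d → ℝ≥0) (z : Fin d → ℤ) (S : Set (Fin d → ℤ))
    (x y : Fin d → ℤ) :
    ptTime t {w | w - z ∈ S} (x + z) (y + z) = ptTime (fun e => t (shiftEdge z e)) S x y := by
  refine le_antisymm (ptTime_shift_le t z S x y) ?_
  have h := ptTime_shift_le (fun e => t (shiftEdge z e)) (-z) {w | w - z ∈ S} (x + z) (y + z)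
  simpa [shiftEdge_shiftEdge_neg] using h

/-! ### Measurability -/

instance {d : ℕ} (x y : Fin d → ℤ) : Countable ((lattice d).Walk x y) :=
  Function.Injective.countable (f := fun γ => γ.support)
    fun _ _ h => SimpleGraph.Walk.ext_support h

lemma measurable_ptTime {d : ℕ} {Ω : Type*} [MeasurableSpace Ω] {τ : Edge d → Ω → ℝ≥0}
    {S : Set (Fin d → ℤ)} (h : ∀ e : Edge d, (∀ v ∈ e.1, v ∈ S) → Measurable (τ e))
    (x y : Fin d → ℤ) : Measurable (fun ω => ptTime (fun e => τ e ω) S x y) := by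
  refine Measurable.iInf fun γ => Measurable.iInf fun hγ => ?_
  refine Measurable.coe_nnreal_ennreal ?_
  have : ∀ l : List (lattice d).Dart, (∀ e ∈ l, e ∈ γ.darts) →
      Measurable (fun ω => (l.map (fun e => τ ⟨e.edge, e.edge_mem⟩ ω)).sum) := by
    intro l hl
    induction l with
    | nil => simp
    | cons e l ih =>
      simp only [List.map_cons, List.sum_cons]
      refine Measurable.add (h _ fun v hv => ?_) (ih fun e he => hl e (by simp [he]))
      have he : e ∈ γ.darts := hl e (by simp)
      rcases Sym2.mem_iff.1 (show v ∈ s(e.fst, e.snd) from hv) with rfl | rfl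
      · exact hγ _ (γ.dart_fst_mem_support_of_mem_darts he)
      · exact hγ _ (γ.dart_snd_mem_support_of_mem_darts he)
  exact this _ fun _ => id

/-! ### Stationarity and independence -/

lemma map_shiftEdge {d : ℕ} {Ω : Type*} [MeasurableSpace Ω] {P : Measure Ω}
    [IsProbabilityMeasure P] {τ : Edge d → Ω → ℝ≥0} (hτ : IsWeights P τ) (z : Fin d → ℤ) :
    P.map (fun ω e => τ (shiftEdge z e) ω) = P.map (fun ω e => τ e ω) := by
  have h1 := (hτ.indep.precomp (shiftEdge_injective z)).map_fun_eq_infinitePi_map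
    (fun e => hτ.measurable _)
  have h2 := hτ.indep.map_fun_eq_infinitePi_map hτ.measurable
  rw [h1, h2]
  congr 1
  ext1 e
  exact (hτ.identDistrib _ _).map_eq

lemma measurable_ptTime_coord {d : ℕ} (S : Set (Fin d → ℤ)) (x y : Fin d → ℤ) :
    Measurable (fun t : Edge d → ℝ≥0 => ptTime t S x y) := by
  have h := @measurable_ptTime d (Edge d → ℝ≥0) _ (fun e t => t e) S
    (fun e _ => measurable_pi_apply e) x y
  exact h

lemma prob_ptTime_shift {d : ℕ} {Ω : Type*} [MeasurableSpace Ω] {P : Measure Ω}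
    [IsProbabilityMeasure P] {τ : Edge d → Ω → ℝ≥0} (hτ : IsWeights P τ) (z : Fin d → ℤ)
    (S : Set (Fin d → ℤ)) (x y : Fin d → ℤ) (c : ℝ≥0∞) :
    P.real {ω | c < ptTime (fun e => τ e ω) {w | w - z ∈ S} (x + z) (y + z)} =
      P.real {ω | c < ptTime (fun e => τ e ω) S x y} := by
  have hm : MeasurableSet {t : Edge d → ℝ≥0 | c < ptTime t S x y} :=
    measurableSet_lt measurable_const (measurable_ptTime_coord S x y)
  simp only [ptTime_shift]
  have h := congrArg (fun ν : Measure (Edge d → ℝ≥0) => ν.real {t | c < ptTime t S x y})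
    (map_shiftEdge hτ z)
  rwa [map_measureReal_apply (measurable_pi_lambda _ fun e => hτ.measurable _) hm,
    map_measureReal_apply (measurable_pi_lambda _ fun e => hτ.measurable _) hm] at h

lemma integral_ptTime_shift {d : ℕ} {Ω : Type*} [MeasurableSpace Ω] {P : Measure Ω}
    [IsProbabilityMeasure P] {τ : Edge d → Ω → ℝ≥0} (hτ : IsWeights P τ) (z : Fin d → ℤ)
    (x y : Fin d → ℤ) :
    ∫ ω, (ptTime (fun e => τ e ω) Set.univ (x + z) (y + z)).toReal ∂P =
      ∫ ω, (ptTime (fun e => τ e ω) Set.univ x y).toReal ∂P := by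
  have hs : ∀ t : Edge d → ℝ≥0, ptTime t Set.univ (x + z) (y + z) =
      ptTime (fun e => t (shiftEdge z e)) Set.univ x y := fun t => ptTime_shift t z Set.univ x y
  simp only [hs]
  have hm : Measurable (fun t : Edge d → ℝ≥0 => (ptTime t Set.univ x y).toReal) :=
    (measurable_ptTime_coord _ x y).ennreal_toReal
  rw [← integral_map (φ := fun ω e => τ (shiftEdge z e) ω)
      (measurable_pi_lambda _ fun e => hτ.measurable _).aemeasurable hm.aestronglyMeasurable,
    map_shiftEdge hτ z, integral_map
      (measurable_pi_lambda _ fun e => hτ.measurable _).aemeasurable hm.aestronglyMeasurable]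

/-- Passage times in disjoint regions are independent. -/
lemma prob_iInter_ptTime {d : ℕ} {Ω : Type*} [mΩ : MeasurableSpace Ω] {P : Measure Ω}
    [IsProbabilityMeasure P] {τ : Edge d → Ω → ℝ≥0} (hτ : IsWeights P τ) {ι : Type*}
    (S : ι → Set (Fin d → ℤ)) (x y : ι → Fin d → ℤ) (c : ι → ℝ≥0∞) (A : Finset ι)
    (hS : (A : Set ι).PairwiseDisjoint S) :
    P.real (⋂ a ∈ A, {ω | c a < ptTime (fun e => τ e ω) (S a) (x a) (y a)}) =
      ∏ a ∈ A, P.real {ω | c a < ptTime (fun e => τ e ω) (S a) (x a) (y a)} := by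
  classical
  induction A using Finset.induction_on with
  | empty => simp
  | insert a A ha ih =>
    rw [Finset.set_biInter_insert, Finset.prod_insert ha, ← ih (hS.subset (by simp))]
    let m : Edge d → MeasurableSpace Ω := fun e => MeasurableSpace.comap (τ e) inferInstance
    have hle : ∀ e, m e ≤ mΩ := fun e => (hτ.measurable e).comap_le
    let ED : Set (Fin d → ℤ) → Set (Edge d) := fun S => {e | ∀ v ∈ e.1, v ∈ S}
    have hdis : Disjoint (ED (S a)) (⋃ b ∈ A, ED (S b)) := by
      rw [Set.disjoint_left]
      intro e he he'
      obtain ⟨b, hb, heb⟩ := Set.mem_iUnion₂.1 he'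
      have hab : a ≠ b := fun h => ha (h ▸ hb)
      have := hS (by simp) (by simp [hb]) hab
      obtain ⟨v, hv⟩ : ∃ v, v ∈ e.1 := ⟨_, e.1.out_fst_mem⟩
      exact Set.disjoint_left.1 this (he v hv) (heb v hv)
    have hind := indep_iSup_of_disjoint hle hτ.indep hdis
    have hmeas : ∀ (E : Set (Edge d)) (b : ι), ED (S b) ⊆ E → MeasurableSet[⨆ e ∈ E, m e]
        {ω | c b < ptTime (fun e => τ e ω) (S b) (x b) (y b)} := by
      intro E b hb
      have h := @measurable_ptTime d Ω (⨆ e ∈ E, m e) τ (S b) (fun e he =>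
        Measurable.mono (comap_measurable (τ e)) (le_iSup₂_of_le e (hb he) le_rfl) le_rfl)
        (x b) (y b)
      exact h measurableSet_Ioi
    have h := (Indep_iff _ _ _).1 hind _
      ( ⋂ b ∈ A, {ω | c b < ptTime (fun e => τ e ω) (S b) (x b) (y b)}) (hmeas _ a subset_rfl)
      (Finset.measurableSet_biInter _ fun b hb => hmeas _ b
        (Set.subset_biUnion_of_mem (u := fun b => ED (S b)) hb))
    rw [Measure.real, h, ENNReal.toReal_mul]
    rfl

/-! ### The time constant -/

section TimeConstant

variable {d : ℕ} {Ω : Type*} [MeasurableSpace Ω] {P : Measure Ω} {τ : Edge d → Ω → ℝ≥0}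

lemma IsWeights.exists_ae_bound (hτ : IsWeights P τ) :
    ∃ C : ℝ≥0, 1 ≤ C ∧ ∀ᵐ ω ∂P, ∀ e, τ e ω ≤ C := by
  obtain ⟨C, hC⟩ := hτ.bounded
  have : Countable (Sym2 (Fin d → ℤ)) := Quot.mk_surjective.countable
  refine ⟨max C 1, le_max_right _ _, ae_all_iff.2 fun e => ?_⟩
  filter_upwards [hC e] with ω hω using hω.trans (le_max_left _ _)

/-- The mean passage time from the origin to a lattice point. -/
noncomputable def meanTime (P : Measure Ω) (τ : Edge d → Ω → ℝ≥0) (x : Fin d → ℤ) : ℝ :=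
  ∫ ω, (ptTime (fun e => τ e ω) Set.univ 0 x).toReal ∂P

lemma meanTime_nonneg (x : Fin d → ℤ) : 0 ≤ meanTime P τ x :=
  integral_nonneg fun _ => ENNReal.toReal_nonneg

lemma ptTime_univ_le {t : Edge d → ℝ≥0} {C : ℝ≥0} (hC : ∀ e, t e ≤ C) (x y : Fin d → ℤ) :
    ptTime t Set.univ x y ≤ ENNReal.ofReal (C * l1 x y) :=
  ptTime_le_l1 hC fun _ _ => trivial

variable [IsProbabilityMeasure P]

lemma integrable_ptTime (hτ : IsWeights P τ) (x y : Fin d → ℤ) :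
    Integrable (fun ω => (ptTime (fun e => τ e ω) Set.univ x y).toReal) P := by
  obtain ⟨C, _, hC⟩ := hτ.exists_ae_bound
  refine Integrable.of_bound (C := C * l1 x y)
    (measurable_ptTime (fun e _ => hτ.measurable e) x y).ennreal_toReal.aestronglyMeasurable ?_
  filter_upwards [hC] with ω hω
  have hnn : (0 : ℝ) ≤ C * l1 x y := mul_nonneg C.2 (by exact_mod_cast l1_nonneg x y)
  rw [Real.norm_of_nonneg ENNReal.toReal_nonneg]
  exact ENNReal.toReal_le_of_le_ofReal hnn (ptTime_univ_le hω x y)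

lemma meanTime_add_le (hτ : IsWeights P τ) (x y : Fin d → ℤ) :
    meanTime P τ (x + y) ≤ meanTime P τ x + meanTime P τ y := by
  obtain ⟨C, _, hC⟩ := hτ.exists_ae_bound
  have h : meanTime P τ y = ∫ ω, (ptTime (fun e => τ e ω) Set.univ x (x + y)).toReal ∂P := by
    rw [meanTime, ← integral_ptTime_shift hτ x, zero_add, add_comm y x]
  rw [h, meanTime, meanTime,
    ← integral_add (integrable_ptTime hτ _ _) (integrable_ptTime hτ _ _)]
  refine integral_mono_ae (integrable_ptTime hτ _ _)
    ((integrable_ptTime hτ _ _).add (integrable_ptTime hτ _ _)) ?_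
  filter_upwards [hC] with ω hω
  have hfin : ∀ x y, ptTime (fun e => τ e ω) Set.univ x y ≠ ⊤ := fun x y =>
    ((ptTime_univ_le hω x y).trans_lt ENNReal.ofReal_lt_top).ne
  rw [← ENNReal.toReal_add (hfin _ _) (hfin _ _)]
  exact ENNReal.toReal_mono (ENNReal.add_ne_top.2 ⟨hfin _ _, hfin _ _⟩)
    (ptTime_triangle _ _ _ _ _)

lemma meanTime_le (hτ : IsWeights P τ) {C : ℝ≥0} (hC : ∀ᵐ ω ∂P, ∀ e, τ e ω ≤ C)
    (x : Fin d → ℤ) : meanTime P τ x ≤ C * l1 0 x := by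
  have hnn : (0 : ℝ) ≤ C * l1 0 x := mul_nonneg C.2 (by exact_mod_cast l1_nonneg 0 x)
  have h := integral_mono_ae (integrable_ptTime hτ 0 x) (integrable_const (C * l1 0 x : ℝ)) ?_
  · simpa [meanTime] using h
  · filter_upwards [hC] with ω hω
    exact ENNReal.toReal_le_of_le_ofReal hnn (ptTime_univ_le hω 0 x)

lemma floorPt_zero : floorPt (0 : Space d) = 0 := by
  ext i; simp [floorPt]

lemma tendsto_timeConstant (hτ : IsWeights P τ) (x : Space d) :
    Tendsto (fun N : ℕ => meanTime P τ (floorPt ((N : ℝ) • x)) / (N : ℝ)) atTop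
      (𝓝 (timeConstant P τ x)) := by
  obtain ⟨C, _, hC⟩ := hτ.exists_ae_bound
  set a : ℕ → ℝ := fun N => meanTime P τ (floorPt ((N : ℝ) • x)) with ha
  have hsub : Subadditive (fun N => a N + C * d) := by
    intro m n
    set r := floorPt (((m + n : ℕ) : ℝ) • x) - (floorPt ((m : ℝ) • x) + floorPt ((n : ℝ) • x))
      with hr
    have h1 : a (m + n) ≤ a m + a n + meanTime P τ r := by
      have : floorPt (((m + n : ℕ) : ℝ) • x) =
          floorPt ((m : ℝ) • x) + floorPt ((n : ℝ) • x) + r := by rw [hr]; abel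
      simp only [ha]
      rw [this]
      exact (meanTime_add_le hτ _ _).trans (add_le_add_left (meanTime_add_le hτ _ _) _)
    have h2 : l1 0 r ≤ d := by
      have : ∀ i, |(0 : Fin d → ℤ) i - r i| ≤ 1 := by
        intro i
        simp only [hr, Pi.zero_apply, floorPt, Pi.sub_apply, Pi.add_apply, PiLp.smul_apply,
          smul_eq_mul, Nat.cast_add, add_mul]
        have e1 := Int.le_floor_add ((m : ℝ) * x i) ((n : ℝ) * x i)
        have e2 := Int.le_floor_add_floor ((m : ℝ) * x i) ((n : ℝ) * x i)
        rw [abs_le]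
        constructor <;> omega
      calc l1 0 r ≤ ∑ _i : Fin d, (1 : ℤ) := Finset.sum_le_sum fun i _ => this i
        _ = d := by simp
    have h3 : meanTime P τ r ≤ C * d :=
      (meanTime_le hτ hC r).trans (mul_le_mul_of_nonneg_left (by exact_mod_cast h2) C.2)
    simp only
    linarith
  have hbdd : BddBelow (Set.range fun n => (a n + C * d) / n) := by
    refine ⟨0, ?_⟩
    rintro _ ⟨n, rfl⟩
    have := meanTime_nonneg (P := P) (τ := τ) (floorPt ((n : ℝ) • x))
    simp only [ha]
    positivity
  have hlim := hsub.tendsto_lim hbdd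
  have h0 : Tendsto (fun n : ℕ => (C * d : ℝ) / n) atTop (𝓝 0) :=
    tendsto_const_div_atTop_nhds_zero_nat _
  have hlim' : Tendsto (fun n : ℕ => a n / n) atTop (𝓝 hsub.lim) := by
    have := hlim.sub h0
    simp only [sub_zero, ← sub_div, add_sub_cancel_right] at this
    exact this
  have heq : timeConstant P τ x = hsub.lim := by
    refine Tendsto.limUnder_eq ?_
    have : (fun N : ℕ => (∫ ω, (passageTime (fun e => τ e ω) 0 ((N : ℝ) • x)).toReal ∂P) /
        (N : ℝ)) = fun n : ℕ => a n / n := by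
      ext N
      simp only [ha, meanTime, passageTime, restrictedTime_eq_ptTime, floorPt_zero,
        Set.preimage_univ]
    rw [this]
    exact hlim'
  rw [heq]
  exact hlim'

lemma timeConstant_nonneg (hτ : IsWeights P τ) (x : Space d) : 0 ≤ timeConstant P τ x :=
  ge_of_tendsto' (tendsto_timeConstant hτ x) fun _ => div_nonneg (meanTime_nonneg _) (by simp)

lemma timeConstant_smul_div (hτ : IsWeights P τ) (x : Space d) {p q : ℕ} (hp : p ≠ 0)
    (hq : q ≠ 0) :
    timeConstant P τ (((p : ℝ) / q) • x) = (p : ℝ) / q * timeConstant P τ x := by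
  have hp' : (p : ℝ) ≠ 0 := by exact_mod_cast hp
  have hq' : (q : ℝ) ≠ 0 := by exact_mod_cast hq
  have h1 := (tendsto_timeConstant hτ (((p : ℝ) / q) • x)).comp
    (tendsto_id.const_mul_atTop' (Nat.pos_of_ne_zero hq))
  have h2 := ((tendsto_timeConstant hτ x).comp
    (tendsto_id.const_mul_atTop' (Nat.pos_of_ne_zero hp))).const_mul ((p : ℝ) / q)
  refine tendsto_nhds_unique h1 (h2.congr fun N => ?_)
  simp only [Function.comp, id, smul_smul]
  have h3 : ((q * N : ℕ) : ℝ) * ((p : ℝ) / q) = ((p * N : ℕ) : ℝ) := by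
    push_cast; field_simp
  rw [h3]
  push_cast
  rcases eq_or_ne N 0 with rfl | hN
  · simp
  · field_simp

variable [NeZero d]

lemma inner_eq_of_mem_tangentPlane {b : OrthonormalBasis (Fin d) ℝ (Space d)} {u v : Space d}
    (hv : v ∈ tangentPlane b u) : inner ℝ (b 0) v = inner ℝ (b 0) u := by
  have h : ∀ w ∈ tangentSpace b, inner ℝ (b 0) w = 0 := by
    intro w hw
    induction hw using Submodule.span_induction with
    | mem x hx =>
      obtain ⟨i, hi, rfl⟩ := hx
      rw [b.inner_eq_ite, if_neg (Ne.symm hi)]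
    | zero => simp
    | add x y _ _ hx hy => rw [inner_add_right, hx, hy, add_zero]
    | smul a x _ hx => rw [inner_smul_right, hx, mul_zero]
  have := h _ hv
  rw [inner_sub_right] at this
  linarith

/-- On a tangent hyperplane at `u`, the time constant is minimal at `u`. -/
lemma timeConstant_le_of_mem_tangentPlane (hτ : IsWeights P τ) {u v : Space d}
    {b : OrthonormalBasis (Fin d) ℝ (Space d)} (hb : IsTangentFrame (timeConstant P τ) u b)
    (hv : v ∈ tangentPlane b u) : timeConstant P τ u ≤ timeConstant P τ v := by
  by_contra! hlt
  have h0 := timeConstant_nonneg hτ v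
  obtain ⟨q, hq⟩ := exists_nat_gt (timeConstant P τ v / (timeConstant P τ u - timeConstant P τ v))
  have hgap : 0 < timeConstant P τ u - timeConstant P τ v := by linarith
  have hq0 : (0 : ℝ) < q := lt_of_le_of_lt (by positivity) hq
  have hqne : q ≠ 0 := by rintro rfl; simp at hq0
  have hs := timeConstant_smul_div hτ v (p := q + 1) (q := q) (by omega) hqne
  have hle : timeConstant P τ ((((q + 1 : ℕ) : ℝ) / q) • v) ≤ timeConstant P τ u := by
    rw [hs, div_mul_eq_mul_div, div_le_iff₀ hq0]
    rw [div_lt_iff₀ hgap] at hq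
    push_cast
    linarith
  have h := hb.2 _ hle
  rw [inner_smul_right, inner_eq_of_mem_tangentPlane hv, div_mul_eq_mul_div, div_le_iff₀ hq0] at h
  push_cast at h
  nlinarith [hb.1]

end TimeConstant

/-! ### Coordinates adapted to a tilted cylinder -/

section Geometry

variable {d : ℕ}

lemma toSpace_add (x y : Fin d → ℤ) : toSpace (x + y) = toSpace x + toSpace y := by
  ext i; simp [toSpace]

lemma toSpace_sub (x y : Fin d → ℤ) : toSpace (x - y) = toSpace x - toSpace y := by
  ext i; simp [toSpace]

lemma toSpace_nsmul (k : ℕ) (x : Fin d → ℤ) : toSpace (k • x) = (k : ℝ) • toSpace x := by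
  ext i; simp [toSpace]

lemma norm_le_sum_abs (x : Space d) : ‖x‖ ≤ ∑ i, |x i| := by
  rw [EuclideanSpace.norm_eq]
  refine Real.sqrt_le_iff.2 ⟨Finset.sum_nonneg fun _ _ => abs_nonneg _, ?_⟩
  simp only [Real.norm_eq_abs]
  exact Finset.sum_sq_le_sq_sum_of_nonneg fun _ _ => abs_nonneg _

lemma norm_toSpace_sub_le (x y : Fin d → ℤ) : ‖toSpace y - toSpace x‖ ≤ l1 x y := by
  refine (norm_le_sum_abs _).trans (le_of_eq ?_)
  simp only [l1, toSpace, PiLp.sub_apply, Int.cast_sum, Int.cast_abs, Int.cast_sub]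
  exact Finset.sum_congr rfl fun i _ => abs_sub_comm _ _

lemma norm_floorPt_sub_le (x : Space d) : ‖toSpace (floorPt x) - x‖ ≤ d := by
  refine (norm_le_sum_abs _).trans ?_
  calc ∑ i, |(toSpace (floorPt x) - x) i| ≤ ∑ _i : Fin d, (1 : ℝ) := by
        refine Finset.sum_le_sum fun i _ => ?_
        have h1 := Int.floor_le (x i)
        have h2 := Int.lt_floor_add_one (x i)
        simp only [toSpace, floorPt, PiLp.sub_apply]
        rw [abs_le]; constructor <;> linarith
    _ = d := by simp

lemma abs_apply_le_norm (x : Space d) (i : Fin d) : |x i| ≤ ‖x‖ := by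
  simpa using PiLp.norm_apply_le x i

variable [NeZero d]

/-- The coordinate along `v` in the basis `v, ũ_2, …, ũ_d`. -/
noncomputable def axial (b : OrthonormalBasis (Fin d) ℝ (Space d)) (v : Space d) :
    Space d →ₗ[ℝ] ℝ :=
  (inner ℝ (b 0) v)⁻¹ • (innerₗ (Space d) (b 0))

/-- The coordinate along `ũ_i` in the basis `v, ũ_2, …, ũ_d`. -/
noncomputable def lateral (b : OrthonormalBasis (Fin d) ℝ (Space d)) (v : Space d) (i : Fin d) :
    Space d →ₗ[ℝ] ℝ :=
  innerₗ (Space d) (b i) - (inner ℝ (b i) v : ℝ) • axial b v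

variable {b : OrthonormalBasis (Fin d) ℝ (Space d)} {v : Space d}

lemma axial_apply (x : Space d) : axial b v x = (inner ℝ (b 0) v)⁻¹ * inner ℝ (b 0) x := rfl

lemma lateral_apply (i : Fin d) (x : Space d) :
    lateral b v i x = inner ℝ (b i) x - inner ℝ (b i) v * axial b v x := rfl

lemma axial_self (hv : inner ℝ (b 0) v ≠ (0 : ℝ)) : axial b v v = 1 := by
  rw [axial_apply, inv_mul_cancel₀ hv]

lemma lateral_self (hv : inner ℝ (b 0) v ≠ (0 : ℝ)) (i : Fin d) : lateral b v i v = 0 := by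
  rw [lateral_apply, axial_self hv]; ring

lemma axial_basis {j : Fin d} (hj : j ≠ 0) : axial b v (b j) = 0 := by
  rw [axial_apply, b.inner_eq_ite, if_neg (Ne.symm hj), mul_zero]

lemma lateral_basis (i : Fin d) {j : Fin d} (hj : j ≠ 0) :
    lateral b v i (b j) = if i = j then 1 else 0 := by
  rw [lateral_apply, axial_basis hj, b.inner_eq_ite]; ring

lemma axial_comb (y : Fin d → ℝ) :
    axial b v (∑ i ∈ Finset.univ.erase 0, y i • b i) = 0 := by
  rw [map_sum]
  refine Finset.sum_eq_zero fun i hi => ?_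
  rw [map_smul, axial_basis (Finset.ne_of_mem_erase hi), smul_zero]

lemma lateral_comb (y : Fin d → ℝ) {i : Fin d} (hi : i ≠ 0) :
    lateral b v i (∑ i ∈ Finset.univ.erase 0, y i • b i) = y i := by
  rw [map_sum, Finset.sum_eq_single_of_mem i (by simp [hi])]
  · rw [map_smul, lateral_basis i hi]; simp
  · intro j hj hji
    rw [map_smul, lateral_basis i (Finset.ne_of_mem_erase hj), if_neg (Ne.symm hji), smul_zero]

lemma eq_axial_add_lateral (hv : inner ℝ (b 0) v ≠ (0 : ℝ)) (x : Space d) :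
    x = axial b v x • v + ∑ i ∈ Finset.univ.erase 0, lateral b v i x • b i := by
  refine b.repr.injective (PiLp.ext fun j => ?_)
  rw [b.repr_apply_apply, b.repr_apply_apply, inner_add_right, inner_smul_right, inner_sum]
  simp only [inner_smul_right, b.inner_eq_ite]
  rcases eq_or_ne j 0 with rfl | hj
  · rw [Finset.sum_eq_zero, axial_apply]
    · field_simp; ring
    · intro i hi
      rw [if_neg (Ne.symm (Finset.ne_of_mem_erase hi)), mul_zero]
  · rw [Finset.sum_eq_single_of_mem j (by simp [hj])]
    · rw [lateral_apply, if_pos rfl]; ring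
    · intro i _ hij
      rw [if_neg (Ne.symm hij), mul_zero]

lemma mem_cyl_iff (hv : inner ℝ (b 0) v ≠ (0 : ℝ)) {I : Set ℝ} {h : ℝ} {x : Space d} :
    x ∈ cyl b v I h ↔ axial b v x ∈ I ∧ ∀ i, i ≠ 0 → |lateral b v i x| ≤ h := by
  constructor
  · rintro ⟨y, h0, hy, rfl⟩
    refine ⟨?_, fun i hi => ?_⟩
    · rw [map_add, axial_comb, map_smul, axial_self hv]; simpa using h0
    · rw [map_add, lateral_comb y hi, map_smul, lateral_self hv]; simpa using hy i hi
  · rintro ⟨h0, hy⟩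
    refine ⟨fun i => if i = 0 then axial b v x else lateral b v i x, by simpa using h0,
      fun i hi => by simpa [hi] using hy i hi, ?_⟩
    simp only [if_true]
    nth_rw 1 [eq_axial_add_lateral hv x]
    congr 1
    exact Finset.sum_congr rfl fun i hi => by simp [Finset.ne_of_mem_erase hi]

lemma mem_cyl_Icc_iff (hv : inner ℝ (b 0) v ≠ (0 : ℝ)) {l h : ℝ} {x : Space d} :
    x ∈ cyl b v (Set.Icc (-2 * l) (2 * l)) h ↔
      |axial b v x| ≤ 2 * l ∧ ∀ i, i ≠ 0 → |lateral b v i x| ≤ h := by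
  rw [mem_cyl_iff hv, Set.mem_Icc, abs_le, neg_mul]

lemma abs_axial_le (hv : 0 < (inner ℝ (b 0) v : ℝ)) (x : Space d) :
    |axial b v x| ≤ (inner ℝ (b 0) v)⁻¹ * ‖x‖ := by
  rw [axial_apply, abs_mul, abs_of_pos (inv_pos.2 hv)]
  refine mul_le_mul_of_nonneg_left ?_ (inv_pos.2 hv).le
  simpa using abs_real_inner_le_norm (b 0) x

lemma abs_lateral_le (hv : 0 < (inner ℝ (b 0) v : ℝ)) (i : Fin d) (x : Space d) :
    |lateral b v i x| ≤ (1 + ‖v‖ * (inner ℝ (b 0) v)⁻¹) * ‖x‖ := by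
  rw [lateral_apply]
  refine (abs_sub _ _).trans ?_
  have h1 : |(inner ℝ (b i) x : ℝ)| ≤ ‖x‖ := by simpa using abs_real_inner_le_norm (b i) x
  have h2 : |(inner ℝ (b i) v : ℝ)| ≤ ‖v‖ := by simpa using abs_real_inner_le_norm (b i) v
  rw [abs_mul]
  have h3 := mul_le_mul h2 (abs_axial_le hv x) (abs_nonneg _) (norm_nonneg _)
  linarith [mul_assoc ‖v‖ (inner ℝ (b 0) v)⁻¹ ‖x‖]

/-- A bound for the coordinates of a vector of norm at most `d`, uniform over the directions of
norm at most `3` in a tangent hyperplane. -/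
noncomputable def coordBound (b : OrthonormalBasis (Fin d) ℝ (Space d)) (u : Space d) : ℝ :=
  (1 + 4 * (inner ℝ (b 0) u)⁻¹) * d

lemma coordBound_pos (hu : 0 < (inner ℝ (b 0) v : ℝ)) : 0 < coordBound b v := by
  have : (0 : ℝ) < d := by exact_mod_cast Nat.pos_of_ne_zero (NeZero.ne d)
  unfold coordBound
  have := inv_pos.2 hu
  positivity

variable {u : Space d}

lemma abs_axial_le_coordBound (hu : 0 < (inner ℝ (b 0) u : ℝ)) (hv : v ∈ tangentPlane b u)
    {x : Space d} {c : ℝ} (hx : ‖x‖ ≤ c * d) : |axial b v x| ≤ c * coordBound b u := by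
  have hvu := inner_eq_of_mem_tangentPlane hv
  have h1 := abs_axial_le (b := b) (v := v) (hvu ▸ hu) x
  rw [hvu] at h1
  have hi := inv_pos.2 hu
  have hn := norm_nonneg x
  unfold coordBound
  have := mul_le_mul_of_nonneg_left hx (by positivity : 0 ≤ 1 + 4 * (inner ℝ (b 0) u : ℝ)⁻¹)
  nlinarith [mul_nonneg hi.le hn]

lemma abs_lateral_le_coordBound (hu : 0 < (inner ℝ (b 0) u : ℝ)) (hv : v ∈ tangentPlane b u)
    (hv3 : ‖v‖ ≤ 3) (i : Fin d) {x : Space d} {c : ℝ} (hx : ‖x‖ ≤ c * d) :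
    |lateral b v i x| ≤ c * coordBound b u := by
  have hvu := inner_eq_of_mem_tangentPlane hv
  have h1 := abs_lateral_le (b := b) (v := v) (hvu ▸ hu) i x
  rw [hvu] at h1
  have hi := inv_pos.2 hu
  have hn := norm_nonneg x
  unfold coordBound
  have := mul_le_mul_of_nonneg_left hx (by positivity : 0 ≤ 1 + 4 * (inner ℝ (b 0) u : ℝ)⁻¹)
  nlinarith [mul_nonneg hi.le hn, mul_le_mul_of_nonneg_right hv3 (mul_nonneg hi.le hn)]

/-- The passage time along a straight segment is at most linear in its length, in every
sufficiently wide cylinder. -/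
lemma restrictedTime_cyl_le (hu : 0 < (inner ℝ (b 0) u : ℝ)) (hv : v ∈ tangentPlane b u)
    (hv3 : ‖v‖ ≤ 3) {t : Edge d → ℝ≥0} {C : ℝ≥0} (hC : ∀ e, t e ≤ C) {K : ℕ} {h : ℝ}
    (hK : 5 * coordBound b u ≤ K) (hh : 5 * coordBound b u ≤ h) :
    restrictedTime t (cyl b v (Set.Icc (-2 * (K : ℝ)) (2 * K)) h) 0 ((K : ℝ) • v) ≤
      ENNReal.ofReal (4 * C * d * K) := by
  have hvu := inner_eq_of_mem_tangentPlane hv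
  have hv0 : (inner ℝ (b 0) v : ℝ) ≠ 0 := by rw [hvu]; exact hu.ne'
  rw [restrictedTime_eq_ptTime, floorPt_zero]
  have key : ∀ m : ℕ, m ≤ K → ptTime t
      (toSpace ⁻¹' (cyl b v (Set.Icc (-2 * (K : ℝ)) (2 * K)) h)) 0 (floorPt ((m : ℝ) • v)) ≤
        ENNReal.ofReal (4 * C * d * m) := by
    intro m
    induction m with
    | zero =>
      intro _
      have h0 : floorPt (((0 : ℕ) : ℝ) • v) = 0 := by simp [floorPt_zero]
      rw [h0]
      refine (ptTime_le t SimpleGraph.Walk.nil ?_).trans (by simp [pathTime])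
      intro z hz
      have : z = 0 := by simpa using hz
      subst this
      have hz0 : (toSpace (0 : Fin d → ℤ) : Space d) = 0 := by ext i; simp [toSpace]
      have hB := coordBound_pos hu
      rw [Set.mem_preimage, hz0, mem_cyl_Icc_iff hv0]
      simp only [map_zero, abs_zero]
      exact ⟨by positivity, fun _ _ => by linarith⟩
    | succ m ih =>
      intro hm
      refine (ptTime_triangle _ _ _ (floorPt ((m : ℝ) • v)) _).trans ?_
      have hl : l1 (floorPt ((m : ℝ) • v)) (floorPt (((m + 1 : ℕ) : ℝ) • v)) ≤ 4 * d := by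
        have : ∀ i, |floorPt ((m : ℝ) • v) i - floorPt (((m + 1 : ℕ) : ℝ) • v) i| ≤ 4 := by
          intro i
          simp only [floorPt, PiLp.smul_apply, smul_eq_mul, Nat.cast_add, Nat.cast_one, add_mul,
            one_mul]
          have hvi := abs_le.1 ((abs_apply_le_norm v i).trans hv3)
          have h1 : ⌊(m : ℝ) * v i + v i⌋ ≤ ⌊(m : ℝ) * v i⌋ + 4 := by
            rw [← Int.lt_add_one_iff, Int.floor_lt]
            push_cast
            linarith [Int.lt_floor_add_one ((m : ℝ) * v i)]
          have h2 : ⌊(m : ℝ) * v i⌋ - 4 ≤ ⌊(m : ℝ) * v i + v i⌋ := by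
            rw [Int.le_floor]
            push_cast
            linarith [Int.floor_le ((m : ℝ) * v i)]
          rw [abs_le]; constructor <;> omega
        calc l1 _ _ ≤ ∑ _i : Fin d, (4 : ℤ) := Finset.sum_le_sum fun i _ => this i
          _ = 4 * d := by simp [mul_comm]
      have hstep : ptTime t (toSpace ⁻¹' (cyl b v (Set.Icc (-2 * (K : ℝ)) (2 * K)) h))
          (floorPt ((m : ℝ) • v)) (floorPt (((m + 1 : ℕ) : ℝ) • v)) ≤
          ENNReal.ofReal (4 * C * d) := by
        refine (ptTime_le_l1 hC fun z hz => ?_).trans (ENNReal.ofReal_le_ofReal ?_)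
        · set e := toSpace z - (m : ℝ) • v with he
          have hez : toSpace z = (m : ℝ) • v + e := by rw [he]; abel
          have hen : ‖e‖ ≤ 5 * d := by
            have h1 := norm_toSpace_sub_le (floorPt ((m : ℝ) • v)) z
            have h2 := norm_floorPt_sub_le ((m : ℝ) • v)
            have h3 : e = (toSpace z - toSpace (floorPt ((m : ℝ) • v))) +
              (toSpace (floorPt ((m : ℝ) • v)) - (m : ℝ) • v) := by rw [he]; abel
            rw [h3]
            have h4 : (l1 (floorPt ((m : ℝ) • v)) z : ℝ) ≤ 4 * d := by exact_mod_cast hz.trans hl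
            linarith [norm_add_le (toSpace z - toSpace (floorPt ((m : ℝ) • v)))
              (toSpace (floorPt ((m : ℝ) • v)) - (m : ℝ) • v)]
          have hmK : (m : ℝ) + 1 ≤ K := by exact_mod_cast hm
          rw [Set.mem_preimage, hez, mem_cyl_Icc_iff hv0]
          refine ⟨?_, fun i _ => ?_⟩
          · have := abs_axial_le_coordBound hu hv hen
            rw [map_add, map_smul, axial_self hv0, smul_eq_mul, mul_one]
            refine (abs_add_le _ _).trans ?_
            rw [abs_of_nonneg (Nat.cast_nonneg m)]
            linarith
          · have := abs_lateral_le_coordBound hu hv hv3 i hen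
            rw [map_add, map_smul, lateral_self hv0, smul_zero, zero_add]
            linarith
        · have h4 : (l1 (floorPt ((m : ℝ) • v)) (floorPt (((m + 1 : ℕ) : ℝ) • v)) : ℝ) ≤ 4 * d := by
            exact_mod_cast hl
          have := mul_le_mul_of_nonneg_left h4 C.2
          simp only [NNReal.val_eq_coe] at this
          linarith
      refine (add_le_add (ih (by omega)) hstep).trans (le_of_eq ?_)
      rw [← ENNReal.ofReal_add (by positivity) (by positivity)]
      congr 1
      push_cast; ring
  exact key K le_rfl

end Geometry

/-! ### Concatenation of passage times along a tube -/

section Tube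

variable {d : ℕ}

lemma ptTime_chain {t : Edge d → ℝ≥0} {S : Set (Fin d → ℤ)} {z q : Fin d → ℤ} {n : ℕ} {p : ℕ → ℝ}
    (hp : ∀ k < n, 0 ≤ p k)
    (h : ∀ k < n, ptTime t S (z + k • q) (z + (k + 1) • q) ≤ ENNReal.ofReal (p k)) (hz : z ∈ S) :
    ptTime t S z (z + n • q) ≤ ENNReal.ofReal (∑ k ∈ Finset.range n, p k) := by
  induction n with
  | zero =>
    rw [zero_smul, add_zero]
    refine (ptTime_le t SimpleGraph.Walk.nil fun w hw => ?_).trans (by simp [pathTime])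
    have : w = z := by simpa using hw
    exact this ▸ hz
  | succ n ih =>
    rw [Finset.sum_range_succ, ENNReal.ofReal_add
      (Finset.sum_nonneg fun k hk => hp k (by have := Finset.mem_range.1 hk; omega)) (hp n (by omega))]
    exact (ptTime_triangle _ _ _ _ _).trans (add_le_add
      (ih (fun k hk => hp k (by omega)) fun k hk => h k (by omega)) (h n (by omega)))

variable [NeZero d] {b : OrthonormalBasis (Fin d) ℝ (Space d)} {u v : Space d}

/-- A lateral displacement with coordinates `y`. -/
noncomputable def displacement (b : OrthonormalBasis (Fin d) ℝ (Space d)) (y : Fin d → ℝ) :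
    Space d :=
  ∑ i ∈ Finset.univ.erase 0, y i • b i

lemma displacement_mem (y : Fin d → ℝ) : displacement b y ∈ tangentSpace b :=
  Submodule.sum_mem _ fun i hi => Submodule.smul_mem _ _
    (Submodule.subset_span ⟨i, Finset.ne_of_mem_erase hi, rfl⟩)

lemma axial_displacement (y : Fin d → ℝ) : axial b v (displacement b y) = 0 := axial_comb y

lemma lateral_displacement (y : Fin d → ℝ) {i : Fin d} (hi : i ≠ 0) :
    lateral b v i (displacement b y) = y i := lateral_comb y hi

lemma norm_displacement_le {y : Fin d → ℝ} {W : ℝ} (hy : ∀ i, i ≠ 0 → |y i| ≤ W) (hW : 0 ≤ W) :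
    ‖displacement b y‖ ≤ d * W := by
  refine (norm_sum_le _ _).trans ?_
  calc ∑ i ∈ Finset.univ.erase 0, ‖y i • b i‖ ≤ ∑ _i ∈ Finset.univ.erase (0 : Fin d), W := by
        refine Finset.sum_le_sum fun i hi => ?_
        rw [norm_smul, b.norm_eq_one, mul_one]
        exact hy i (Finset.ne_of_mem_erase hi)
    _ ≤ ∑ _i : Fin d, W :=
        Finset.sum_le_sum_of_subset_of_nonneg (Finset.erase_subset _ _) fun _ _ _ => hW
    _ = d * W := by simp

/-- Coordinates relative to `v` of a point of a cylinder with a perturbed axis. -/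
lemma coords_of_mem_cyl_add (hv : inner ℝ (b 0) v ≠ (0 : ℝ)) {y : Fin d → ℝ} {c l h : ℝ}
    {x : Space d} (hx : x ∈ cyl b (v + c • displacement b y) (Set.Icc (-2 * l) (2 * l)) h) :
    |axial b v x| ≤ 2 * l ∧ ∀ i, i ≠ 0 → |lateral b v i x| ≤ h + 2 * l * |c * y i| := by
  obtain ⟨a, h0, ha, rfl⟩ := hx
  have h0' : |a 0| ≤ 2 * l := by rw [abs_le]; simpa [neg_mul] using h0
  constructor
  · rw [map_add, axial_comb, map_smul, map_add, map_smul, axial_self hv, axial_displacement]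
    simpa using h0'
  · intro i hi
    rw [map_add, lateral_comb a hi, map_smul, map_add, map_smul, lateral_self hv,
      lateral_displacement y hi]
    simp only [smul_eq_mul, zero_add]
    rw [add_comm]
    refine (abs_add_le _ _).trans (add_le_add (ha i hi) ?_)
    rw [abs_mul]
    exact mul_le_mul_of_nonneg_right h0' (abs_nonneg _)

lemma add_smul_displacement_mem (hv : v ∈ tangentPlane b u) (c : ℝ) (y : Fin d → ℝ) :
    v + c • displacement b y ∈ tangentPlane b u := by
  have h : (v - u) + c • displacement b y ∈ tangentSpace b :=
    Submodule.add_mem _ hv (Submodule.smul_mem _ _ (displacement_mem y))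
  change v + c • displacement b y - u ∈ tangentSpace b
  rwa [add_sub_right_comm]

/-- The passage time in a tilted cylinder is bounded by the sum of the passage times along a tube
which fans out at the beginning and fans in at the end. -/
lemma restrictedTime_le_tube (hu : 0 < (inner ℝ (b 0) u : ℝ)) (hv : v ∈ tangentPlane b u)
    (hv3 : ‖v‖ ≤ 3) {t : Edge d → ℝ≥0} {C : ℝ≥0} (hC : ∀ e, t e ≤ C) {N K R R' n : ℕ}
    (hN : R + n * K + R' = N) (hR : 0 < R) (hR' : 0 < R') (hKN : 4 * K ≤ N) (hRN : 2 * R' ≤ N)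
    {h hR₁ hR₂ W : ℝ} (hhN : h ≤ N) (hB : (2 * n + 4) * coordBound b u ≤ h / 4)
    (hR₁h : hR₁ ≤ h / 2) (hR₂h : hR₂ ≤ h / 2) (hWh : W ≤ h / 16)
    {y : Fin d → ℝ} (hy : ∀ i, i ≠ 0 → |y i| ≤ W)
    {p : ℕ → ℝ} {a₁ a₂ : ℝ} (ha₁ : 0 ≤ a₁) (ha₂ : 0 ≤ a₂) (hp : ∀ k < n, 0 ≤ p k)
    (h₁ : restrictedTime t (cyl b (v + (R : ℝ)⁻¹ • displacement b y)
      (Set.Icc (-2 * (R : ℝ)) (2 * R)) hR₁) 0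
      ((R : ℝ) • (v + (R : ℝ)⁻¹ • displacement b y)) ≤ ENNReal.ofReal a₁)
    (h₂ : ∀ k < n, ∃ s ≤ h / 2, ptTime t {z | z - (floorPt ((R : ℝ) • v + displacement b y) +
        k • floorPt ((K : ℝ) • v)) ∈ toSpace ⁻¹' (cyl b v (Set.Icc (-2 * (K : ℝ)) (2 * K)) s)}
      (0 + (floorPt ((R : ℝ) • v + displacement b y) + k • floorPt ((K : ℝ) • v)))
      (floorPt ((K : ℝ) • v) +
        (floorPt ((R : ℝ) • v + displacement b y) + k • floorPt ((K : ℝ) • v))) ≤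
        ENNReal.ofReal (p k))
    (h₃ : ptTime t {z | z - (floorPt ((N : ℝ) • v) -
          floorPt ((R' : ℝ) • (v + (-(R' : ℝ)⁻¹) • displacement b y))) ∈
        toSpace ⁻¹' (cyl b (v + (-(R' : ℝ)⁻¹) • displacement b y)
          (Set.Icc (-2 * (R' : ℝ)) (2 * R')) hR₂)}
      (0 + (floorPt ((N : ℝ) • v) -
          floorPt ((R' : ℝ) • (v + (-(R' : ℝ)⁻¹) • displacement b y))))
      (floorPt ((R' : ℝ) • (v + (-(R' : ℝ)⁻¹) • displacement b y)) + (floorPt ((N : ℝ) • v) -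
          floorPt ((R' : ℝ) • (v + (-(R' : ℝ)⁻¹) • displacement b y)))) ≤ ENNReal.ofReal a₂) :
    restrictedTime t (cyl b v (Set.Icc (-2 * (N : ℝ)) (2 * N)) h) 0 ((N : ℝ) • v) ≤
      ENNReal.ofReal (a₁ + ∑ k ∈ Finset.range n, p k + C * (d * (n + 3)) + a₂) := by
  have hvu := inner_eq_of_mem_tangentPlane hv
  have hv0 : (inner ℝ (b 0) v : ℝ) ≠ 0 := by rw [hvu]; exact hu.ne'
  have hBpos := coordBound_pos hu
  set B := coordBound b u with hBdef
  set w := displacement b y with hw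
  have hR0 : (0 : ℝ) < R := by exact_mod_cast hR
  have hR'0 : (0 : ℝ) < R' := by exact_mod_cast hR'
  have hNr : (R : ℝ) + n * K + R' = N := by exact_mod_cast hN
  have hKNr : 4 * (K : ℝ) ≤ N := by exact_mod_cast hKN
  have hRNr : 2 * (R' : ℝ) ≤ N := by exact_mod_cast hRN
  have hn0 : (0 : ℝ) ≤ n := Nat.cast_nonneg n
  have hK0 : (0 : ℝ) ≤ K := Nat.cast_nonneg K
  have hnB : 0 ≤ n * B := by positivity
  have hRw : (R : ℝ) • (v + (R : ℝ)⁻¹ • w) = (R : ℝ) • v + w := by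
    rw [smul_add, smul_smul, mul_inv_cancel₀ hR0.ne', one_smul]
  have hRw' : (R' : ℝ) • (v + (-(R' : ℝ)⁻¹) • w) = (R' : ℝ) • v - w := by
    rw [smul_add, smul_smul, mul_neg, mul_inv_cancel₀ hR'0.ne', neg_smul, one_smul, sub_eq_add_neg]
  rw [hRw] at h₁
  rw [hRw'] at h₃
  set S : Set (Fin d → ℤ) := toSpace ⁻¹' (cyl b v (Set.Icc (-2 * (N : ℝ)) (2 * N)) h) with hS
  have memS : ∀ z : Fin d → ℤ, |axial b v (toSpace z)| ≤ 2 * N →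
      (∀ i, i ≠ 0 → |lateral b v i (toSpace z)| ≤ h) → z ∈ S := fun z hz1 hz2 =>
    (mem_cyl_Icc_iff hv0).2 ⟨hz1, hz2⟩
  set z₀ := floorPt ((R : ℝ) • v + w) with hz₀
  set q := floorPt ((K : ℝ) • v) with hq
  set z₁ := floorPt ((N : ℝ) • v) - floorPt ((R' : ℝ) • v - w) with hz₁
  set e₁ := toSpace z₀ - ((R : ℝ) • v + w) with he₁
  set e₂ := toSpace q - (K : ℝ) • v with he₂
  set e₃ := toSpace (floorPt ((N : ℝ) • v)) - (N : ℝ) • v with he₃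
  set e₄ := toSpace (floorPt ((R' : ℝ) • v - w)) - ((R' : ℝ) • v - w) with he₄
  have hne₁ : ‖e₁‖ ≤ d := norm_floorPt_sub_le _
  have hne₂ : ‖e₂‖ ≤ d := norm_floorPt_sub_le _
  have hne₃ : ‖e₃‖ ≤ d := norm_floorPt_sub_le _
  have hne₄ : ‖e₄‖ ≤ d := norm_floorPt_sub_le _
  have hd0 : (0 : ℝ) ≤ d := Nat.cast_nonneg d
  have hchain : ∀ k : ℕ, k ≤ n → ∃ e : Space d, ‖e‖ ≤ (1 + n) * d ∧
      toSpace (z₀ + k • q) = ((R : ℝ) + k * K) • v + w + e := by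
    intro k hk
    have hkn : (k : ℝ) ≤ n := by exact_mod_cast hk
    refine ⟨e₁ + (k : ℝ) • e₂, ?_, ?_⟩
    · refine (norm_add_le _ _).trans ?_
      rw [norm_smul, Real.norm_of_nonneg (Nat.cast_nonneg k)]
      have := mul_le_mul hkn hne₂ (norm_nonneg _) hn0
      linarith
    · rw [toSpace_add, toSpace_nsmul, he₁, he₂, smul_sub, smul_smul, add_smul]; abel
  have hend : ∃ e : Space d, ‖e‖ ≤ 2 * d ∧
      toSpace z₁ = ((N : ℝ) - R') • v + w + e := by
    refine ⟨e₃ - e₄, (norm_sub_le _ _).trans (by linarith), ?_⟩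
    rw [hz₁, toSpace_sub, he₃, he₄, sub_smul]; abel
  have memAff : ∀ (z : Fin d → ℤ) (x e : Space d) (c r s c' : ℝ), ‖e‖ ≤ c' * d →
      toSpace z = c • v + w + e + x → |axial b v x| ≤ r →
      (∀ i, i ≠ 0 → |lateral b v i x| ≤ s) → 0 ≤ c → c + c' * B + r ≤ 2 * N →
      W + c' * B + s ≤ h → z ∈ S := by
    intro z x e c r s c' he hz hr hs hc h1 h2
    have ha := abs_axial_le_coordBound hu hv he
    refine memS z ?_ fun i hi => ?_
    · rw [hz, map_add, map_add, map_add, map_smul, axial_self hv0, hw, axial_displacement,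
        smul_eq_mul, mul_one, add_zero]
      refine (abs_add_le _ _).trans ((add_le_add (abs_add_le _ _) le_rfl).trans ?_)
      rw [abs_of_nonneg hc]
      linarith
    · have hl := abs_lateral_le_coordBound hu hv hv3 i he
      rw [hz, map_add, map_add, map_add, map_smul, lateral_self hv0, hw,
        lateral_displacement y hi, smul_zero, zero_add]
      refine (abs_add_le _ _).trans ((add_le_add (abs_add_le _ _) le_rfl).trans ?_)
      linarith [hy i hi, hs i hi]
  -- the beginning
  have step₁ : ptTime t S 0 z₀ ≤ ENNReal.ofReal a₁ := by
    rw [restrictedTime_eq_ptTime, floorPt_zero] at h₁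
    refine le_trans (ptTime_anti t (fun z hz => ?_) _ _) h₁
    obtain ⟨h1, h2⟩ := coords_of_mem_cyl_add hv0 hz
    refine memS z (h1.trans ?_) fun i hi => (h2 i hi).trans ?_
    · nlinarith [mul_nonneg hn0 hK0]
    · rw [abs_mul, abs_of_pos (inv_pos.2 hR0), mul_assoc, ← mul_assoc (R : ℝ),
        mul_inv_cancel₀ hR0.ne', one_mul]
      linarith [hy i hi, abs_nonneg (y i)]
  -- the pieces
  have step₂ : ptTime t S z₀ (z₀ + n • q) ≤ ENNReal.ofReal (∑ k ∈ Finset.range n, p k) := by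
    refine ptTime_chain hp (fun k hk => ?_) ?_
    · obtain ⟨s, hs, hk'⟩ := h₂ k hk
      obtain ⟨e, he, hek⟩ := hchain k hk.le
      have hkn : (k : ℝ) ≤ n := by exact_mod_cast hk.le
      have heq : z₀ + (k + 1) • q = q + (z₀ + k • q) := by rw [add_smul, one_smul]; abel
      rw [zero_add] at hk'
      rw [heq]
      refine (ptTime_anti t (fun z hz => ?_) _ _).trans hk'
      obtain ⟨hx1, hx2⟩ := (mem_cyl_Icc_iff hv0).1 (show toSpace (z - (z₀ + k • q)) ∈ _ from hz)
      refine memAff z (toSpace (z - (z₀ + k • q))) e (R + k * K) _ _ _ he ?_ hx1 hx2 (by positivity) ?_ ?_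
      · rw [toSpace_sub, ← hek]; abel
      · have := mul_le_mul_of_nonneg_right hkn hK0
        linarith
      · linarith
    · obtain ⟨e, he, hek⟩ := hchain 0 (Nat.zero_le _)
      rw [zero_smul, add_zero] at hek
      refine memAff z₀ 0 e _ 0 0 _ he (by rw [add_zero]; exact hek) (by simp) (by simp)
        (by simp) ?_ ?_
      · push_cast; nlinarith [mul_nonneg hn0 hK0]
      · linarith
  -- the connection
  have step₃ : ptTime t S (z₀ + n • q) z₁ ≤ ENNReal.ofReal (C * (d * (n + 3))) := by
    have hl : l1 (z₀ + n • q) z₁ ≤ d * (n + 3) := by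
      have : ∀ i, |(z₀ + n • q) i - z₁ i| ≤ (n + 3 : ℤ) := by
        intro i
        have hflo : ∀ x : Space d, |((floorPt x i : ℤ) : ℝ) - x i| ≤ 1 := fun x => by
          have h1 := Int.floor_le (x i)
          have h2 := Int.lt_floor_add_one (x i)
          simp only [floorPt]
          rw [abs_le]; constructor <;> linarith
        have f1 := abs_le.1 (hflo ((R : ℝ) • v + w))
        have f2 := abs_le.1 (hflo ((K : ℝ) • v))
        have f3 := abs_le.1 (hflo ((N : ℝ) • v))
        have f4 := abs_le.1 (hflo ((R' : ℝ) • v - w))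
        rw [← hz₀] at f1
        rw [← hq] at f2
        simp only [PiLp.add_apply, PiLp.sub_apply, PiLp.smul_apply, smul_eq_mul] at f1 f2 f3 f4
        have hcast : (((z₀ + n • q) i - z₁ i : ℤ) : ℝ) = z₀ i + n * q i -
            (floorPt ((N : ℝ) • v) i - floorPt ((R' : ℝ) • v - w) i) := by
          simp [hz₁]
        have hb : |(((z₀ + n • q) i - z₁ i : ℤ) : ℝ)| ≤ n + 3 := by
          rw [hcast]
          have g1 := mul_le_mul_of_nonneg_left f2.1 hn0
          have g2 := mul_le_mul_of_nonneg_left f2.2 hn0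
          have hNv : (N : ℝ) * v i = R * v i + n * (K * v i) + R' * v i := by rw [← hNr]; ring
          rw [abs_le]; constructor <;> linarith
        exact_mod_cast hb
      calc l1 _ _ ≤ ∑ _i : Fin d, (n + 3 : ℤ) := Finset.sum_le_sum fun i _ => this i
        _ = d * (n + 3) := by simp
    have hlr : (l1 (z₀ + n • q) z₁ : ℝ) ≤ d * (n + 3) := by exact_mod_cast hl
    refine (ptTime_le_l1 hC fun z hz => ?_).trans
      (ENNReal.ofReal_le_ofReal (mul_le_mul_of_nonneg_left hlr C.2))
    obtain ⟨e, he, hek⟩ := hchain n le_rfl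
    have hzl : ‖toSpace z - toSpace (z₀ + n • q)‖ ≤ d * (n + 3) :=
      (norm_toSpace_sub_le _ _).trans (by exact_mod_cast hz.trans hl)
    refine memAff z 0 (e + (toSpace z - toSpace (z₀ + n • q))) (R + n * K) 0 0 (2 * n + 4)
      ((norm_add_le _ _).trans (by linarith)) (by rw [hek]; abel) (by simp) (by simp)
      (by positivity) ?_ ?_
    · linarith
    · linarith
  -- the end
  have step₄ : ptTime t S z₁ (floorPt ((N : ℝ) • v)) ≤ ENNReal.ofReal a₂ := by
    obtain ⟨e, he, hee⟩ := hend
    rw [zero_add, add_sub_cancel] at h₃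
    refine (ptTime_anti t (fun z hz => ?_) _ _).trans h₃
    obtain ⟨hx1, hx2⟩ := coords_of_mem_cyl_add hv0 (show toSpace (z - z₁) ∈ _ from hz)
    refine memAff z (toSpace (z - z₁)) e (N - R') (2 * R') (hR₂ + 2 * W) 2 he ?_ hx1
      (fun i hi => (hx2 i hi).trans ?_) (by linarith) ?_ ?_
    · rw [toSpace_sub, ← hee]; abel
    · rw [abs_mul, abs_neg, abs_of_pos (inv_pos.2 hR'0), mul_assoc, ← mul_assoc (R' : ℝ),
        mul_inv_cancel₀ hR'0.ne', one_mul]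
      linarith [hy i hi]
    · linarith
    · linarith
  have hps : 0 ≤ ∑ k ∈ Finset.range n, p k :=
    Finset.sum_nonneg fun k hk => hp k (Finset.mem_range.1 hk)
  rw [restrictedTime_eq_ptTime, floorPt_zero, ENNReal.ofReal_add (by positivity) ha₂,
    ENNReal.ofReal_add (by positivity) (by positivity), ENNReal.ofReal_add ha₁ hps]
  refine (ptTime_triangle _ _ _ z₁ _).trans (add_le_add ?_ step₄)
  refine (ptTime_triangle _ _ _ (z₀ + n • q) _).trans (add_le_add ?_ step₃)
  exact (ptTime_triangle _ _ _ z₀ _).trans (add_le_add step₁ step₂)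

end Tube

/-! ### Many tubes -/

section Core

variable {d : ℕ} {Ω : Type*} [MeasurableSpace Ω] [NeZero d]

/-- The event that the passage time from `0` to `N v`, in a tilted cylinder of half-width
`√ζ N`, exceeds `N μ(v)` by more than `ζ N`. -/
def slow (P : Measure Ω) (τ : Edge d → Ω → ℝ≥0) (b : OrthonormalBasis (Fin d) ℝ (Space d))
    (N : ℕ) (ζ : ℝ) (v : Space d) : Set Ω :=
  {ω | ENNReal.ofReal (N * timeConstant P τ v + ζ * N) <
    restrictedTime (fun e => τ e ω) (cyl b v (Set.Icc (-2 * (N : ℝ)) (2 * N)) (√ζ * N)) 0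
      ((N : ℝ) • v)}

/-- The event `slow`, translated by a lattice vector. -/
def slowAt (P : Measure Ω) (τ : Edge d → Ω → ℝ≥0) (b : OrthonormalBasis (Fin d) ℝ (Space d))
    (N : ℕ) (ζ : ℝ) (v : Space d) (z : Fin d → ℤ) : Set Ω :=
  {ω | ENNReal.ofReal (N * timeConstant P τ v + ζ * N) <
    ptTime (fun e => τ e ω)
      {w | w - z ∈ toSpace ⁻¹' (cyl b v (Set.Icc (-2 * (N : ℝ)) (2 * N)) (√ζ * N))}
      (0 + z) (floorPt ((N : ℝ) • v) + z)}

variable {P : Measure Ω} [IsProbabilityMeasure P] {τ : Edge d → Ω → ℝ≥0}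
  {b : OrthonormalBasis (Fin d) ℝ (Space d)} {u v : Space d}

lemma prob_slowAt (hτ : IsWeights P τ) (N : ℕ) (ζ : ℝ) (v : Space d) (z : Fin d → ℤ) :
    P.real (slowAt P τ b N ζ v z) = P.real (slow P τ b N ζ v) := by
  rw [slowAt, prob_ptTime_shift hτ, slow]
  simp only [restrictedTime_eq_ptTime, floorPt_zero]

/-- The indices of the tubes. -/
def tubeIndex (d : ℕ) [NeZero d] (M : ℕ) : Finset (Fin d → ℕ) :=
  Fintype.piFinset fun i => if i = 0 then {0} else Finset.range M

lemma mem_tubeIndex {M : ℕ} {j : Fin d → ℕ} :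
    j ∈ tubeIndex d M ↔ j 0 = 0 ∧ ∀ i, i ≠ 0 → j i < M := by
  simp only [tubeIndex, Fintype.mem_piFinset]
  constructor
  · intro h
    exact ⟨by simpa using h 0, fun i hi => by simpa [hi] using h i⟩
  · rintro ⟨h0, h⟩ i
    by_cases hi : i = 0
    · subst hi; simp [h0]
    · simpa [hi] using h i hi

lemma card_tubeIndex (M : ℕ) : (tubeIndex d M).card = M ^ (d - 1) := by
  rw [tubeIndex, Fintype.card_piFinset,
    ← Finset.mul_prod_erase _ _ (Finset.mem_univ (0 : Fin d)), if_pos rfl, Finset.card_singleton,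
    one_mul, Finset.prod_congr rfl (g := fun _ => M)
      (fun i hi => by rw [if_neg (Finset.ne_of_mem_erase hi), Finset.card_range])]
  simp

/-- The lateral offset of a tube. -/
noncomputable def tubeOffset (b : OrthonormalBasis (Fin d) ℝ (Space d)) (σ : ℝ) (j : Fin d → ℕ) :
    Space d := displacement b fun i => σ * j i

/-- The starting point of the `k`-th piece of the `j`-th tube. -/
noncomputable def pieceStart (b : OrthonormalBasis (Fin d) ℝ (Space d)) (v : Space d) (R K : ℕ)
    (σ : ℝ) (a : ℕ × (Fin d → ℕ)) : Fin d → ℤ :=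
  floorPt ((R : ℝ) • v + tubeOffset b σ a.2) + a.1 • floorPt ((K : ℝ) • v)

/-- The region of a piece. -/
def pieceRegion (b : OrthonormalBasis (Fin d) ℝ (Space d)) (v : Space d) (K : ℕ) (s : ℝ)
    (z : Fin d → ℤ) : Set (Fin d → ℤ) :=
  {w | w - z ∈ toSpace ⁻¹' (cyl b v (Set.Icc (-2 * (K : ℝ)) (2 * K)) s)}

lemma disjoint_pieceRegion (hu : 0 < (inner ℝ (b 0) u : ℝ)) (hv : v ∈ tangentPlane b u)
    (hv3 : ‖v‖ ≤ 3) {R K c : ℕ} {σ s : ℝ} (hσ : 0 ≤ σ) (hK : 8 * coordBound b u ≤ K)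
    (hc : 2 * s + 2 * coordBound b u < c * σ) {a a' : ℕ × (Fin d → ℕ)} (ha0 : a.2 0 = 0)
    (ha0' : a'.2 0 = 0) (hne : a ≠ a') (h1 : a.1 % 5 = a'.1 % 5)
    (h2 : ∀ i, a.2 i % c = a'.2 i % c) :
    Disjoint (pieceRegion b v K s (pieceStart b v R K σ a))
      (pieceRegion b v K s (pieceStart b v R K σ a')) := by
  have hvu := inner_eq_of_mem_tangentPlane hv
  have hv0 : (inner ℝ (b 0) v : ℝ) ≠ 0 := by rw [hvu]; exact hu.ne'
  have hBpos := coordBound_pos hu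
  set B := coordBound b u
  rw [Set.disjoint_left]
  intro z hz hz'
  obtain ⟨k, j⟩ := a
  obtain ⟨k', j'⟩ := a'
  change k % 5 = k' % 5 at h1
  change ∀ i, j i % c = j' i % c at h2
  obtain ⟨hx1, hx2⟩ := (mem_cyl_Icc_iff hv0).1
    (show toSpace (z - pieceStart b v R K σ (k, j)) ∈ _ from hz)
  obtain ⟨hy1, hy2⟩ := (mem_cyl_Icc_iff hv0).1
    (show toSpace (z - pieceStart b v R K σ (k', j')) ∈ _ from hz')
  have hdiff : toSpace (z - pieceStart b v R K σ (k', j')) -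
      toSpace (z - pieceStart b v R K σ (k, j)) =
      toSpace (pieceStart b v R K σ (k, j)) - toSpace (pieceStart b v R K σ (k', j')) := by
    rw [toSpace_sub, toSpace_sub]; abel
  set e := toSpace (floorPt ((R : ℝ) • v + tubeOffset b σ j)) -
    ((R : ℝ) • v + tubeOffset b σ j) with he
  set e' := toSpace (floorPt ((R : ℝ) • v + tubeOffset b σ j')) -
    ((R : ℝ) • v + tubeOffset b σ j') with he'
  set f := toSpace (floorPt ((K : ℝ) • v)) - (K : ℝ) • v with hf
  have hen : ‖e‖ ≤ 1 * d := by rw [one_mul]; exact norm_floorPt_sub_le _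
  have hen' : ‖e'‖ ≤ 1 * d := by rw [one_mul]; exact norm_floorPt_sub_le _
  have hfn : ‖f‖ ≤ 1 * d := by rw [one_mul]; exact norm_floorPt_sub_le _
  have hstart : ∀ (k : ℕ) (j : Fin d → ℕ), toSpace (pieceStart b v R K σ (k, j)) =
      ((R : ℝ) + k * K) • v + tubeOffset b σ j +
        (toSpace (floorPt ((R : ℝ) • v + tubeOffset b σ j)) -
        ((R : ℝ) • v + tubeOffset b σ j)) + (k : ℝ) • f := by
    intro k j
    rw [pieceStart, toSpace_add, toSpace_nsmul, hf, smul_sub, smul_smul, add_smul]; abel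
  rw [hstart, hstart, ← he, ← he'] at hdiff
  have hax := congrArg (axial b v) hdiff
  simp only [map_sub, map_add, map_smul, axial_self hv0, tubeOffset, axial_displacement,
    smul_eq_mul, mul_one, add_zero] at hax
  have eax := abs_le.1 (abs_axial_le_coordBound hu hv hen)
  have eax' := abs_le.1 (abs_axial_le_coordBound hu hv hen')
  have fax := abs_le.1 (abs_axial_le_coordBound hu hv hfn)
  have hx1' := abs_le.1 hx1
  have hy1' := abs_le.1 hy1
  by_cases hk : k = k'
  · subst hk
    obtain ⟨i, hi⟩ : ∃ i, j i ≠ j' i := by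
      by_contra! h
      exact hne (by rw [funext h])
    have hi0 : i ≠ 0 := by rintro rfl; exact hi (ha0.trans ha0'.symm)
    have hlat := congrArg (lateral b v i) hdiff
    simp only [map_sub, map_add, map_smul, lateral_self hv0, tubeOffset,
      lateral_displacement _ hi0, smul_eq_mul, mul_zero, zero_add] at hlat
    have el := abs_le.1 (abs_lateral_le_coordBound hu hv hv3 i hen)
    have el' := abs_le.1 (abs_lateral_le_coordBound hu hv hv3 i hen')
    have hx2' := abs_le.1 (hx2 i hi0)
    have hy2' := abs_le.1 (hy2 i hi0)
    have hsep : j i + c ≤ j' i ∨ j' i + c ≤ j i := by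
      rcases lt_or_gt_of_ne hi with hlt | hlt
      · left
        have := Nat.le_of_dvd (by omega) ((Nat.modEq_iff_dvd' hlt.le).1 (h2 i))
        omega
      · right
        have := Nat.le_of_dvd (by omega) ((Nat.modEq_iff_dvd' hlt.le).1 (h2 i).symm)
        omega
    rcases hsep with h | h
    · have h' : (j i : ℝ) + c ≤ j' i := by exact_mod_cast h
      have := mul_le_mul_of_nonneg_right h' hσ
      linarith
    · have h' : (j' i : ℝ) + c ≤ j i := by exact_mod_cast h
      have := mul_le_mul_of_nonneg_right h' hσ
      linarith
  · have hsep : k + 5 ≤ k' ∨ k' + 5 ≤ k := by omega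
    rcases hsep with h | h
    · have h' : (k : ℝ) + 5 ≤ k' := by exact_mod_cast h
      have g1 := mul_le_mul_of_nonneg_right h' (by linarith : 0 ≤ (K : ℝ) - B)
      have g2 := mul_le_mul_of_nonneg_left fax.1 (by linarith : 0 ≤ (k' : ℝ) - k)
      have g3 := mul_le_mul_of_nonneg_left fax.2 (by linarith : 0 ≤ (k' : ℝ) - k)
      nlinarith
    · have h' : (k' : ℝ) + 5 ≤ k := by exact_mod_cast h
      have g1 := mul_le_mul_of_nonneg_right h' (by linarith : 0 ≤ (K : ℝ) - B)
      have g2 := mul_le_mul_of_nonneg_left fax.1 (by linarith : 0 ≤ (k : ℝ) - k')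
      have g3 := mul_le_mul_of_nonneg_left fax.2 (by linarith : 0 ≤ (k : ℝ) - k')
      nlinarith

/-- Among the pieces, `m` separated ones are slow. -/
def manySlow (P : Measure Ω) (τ : Edge d → Ω → ℝ≥0) (b : OrthonormalBasis (Fin d) ℝ (Space d))
    (v : Space d) (R K : ℕ) (σ ζ : ℝ) (G : Finset (ℕ × (Fin d → ℕ))) (m : ℕ) : Set Ω :=
  {ω | ∃ A ∈ G.powersetCard m, (A : Set (ℕ × (Fin d → ℕ))).PairwiseDisjoint
      (fun a => pieceRegion b v K (√ζ * K) (pieceStart b v R K σ a)) ∧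
    ∀ a ∈ A, ω ∈ slowAt P τ b K ζ v (pieceStart b v R K σ a)}

lemma prob_manySlow_le (hτ : IsWeights P τ) (v : Space d) (R K : ℕ) (σ ζ : ℝ)
    (G : Finset (ℕ × (Fin d → ℕ))) (m : ℕ) :
    P.real (manySlow P τ b v R K σ ζ G m) ≤
      (G.card.choose m : ℝ) * P.real (slow P τ b K ζ v) ^ m := by
  classical
  set 𝒜 := (G.powersetCard m).filter fun A : Finset (ℕ × (Fin d → ℕ)) => (A : Set (ℕ × (Fin d → ℕ))).PairwiseDisjoint
      (fun a => pieceRegion b v K (√ζ * K) (pieceStart b v R K σ a)) with h𝒜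
  have hsub : manySlow P τ b v R K σ ζ G m ⊆
      ⋃ A ∈ 𝒜, ⋂ a ∈ A, slowAt P τ b K ζ v (pieceStart b v R K σ a) := by
    rintro ω ⟨A, hA, hd, hs⟩
    exact Set.mem_iUnion₂.2 ⟨A, Finset.mem_filter.2 ⟨hA, hd⟩, Set.mem_iInter₂.2 hs⟩
  refine (measureReal_mono hsub (measure_ne_top _ _)).trans ((measureReal_biUnion_finset_le _ _).trans ?_)
  have hterm : ∀ A ∈ 𝒜, P.real (⋂ a ∈ A, slowAt P τ b K ζ v (pieceStart b v R K σ a)) =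
      P.real (slow P τ b K ζ v) ^ m := by
    intro A hA
    obtain ⟨hA, hd⟩ := Finset.mem_filter.1 hA
    have h := prob_iInter_ptTime hτ
      (fun a => pieceRegion b v K (√ζ * K) (pieceStart b v R K σ a))
      (fun a => 0 + pieceStart b v R K σ a)
      (fun a => floorPt ((K : ℝ) • v) + pieceStart b v R K σ a)
      (fun _ => ENNReal.ofReal (K * timeConstant P τ v + ζ * K)) A hd
    refine (h.trans (Finset.prod_congr rfl
      (g := fun _ => P.real (slow P τ b K ζ v)) fun a _ => prob_slowAt hτ K ζ v _)).trans ?_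
    rw [Finset.prod_const, (Finset.mem_powersetCard.1 hA).2]
  rw [Finset.sum_congr rfl hterm, Finset.sum_const, nsmul_eq_mul]
  refine mul_le_mul_of_nonneg_right ?_ (by positivity)
  exact_mod_cast (Finset.card_filter_le _ _).trans (Finset.card_powersetCard _ _).le

omit [IsProbabilityMeasure P] in
/-- Extraction of separated slow pieces by the pigeonhole principle. -/
lemma mem_manySlow_of_card (hu : 0 < (inner ℝ (b 0) u : ℝ)) (hv : v ∈ tangentPlane b u)
    (hv3 : ‖v‖ ≤ 3) {R K c n M m : ℕ} {σ ζ : ℝ} (hσ : 0 ≤ σ) (hK : 8 * coordBound b u ≤ K)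
    (hc0 : 0 < c) (hc : 2 * (√ζ * K) + 2 * coordBound b u < c * σ) {ω : Ω}
    {F : Finset (ℕ × (Fin d → ℕ))} (hF : F ⊆ Finset.range n ×ˢ tubeIndex d M)
    (hFs : ∀ a ∈ F, ω ∈ slowAt P τ b K ζ v (pieceStart b v R K σ a))
    (hm : 5 * c ^ (d - 1) * (m - 1) < F.card) :
    ω ∈ manySlow P τ b v R K σ ζ (Finset.range n ×ˢ tubeIndex d M) m := by
  classical
  obtain ⟨y, _, hy⟩ := Finset.exists_lt_card_fiber_of_mul_lt_card_of_maps_to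
    (s := F) (t := Finset.range 5 ×ˢ tubeIndex d c)
    (f := fun a => (a.1 % 5, fun i => a.2 i % c)) (n := m - 1)
    (fun a ha => by
      have ha' := mem_tubeIndex.1 (Finset.mem_product.1 (hF ha)).2
      refine Finset.mem_product.2 ⟨Finset.mem_range.2 (Nat.mod_lt _ (by norm_num)),
        mem_tubeIndex.2 ⟨?_, fun i _ => Nat.mod_lt _ hc0⟩⟩
      simp [ha'.1])
    (by rwa [Finset.card_product, card_tubeIndex, Finset.card_range])
  obtain ⟨A, hA, hAm⟩ := Finset.exists_subset_card_eq (show m ≤ _ by omega)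
    (s := F.filter fun a => (a.1 % 5, fun i => a.2 i % c) = y)
  have hAF : A ⊆ F := hA.trans (Finset.filter_subset _ _)
  refine ⟨A, Finset.mem_powersetCard.2 ⟨hAF.trans hF, hAm⟩, ?_, fun a ha => hFs a (hAF ha)⟩
  intro a ha a' ha' hne
  have h1 := (Finset.mem_filter.1 (hA ha)).2
  have h2 := (Finset.mem_filter.1 (hA ha')).2
  have h3 := h1.trans h2.symm
  have hi := fun {x} (hx : x ∈ A) => mem_tubeIndex.1 (Finset.mem_product.1 (hF (hAF hx))).2
  exact disjoint_pieceRegion hu hv hv3 hσ hK hc (hi ha).1 (hi ha').1 hne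
    (congrArg Prod.fst h3) (fun i => congrFun (congrArg Prod.snd h3) i)

end Core

section Tubes

variable {d : ℕ} {Ω : Type*} [MeasurableSpace Ω] [NeZero d]
  {P : Measure Ω} [IsProbabilityMeasure P] {τ : Edge d → Ω → ℝ≥0}
  {b : OrthonormalBasis (Fin d) ℝ (Space d)} {u v : Space d}

/-- The passage time of a piece, in terms of the first level at which it is not slow. -/
lemma exists_piece_le (hτ : IsWeights P τ) (hu : 0 < (inner ℝ (b 0) u : ℝ))
    (hv : v ∈ tangentPlane b u) (hv3 : ‖v‖ ≤ 3) {ω : Ω} {C : ℝ≥0} (hC : ∀ e, τ e ω ≤ C)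
    {K J : ℕ} {lev del : ℕ → ℝ} {h : ℝ} (hK : 8 * coordBound b u ≤ K)
    (hlev : ∀ i ≤ J, 0 ≤ lev i) (hlevh : ∀ i ≤ J, √(lev i) * K ≤ h / 2)
    (hlev5 : 5 * coordBound b u ≤ √(lev 0) * K)
    (hdel : ∀ i < J, lev (i + 1) * K ≤ del i) (hdelJ : 4 * C * d * K ≤ del J) (z : Fin d → ℤ)
    (D : ℝ) (hD0 : lev 0 * K ≤ D)
    (hD : ∀ i ≤ J, ω ∈ slowAt P τ b K (lev i) v z → lev 0 * K + del i ≤ D) :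
    ∃ s ≤ h / 2, ptTime (fun e => τ e ω)
      {w | w - z ∈ toSpace ⁻¹' (cyl b v (Set.Icc (-2 * (K : ℝ)) (2 * K)) s)}
      (0 + z) (floorPt ((K : ℝ) • v) + z) ≤ ENNReal.ofReal (K * timeConstant P τ v + D) := by
  classical
  have hμ := timeConstant_nonneg hτ v
  have hB := coordBound_pos hu
  have hK0 : (0 : ℝ) ≤ K := Nat.cast_nonneg K
  by_cases hex : ∃ i, i ≤ J ∧ ω ∉ slowAt P τ b K (lev i) v z
  · obtain ⟨hi, hns⟩ := Nat.find_spec hex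
    have hmin := fun k (hk : k < Nat.find hex) => Nat.find_min hex hk
    set i := Nat.find hex
    refine ⟨√(lev i) * K, hlevh i hi, (not_lt.1 hns).trans (ENNReal.ofReal_le_ofReal ?_)⟩
    rcases Nat.eq_zero_or_pos i with h0 | hpos
    · rw [h0]; linarith
    · obtain ⟨i', hi'⟩ : ∃ i', i = i' + 1 := ⟨i - 1, by omega⟩
      have hs : ω ∈ slowAt P τ b K (lev i') v z := by
        by_contra hcon
        exact hmin i' (by omega) ⟨by omega, hcon⟩
      have h1 := hD i' (by omega) hs
      have h2 := hdel i' (by omega)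
      have h3 := mul_nonneg (hlev 0 (Nat.zero_le _)) hK0
      rw [hi']
      linarith
  · push Not at hex
    refine ⟨√(lev 0) * K, hlevh 0 (Nat.zero_le _), ?_⟩
    have h1 := restrictedTime_cyl_le (b := b) (u := u) (v := v) hu hv hv3
      (t := fun e => τ (shiftEdge z e) ω) (C := C) (fun e => hC _) (K := K) (h := √(lev 0) * K)
      (by linarith) hlev5
    rw [restrictedTime_eq_ptTime, floorPt_zero] at h1
    have h2 := ptTime_shift (fun e => τ e ω) z
      (toSpace ⁻¹' (cyl b v (Set.Icc (-2 * (K : ℝ)) (2 * K)) (√(lev 0) * K))) 0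
      (floorPt ((K : ℝ) • v))
    have h3 := hD J le_rfl (hex J le_rfl)
    have h4 := mul_nonneg (hlev 0 (Nat.zero_le _)) hK0
    have h5 := mul_nonneg hK0 hμ
    refine (h2.le.trans h1).trans (ENNReal.ofReal_le_ofReal ?_)
    linarith

/-- If the passage time is large, then the beginning or the end of some tube is slow, or there are
many slow pieces. -/
lemma prob_slow_le_tubes (hτ : IsWeights P τ) (hu : 0 < (inner ℝ (b 0) u : ℝ))
    (hv : v ∈ tangentPlane b u)
    (hv3 : ‖v‖ ≤ 3) {C : ℝ≥0} (hC : ∀ᵐ ω ∂P, ∀ e, τ e ω ≤ C)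
    {N K R R' n M J : ℕ} {ζ σ : ℝ} {lev del f : ℕ → ℝ} {c m : ℕ → ℕ}
    (hN : R + n * K + R' = N) (hR : 0 < R) (hR' : 0 < R') (hM : 0 < M) (hKN : 4 * K ≤ N)
    (hRN : 2 * R' ≤ N) (hζ0 : 0 ≤ ζ) (hζ1 : ζ ≤ 1) (hσ : 0 ≤ σ)
    (hB : (2 * n + 4) * coordBound b u ≤ √ζ * N / 4)
    (hR₁ : √(ζ * N / (16 * R)) * R ≤ √ζ * N / 2)
    (hR₂ : √(ζ * N / (16 * R')) * R' ≤ √ζ * N / 2)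
    (hW : σ * M ≤ √ζ * N / 16) (hK : 8 * coordBound b u ≤ K)
    (hcurv : ∀ j ∈ tubeIndex d M,
      R * timeConstant P τ (v + (R : ℝ)⁻¹ • tubeOffset b σ j) +
        R' * timeConstant P τ (v + (-(R' : ℝ)⁻¹) • tubeOffset b σ j) ≤
          (R + R') * timeConstant P τ v + ζ * N / 4)
    (hconn : C * (d * (n + 3)) ≤ ζ * N / 16)
    (hlev : ∀ i ≤ J, 0 ≤ lev i) (hlev0 : lev 0 * K * n ≤ ζ * N / 16)
    (hlevh : ∀ i ≤ J, √(lev i) * K ≤ √ζ * N / 2)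
    (hlev5 : 5 * coordBound b u ≤ √(lev 0) * K)
    (hdel : ∀ i < J, lev (i + 1) * K ≤ del i) (hdelJ : 4 * C * d * K ≤ del J)
    (hf0 : ∀ i ≤ J, 0 < f i)
    (hf : ∀ i ≤ J, f i * del i ≤ ζ * N / (16 * (J + 1)) ∨ f i ≤ 1)
    (hc0 : ∀ i ≤ J, 0 < c i)
    (hc : ∀ i ≤ J, 2 * (√(lev i) * K) + 2 * coordBound b u < c i * σ)
    (hm1 : ∀ i ≤ J, 1 ≤ m i)
    (hm : ∀ i ≤ J, 5 * (c i : ℝ) ^ (d - 1) * (m i - 1) < M ^ (d - 1) * f i / (J + 1)) :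
    P.real (slow P τ b N ζ v) ≤
      ∑ j ∈ tubeIndex d M,
        (P.real (slow P τ b R (ζ * N / (16 * R)) (v + (R : ℝ)⁻¹ • tubeOffset b σ j)) +
          P.real (slow P τ b R' (ζ * N / (16 * R')) (v + (-(R' : ℝ)⁻¹) • tubeOffset b σ j))) +
      ∑ i ∈ Finset.range (J + 1),
        ((n * M ^ (d - 1)).choose (m i) : ℝ) * P.real (slow P τ b K (lev i) v) ^ m i := by
  classical
  set G := Finset.range n ×ˢ tubeIndex d M with hG
  have hGcard : G.card = n * M ^ (d - 1) := by
    rw [hG, Finset.card_product, Finset.card_range, card_tubeIndex]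
  have hμ := timeConstant_nonneg (P := P) hτ
  have hR0 : (0 : ℝ) < R := by exact_mod_cast hR
  have hR'0 : (0 : ℝ) < R' := by exact_mod_cast hR'
  have hK0 : (0 : ℝ) ≤ K := Nat.cast_nonneg K
  have hN0 : (0 : ℝ) ≤ N := Nat.cast_nonneg N
  have hJ0 : (0 : ℝ) < (J : ℝ) + 1 := by positivity
  have hζN : 0 ≤ ζ * N := mul_nonneg hζ0 hN0
  set zend : (Fin d → ℕ) → Fin d → ℤ := fun j => floorPt ((N : ℝ) • v) -
    floorPt ((R' : ℝ) • (v + (-(R' : ℝ)⁻¹) • tubeOffset b σ j)) with hzend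
  have hsub : slow P τ b N ζ v ⊆ {ω | ¬ ∀ e, τ e ω ≤ C} ∪
      ((⋃ j ∈ tubeIndex d M,
        (slow P τ b R (ζ * N / (16 * R)) (v + (R : ℝ)⁻¹ • tubeOffset b σ j) ∪
          slowAt P τ b R' (ζ * N / (16 * R')) (v + (-(R' : ℝ)⁻¹) • tubeOffset b σ j) (zend j))) ∪
      ⋃ i ∈ Finset.range (J + 1), manySlow P τ b v R K σ (lev i) G (m i)) := by
    intro ω hω
    by_contra hcon
    simp only [Set.mem_union, not_or, Set.mem_ofPred_eq, not_not, Set.mem_iUnion, not_exists,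
      exists_prop, not_and] at hcon
    obtain ⟨hCω, hnear, hmany⟩ := hcon
    set cnt : ℕ → (Fin d → ℕ) → ℕ := fun i j => ((Finset.range n).filter fun k =>
      ω ∈ slowAt P τ b K (lev i) v (pieceStart b v R K σ (k, j))).card with hcnt
    have hFi : ∀ i ≤ J, (∑ j ∈ tubeIndex d M, (cnt i j : ℝ)) < M ^ (d - 1) * f i / (J + 1) := by
      intro i hi
      set F := G.filter fun a => ω ∈ slowAt P τ b K (lev i) v (pieceStart b v R K σ a) with hF
      have hcardF : F.card = ∑ j ∈ tubeIndex d M, cnt i j := by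
        rw [hF, Finset.card_filter, hG, Finset.sum_product_right]
        exact Finset.sum_congr rfl fun j _ => (Finset.card_filter _ _).symm
      have hle : F.card ≤ 5 * c i ^ (d - 1) * (m i - 1) := by
        by_contra! hlt
        exact hmany i (Finset.mem_range.2 (by omega)) (mem_manySlow_of_card (P := P) hu hv hv3 hσ hK
          (hc0 i hi) (hc i hi) (Finset.filter_subset _ _)
          (fun a ha => (Finset.mem_filter.1 ha).2) hlt)
      have hle' : (F.card : ℝ) ≤ 5 * (c i : ℝ) ^ (d - 1) * (m i - 1) := by
        have : ((m i - 1 : ℕ) : ℝ) = (m i : ℝ) - 1 := by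
          rw [Nat.cast_sub (hm1 i hi), Nat.cast_one]
        rw [← this]
        exact_mod_cast hle
      have := hle'.trans_lt (hm i hi)
      rw [hcardF] at this
      exact_mod_cast this
    obtain ⟨j, hj, hjlt⟩ : ∃ j ∈ tubeIndex d M,
        ∑ i ∈ Finset.range (J + 1), (cnt i j : ℝ) / f i < 1 := by
      refine Finset.exists_lt_of_sum_lt ?_
      rw [Finset.sum_comm, Finset.sum_const, card_tubeIndex, nsmul_eq_mul, mul_one]
      have hM0 : (0 : ℝ) < M := by exact_mod_cast hM
      calc ∑ i ∈ Finset.range (J + 1), ∑ j ∈ tubeIndex d M, (cnt i j : ℝ) / f i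
          < ∑ i ∈ Finset.range (J + 1), (M : ℝ) ^ (d - 1) / (J + 1) := by
            refine Finset.sum_lt_sum_of_nonempty ⟨0, by simp⟩ fun i hi => ?_
            have hi' : i ≤ J := by have := Finset.mem_range.1 hi; omega
            rw [← Finset.sum_div, div_lt_iff₀ (hf0 i hi')]
            refine (hFi i hi').trans_le (le_of_eq ?_)
            ring
        _ = ((M ^ (d - 1) : ℕ) : ℝ) := by
            rw [Finset.sum_const, Finset.card_range, nsmul_eq_mul]
            push_cast
            field_simp
    have hcntlt : ∀ i ≤ J, (cnt i j : ℝ) < f i := by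
      intro i hi
      have hfi := hf0 i hi
      rw [← div_lt_one hfi]
      refine lt_of_le_of_lt ?_ hjlt
      exact Finset.single_le_sum (f := fun i => (cnt i j : ℝ) / f i)
        (fun i' hi' => div_nonneg (Nat.cast_nonneg _)
          (hf0 i' (by have := Finset.mem_range.1 hi'; omega)).le) (Finset.mem_range.2 (by omega))
    have hdel0 : ∀ i ≤ J, 0 ≤ del i := by
      intro i hi
      rcases hi.lt_or_eq with hlt | rfl
      · exact (mul_nonneg (hlev (i + 1) hlt) hK0).trans (hdel i hlt)
      · exact le_trans (by positivity) hdelJ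
    obtain ⟨hn1, hn2⟩ := hnear j hj
    set D : ℕ → ℝ := fun k => lev 0 * K + ∑ i ∈ Finset.range (J + 1),
      if ω ∈ slowAt P τ b K (lev i) v (pieceStart b v R K σ (k, j)) then del i else 0 with hD
    have hterm0 : ∀ k, ∀ i ∈ Finset.range (J + 1), 0 ≤
        if ω ∈ slowAt P τ b K (lev i) v (pieceStart b v R K σ (k, j)) then del i else 0 := by
      intro k i hi
      split_ifs
      · exact hdel0 i (by have := Finset.mem_range.1 hi; omega)
      · exact le_rfl
    have hlevK := mul_nonneg (hlev 0 (Nat.zero_le _)) hK0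
    have hD0 : ∀ k, lev 0 * K ≤ D k := fun k =>
      le_add_of_nonneg_right (Finset.sum_nonneg (hterm0 k))
    have hsum : ∑ k ∈ Finset.range n, D k ≤ ζ * N / 8 := by
      have h1 : ∑ k ∈ Finset.range n, D k = n * (lev 0 * K) +
          ∑ i ∈ Finset.range (J + 1), (cnt i j : ℝ) * del i := by
        simp only [hD]
        rw [Finset.sum_add_distrib, Finset.sum_const, Finset.card_range, nsmul_eq_mul,
          Finset.sum_comm]
        congr 1
        refine Finset.sum_congr rfl fun i _ => ?_
        rw [← Finset.sum_filter, Finset.sum_const, nsmul_eq_mul]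
      have h2 : ∑ i ∈ Finset.range (J + 1), (cnt i j : ℝ) * del i ≤
          ∑ i ∈ Finset.range (J + 1), ζ * N / (16 * (J + 1)) := by
        refine Finset.sum_le_sum fun i hi => ?_
        have hi' : i ≤ J := by have := Finset.mem_range.1 hi; omega
        rcases hf i hi' with hfi | hfi
        · exact (mul_le_mul_of_nonneg_right (hcntlt i hi').le (hdel0 i hi')).trans hfi
        · have h0 : cnt i j = 0 := by
            have h := (hcntlt i hi').trans_le hfi
            have : cnt i j < 1 := by exact_mod_cast h
            omega
          rw [h0, Nat.cast_zero, zero_mul]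
          positivity
      have h3 : ∑ i ∈ Finset.range (J + 1), ζ * N / (16 * ((J : ℝ) + 1)) = ζ * N / 16 := by
        rw [Finset.sum_const, Finset.card_range, nsmul_eq_mul]
        push_cast
        field_simp
      rw [h1]
      linarith [h3 ▸ h2]
    have hy : ∀ i, i ≠ 0 → |σ * (j i : ℝ)| ≤ σ * M := by
      intro i hi
      rw [abs_of_nonneg (by positivity)]
      exact mul_le_mul_of_nonneg_left (by exact_mod_cast ((mem_tubeIndex.1 hj).2 i hi).le) hσ
    have hsqrt : √ζ * N ≤ N := by
      have : √ζ ≤ 1 := Real.sqrt_le_one.2 hζ1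
      nlinarith
    have key := restrictedTime_le_tube hu hv hv3 hCω hN hR hR' hKN hRN hsqrt hB hR₁ hR₂ hW hy
      (p := fun k => K * timeConstant P τ v + D k)
      (add_nonneg (mul_nonneg hR0.le (hμ _)) (by positivity))
      (add_nonneg (mul_nonneg hR'0.le (hμ _)) (by positivity))
      (fun k _ => add_nonneg (mul_nonneg hK0 (hμ v)) (hlevK.trans (hD0 k))) (not_lt.1 hn1)
      (fun k _ => exists_piece_le hτ hu hv hv3 hCω hK hlev hlevh hlev5 hdel hdelJ
        (pieceStart b v R K σ (k, j)) (D k) (hD0 k) (fun i hi hs => by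
          refine add_le_add_right ?_ _
          have h := Finset.single_le_sum (hterm0 k) (Finset.mem_range.2 (by omega : i < J + 1))
          rwa [if_pos hs] at h)) (not_lt.1 hn2)
    refine absurd (lt_of_lt_of_le hω key) (not_lt.2 (ENNReal.ofReal_le_ofReal ?_))
    have e1 : ζ * N / (16 * R) * R = ζ * N / 16 := by field_simp
    have e2 : ζ * N / (16 * R') * R' = ζ * N / 16 := by field_simp
    have e3 : ∑ k ∈ Finset.range n, (K * timeConstant P τ v + D k) =
        n * (K * timeConstant P τ v) + ∑ k ∈ Finset.range n, D k := by
      rw [Finset.sum_add_distrib, Finset.sum_const, Finset.card_range, nsmul_eq_mul]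
    have e4 : (N : ℝ) = R + n * K + R' := by exact_mod_cast hN.symm
    have e5 : (N : ℝ) * timeConstant P τ v = (R + R') * timeConstant P τ v +
      n * (K * timeConstant P τ v) := by rw [e4]; ring
    have hcj := hcurv j hj
    rw [e1, e2, e3, e5]
    linarith
  have hnull : P.real {ω | ¬ ∀ e, τ e ω ≤ C} = 0 := by
    rw [Measure.real, ae_iff.1 hC, ENNReal.toReal_zero]
  refine (measureReal_mono hsub (measure_ne_top _ _)).trans ?_
  refine (measureReal_union_le _ _).trans ?_
  rw [hnull, zero_add]
  refine (measureReal_union_le _ _).trans (add_le_add ?_ ?_)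
  · refine (measureReal_biUnion_finset_le _ _).trans (Finset.sum_le_sum fun j _ => ?_)
    exact (measureReal_union_le _ _).trans (add_le_add le_rfl (prob_slowAt hτ _ _ _ _).le)
  · refine (measureReal_biUnion_finset_le _ _).trans (Finset.sum_le_sum fun i _ => ?_)
    rw [← hGcard]
    exact prob_manySlow_le hτ _ _ _ _ _ _ _

end Tubes

section Reduction

lemma choose_mul_pow_le {G : ℕ} {x p ℓ : ℝ} (hx : 0 < x) (hG : 0 < G) (hp0 : 0 ≤ p)
    (hp : p ≤ Real.exp (-ℓ)) (hℓ0 : 0 ≤ ℓ) (hℓ : 2 * (1 + Real.log (G / x)) ≤ ℓ) :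
    (G.choose ⌈x⌉₊ : ℝ) * p ^ ⌈x⌉₊ ≤ Real.exp (-(x * ℓ / 2)) := by
  set m := ⌈x⌉₊ with hm
  have hmx : x ≤ m := Nat.le_ceil x
  have hm0 : (0 : ℝ) < m := hx.trans_le hmx
  have hG0 : (0 : ℝ) < G := by exact_mod_cast hG
  have h1 : (G.choose m : ℝ) ≤ (G : ℝ) ^ m / m.factorial := Nat.choose_le_pow_div m G
  have h2 : (m : ℝ) ^ m / m.factorial ≤ Real.exp m := Real.pow_div_factorial_le_exp _ hm0.le m
  have hfac : (0 : ℝ) < m.factorial := by exact_mod_cast m.factorial_pos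
  have h3 : (G.choose m : ℝ) ≤ (Real.exp 1 * (G / x)) ^ m := by
    refine h1.trans ?_
    rw [mul_pow, ← Real.exp_nat_mul, mul_one, div_pow]
    have h4 : (G : ℝ) ^ m / m.factorial = (m : ℝ) ^ m / m.factorial * ((G : ℝ) ^ m / (m : ℝ) ^ m) := by
      field_simp
    rw [h4]
    refine mul_le_mul h2 ?_ (by positivity) (by positivity)
    exact div_le_div_of_nonneg_left (by positivity) (by positivity) (pow_le_pow_left₀ hx.le hmx _)
  have h5 : Real.exp 1 * (G / x) = Real.exp (1 + Real.log (G / x)) := by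
    rw [Real.exp_add, Real.exp_log (by positivity)]
  calc (G.choose m : ℝ) * p ^ m ≤ (Real.exp 1 * (G / x)) ^ m * Real.exp (-ℓ) ^ m :=
        mul_le_mul h3 (pow_le_pow_left₀ hp0 hp m) (by positivity) (by positivity)
    _ = Real.exp (m * (1 + Real.log (G / x) - ℓ)) := by
        rw [← mul_pow, h5, ← Real.exp_add, ← Real.exp_nat_mul]; ring_nf
    _ ≤ Real.exp (-(x * ℓ / 2)) := by
        refine Real.exp_le_exp.2 ?_
        have : (m : ℝ) * (1 + Real.log (G / x) - ℓ) ≤ m * (-(ℓ / 2)) :=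
          mul_le_mul_of_nonneg_left (by linarith) hm0.le
        have := mul_le_mul_of_nonneg_right hmx (by linarith : 0 ≤ ℓ / 2)
        linarith

lemma sqrt_div_mul_le {ζ N R : ℝ} (hζ : 0 ≤ ζ) (hR : 0 < R) (hRN : R ≤ N) :
    √(ζ * N / (16 * R)) * R ≤ √ζ * N / 2 := by
  have hN : 0 < N := hR.trans_le hRN
  have h : √(ζ * N / (16 * R)) ≤ √ζ * N / (2 * R) := by
    rw [Real.sqrt_le_left (by positivity), div_pow, mul_pow, Real.sq_sqrt hζ,
      div_le_div_iff₀ (by positivity) (by positivity)]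
    have h1 : ζ * N * (R * R) ≤ ζ * N * (N * R) :=
      mul_le_mul_of_nonneg_left (mul_le_mul_of_nonneg_right hRN hR.le) (by positivity)
    have h2 : 0 ≤ ζ * N * (N * R) := by positivity
    nlinarith
  calc √(ζ * N / (16 * R)) * R ≤ √ζ * N / (2 * R) * R := mul_le_mul_of_nonneg_right h hR.le
    _ = √ζ * N / 2 := by field_simp

variable {d : ℕ} {Ω : Type*} [MeasurableSpace Ω] [NeZero d]
  {P : Measure Ω} [IsProbabilityMeasure P] {τ : Edge d → Ω → ℝ≥0}
  {b : OrthonormalBasis (Fin d) ℝ (Space d)} {u v : Space d}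

lemma mul_timeConstant_le (hτ : IsWeights P τ) (hb : IsTangentFrame (timeConstant P τ) u b)
    {C' : ℝ} (hC'0 : 0 < C')
    (hC' : ∀ w ∈ tangentSpace b, timeConstant P τ (u + w) - timeConstant P τ u ≤ C' * ‖w‖ ^ 2)
    (hv : v ∈ tangentPlane b u) {w : Space d} (hw : v + w ∈ tangentPlane b u) {R : ℝ}
    (hR : 0 ≤ R) :
    R * timeConstant P τ (v + w) ≤
      R * timeConstant P τ v + 2 * C' * (R * ‖v - u‖ ^ 2 + R * ‖w‖ ^ 2) := by
  have h1 := hC' _ hw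
  have h2 := timeConstant_le_of_mem_tangentPlane hτ hb hv
  rw [add_sub_cancel] at h1
  have h3 : ‖v + w - u‖ ≤ ‖v - u‖ + ‖w‖ := by
    rw [add_sub_right_comm]; exact norm_add_le _ _
  have h4 : ‖v + w - u‖ ^ 2 ≤ 2 * (‖v - u‖ ^ 2 + ‖w‖ ^ 2) := by
    have := pow_le_pow_left₀ (norm_nonneg _) h3 2
    nlinarith [sq_nonneg (‖v - u‖ - ‖w‖)]
  have h5 := mul_le_mul_of_nonneg_left h4 hC'0.le
  have h6 : timeConstant P τ (v + w) ≤ timeConstant P τ v +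
      C' * (2 * (‖v - u‖ ^ 2 + ‖w‖ ^ 2)) := by linarith
  have := mul_le_mul_of_nonneg_left h6 hR
  linarith

/-- The upper bounds for the numbers of separated slow pieces, in closed form. -/
lemma level_estimate {e J n M c G : ℕ} {N K ζ lev ρ Γ c' s g ℓ f p Q : ℝ} (hN : 0 < N) (hK : 0 < K)
    (hζ : 0 < ζ) (hζ1 : ζ ≤ 1) (hlev : ζ / 16 ≤ lev) (hlev1 : lev ≤ 1) (hρ1 : 0 < ρ)
    (hρ : ρ ≤ 16 / ζ) (hρJ : ρ ≤ (ζ ^ (1 / (J : ℝ)))⁻¹)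
    (hΓ1 : 1 ≤ Γ) (hc' : 0 < c') (hs : 0 < s) (hn : (n : ℝ) * K ≤ N) (hn0 : 0 < n)
    (hM : c' * √s * N / K ≤ M) (hc0 : 0 < c) (hc : (c : ℝ) ≤ 10 * √(lev / ζ))
    (hf : f = ζ * N / (16 * (J + 1) * K * lev * ρ * Γ))
    (hgl : g ≤ √(ζ / lev) ^ (e + 2) * ℓ) (hG : G = n * M ^ e) (hp0 : 0 ≤ p)
    (hp : p ≤ Real.exp (-ℓ))
    (hQ : 2 * (1 + Real.log (1280 * (J + 1) ^ 2 * Γ * 10 ^ e) + (e + 2)) ≤ Q)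
    (hℓ : Q * (1 + Real.log (1 / ζ)) ≤ ℓ) (hℓ0 : 0 ≤ ℓ)
    (x : ℝ) (hx : x = M ^ e * f / ((J + 1) * (5 * c ^ e))) :
    (G.choose ⌈x⌉₊ : ℝ) * p ^ ⌈x⌉₊ ≤
      Real.exp (-(c' ^ e / (160 * (J + 1) ^ 2 * Γ * 10 ^ e) * g *
        (√s ^ e * (N / K) ^ (e + 1) * ζ ^ (1 / (J : ℝ))))) := by
  have hΓ : 0 < Γ := by linarith
  have hJ : (0 : ℝ) < (J : ℝ) + 1 := by positivity
  have hlev0 : 0 < lev := lt_of_lt_of_le (by positivity) hlev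
  have hf0 : 0 < f := by rw [hf]; positivity
  have hM0 : (0 : ℝ) < M := lt_of_lt_of_le (by positivity) hM
  have hcr : (0 : ℝ) < c := by exact_mod_cast hc0
  have hnr : (0 : ℝ) < n := by exact_mod_cast hn0
  have hx0 : 0 < x := by rw [hx]; positivity
  have hGr : (G : ℝ) = n * M ^ e := by rw [hG]; push_cast; ring
  have hG0 : 0 < G := by
    have : (0 : ℝ) < G := by rw [hGr]; positivity
    exact_mod_cast this
  set y := √(ζ / lev) with hy
  have hy0 : 0 < y := Real.sqrt_pos.2 (by positivity)
  have hy2 : y ^ 2 = ζ / lev := Real.sq_sqrt (by positivity)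
  have hry : √(lev / ζ) = y⁻¹ := by rw [hy, ← Real.sqrt_inv, inv_div]
  have hzl : ζ ≤ y ^ 2 := by
    rw [hy2, le_div_iff₀ hlev0]; nlinarith
  have hzy : ζ ≤ y := by
    by_contra! h
    nlinarith
  have hyinv : y⁻¹ ≤ ζ⁻¹ := inv_anti₀ hζ hzy
  have hcy : (c : ℝ) ^ e ≤ 10 ^ e * y⁻¹ ^ e := by
    rw [← mul_pow]; exact pow_le_pow_left₀ hcr.le (hry ▸ hc) _
  have hfy : f = y ^ 2 * (N / K) / (16 * (J + 1) * ρ * Γ) := by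
    rw [hf, hy2]; field_simp
  -- the ratio of the number of pieces to `x`
  have hratio : (G : ℝ) / x ≤ 1280 * (J + 1) ^ 2 * Γ * 10 ^ e * ζ⁻¹ ^ (e + 2) := by
    have h1 : (G : ℝ) / x = (n * K / N) * (80 * (J + 1) ^ 2 * Γ) * (c ^ e * ρ * (y⁻¹) ^ 2) := by
      rw [hGr, hx, hfy]; field_simp; ring
    rw [h1]
    have h2 : (n : ℝ) * K / N ≤ 1 := (div_le_one hN).2 hn
    have h3 : (c : ℝ) ^ e * ρ * (y⁻¹) ^ 2 ≤ (10 ^ e * ζ⁻¹ ^ e) * (16 / ζ) * ζ⁻¹ := by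
      have h4 : (c : ℝ) ^ e ≤ 10 ^ e * ζ⁻¹ ^ e := hcy.trans
        (mul_le_mul_of_nonneg_left (pow_le_pow_left₀ (by positivity) hyinv _) (by positivity))
      have h5 : (y⁻¹) ^ 2 ≤ ζ⁻¹ := by rw [inv_pow]; exact inv_anti₀ hζ hzl
      exact mul_le_mul (mul_le_mul h4 hρ hρ1.le (by positivity)) h5 (by positivity)
        (by positivity)
    calc (n * K / N) * (80 * (J + 1) ^ 2 * Γ) * (c ^ e * ρ * (y⁻¹) ^ 2)
        ≤ 1 * (80 * (J + 1) ^ 2 * Γ) * ((10 ^ e * ζ⁻¹ ^ e) * (16 / ζ) * ζ⁻¹) := by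
          refine mul_le_mul (mul_le_mul_of_nonneg_right h2 (by positivity)) h3 (by positivity)
            (by positivity)
      _ = 1280 * (J + 1) ^ 2 * Γ * 10 ^ e * ζ⁻¹ ^ (e + 2) := by
          rw [pow_add, pow_two]; ring
  have hlog0 : 0 ≤ Real.log (1 / ζ) := Real.log_nonneg (by rw [le_div_iff₀ hζ]; linarith)
  have hlogratio : Real.log (G / x) ≤ Real.log (1280 * (J + 1) ^ 2 * Γ * 10 ^ e) +
      (e + 2) * Real.log (1 / ζ) := by
    refine (Real.log_le_log (div_pos (by exact_mod_cast hG0) hx0) hratio).trans (le_of_eq ?_)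
    rw [Real.log_mul (by positivity) (by positivity), Real.log_pow, one_div]
    push_cast; ring
  refine (choose_mul_pow_le hx0 hG0 hp0 hp hℓ0 ?_).trans (Real.exp_le_exp.2 (neg_le_neg ?_))
  · refine le_trans ?_ hℓ
    have hlc : 0 ≤ Real.log (1280 * (J + 1) ^ 2 * Γ * 10 ^ e) := by
      refine Real.log_nonneg ?_
      have h1 : (1 : ℝ) ≤ 1280 := by norm_num
      have h2 : (1 : ℝ) ≤ ((J : ℝ) + 1) ^ 2 := one_le_pow₀ (by linarith [Nat.cast_nonneg (α := ℝ) J])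
      have h3 : (1 : ℝ) ≤ 10 ^ e := one_le_pow₀ (by norm_num)
      exact one_le_mul_of_one_le_of_one_le (one_le_mul_of_one_le_of_one_le
        (one_le_mul_of_one_le_of_one_le h1 h2) hΓ1) h3
    have h2 := mul_le_mul_of_nonneg_right hQ (by linarith : 0 ≤ 1 + Real.log (1 / ζ))
    have h3 := mul_nonneg hlc hlog0
    have he : (0 : ℝ) ≤ e := Nat.cast_nonneg e
    linarith
  · have hxl : c' ^ e / (80 * (J + 1) ^ 2 * Γ * 10 ^ e) * (√s ^ e * (N / K) ^ (e + 1) *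
        (y ^ (e + 2) * ρ⁻¹)) ≤ x := by
      rw [hx, hfy, le_div_iff₀ (by positivity)]
      have h1 : (c' * √s * N / K) ^ e ≤ (M : ℝ) ^ e := pow_le_pow_left₀ (by positivity) hM _
      have h2 : (M : ℝ) ^ e * (y ^ 2 * (N / K) / (16 * (J + 1) * ρ * Γ)) ≥
          (c' * √s * N / K) ^ e * (y ^ 2 * (N / K) / (16 * (J + 1) * ρ * Γ)) :=
        mul_le_mul_of_nonneg_right h1 (by positivity)
      refine le_trans ?_ h2
      calc c' ^ e / (80 * (J + 1) ^ 2 * Γ * 10 ^ e) * (√s ^ e * (N / K) ^ (e + 1) *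
            (y ^ (e + 2) * ρ⁻¹)) * ((J + 1) * (5 * c ^ e))
          ≤ c' ^ e / (80 * (J + 1) ^ 2 * Γ * 10 ^ e) * (√s ^ e * (N / K) ^ (e + 1) *
            (y ^ (e + 2) * ρ⁻¹)) * ((J + 1) * (5 * (10 ^ e * y⁻¹ ^ e))) := by gcongr
        _ = (c' * √s * N / K) ^ e * (y ^ 2 * (N / K) / (16 * (J + 1) * ρ * Γ)) := by
            rw [inv_pow, mul_div_assoc (c' * √s), mul_pow, mul_pow, pow_succ (N / K), pow_add y]
            field_simp
            ring
    have hρinv : ζ ^ (1 / (J : ℝ)) ≤ ρ⁻¹ := by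
      rw [← inv_inv (ζ ^ (1 / (J : ℝ)))]; exact inv_anti₀ hρ1 hρJ
    have h3 := mul_le_mul_of_nonneg_right hxl hℓ0
    have hrp : 0 ≤ ζ ^ (1 / (J : ℝ)) := Real.rpow_nonneg hζ.le _
    calc c' ^ e / (160 * (J + 1) ^ 2 * Γ * 10 ^ e) * g *
          (√s ^ e * (N / K) ^ (e + 1) * ζ ^ (1 / (J : ℝ)))
        ≤ c' ^ e / (160 * (J + 1) ^ 2 * Γ * 10 ^ e) * (y ^ (e + 2) * ℓ) *
          (√s ^ e * (N / K) ^ (e + 1) * ρ⁻¹) := by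
          refine mul_le_mul (mul_le_mul_of_nonneg_left hgl (by positivity))
            (mul_le_mul_of_nonneg_left hρinv (by positivity)) (by positivity) (by positivity)
      _ = c' ^ e / (80 * (J + 1) ^ 2 * Γ * 10 ^ e) * (√s ^ e * (N / K) ^ (e + 1) *
        (y ^ (e + 2) * ρ⁻¹)) * ℓ / 2 := by field_simp; ring
      _ ≤ x * ℓ / 2 := by linarith

end Reduction

section Reduction

variable {d : ℕ} {Ω : Type*} [MeasurableSpace Ω] [NeZero d]
  {P : Measure Ω} [IsProbabilityMeasure P] {τ : Edge d → Ω → ℝ≥0}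
  {b : OrthonormalBasis (Fin d) ℝ (Space d)} {u v : Space d}

lemma norm_tubeOffset_le {M : ℕ} {σ : ℝ} (hσ : 0 ≤ σ) {j : Fin d → ℕ} (hj : j ∈ tubeIndex d M) :
    ‖tubeOffset b σ j‖ ≤ d * (σ * M) := by
  refine norm_displacement_le (fun i hi => ?_) (by positivity)
  rw [abs_of_nonneg (by positivity)]
  exact mul_le_mul_of_nonneg_left (by exact_mod_cast ((mem_tubeIndex.1 hj).2 i hi).le) hσ

omit [NeZero d] in
lemma mul_sq_norm_smul_le {w : Space d} {R X : ℝ} (hR : 0 < R) (hw : ‖w‖ ^ 2 ≤ X * R) {c : ℝ}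
    (hc : |c| = R⁻¹) : R * ‖c • w‖ ^ 2 ≤ X := by
  rw [norm_smul, Real.norm_eq_abs, hc, mul_pow]
  have : R * (R⁻¹ ^ 2 * ‖w‖ ^ 2) = ‖w‖ ^ 2 / R := by field_simp
  rw [this, div_le_iff₀ hR]
  exact hw

set_option maxHeartbeats 4000000 in
/-- Reduction of the upper tail at scale `N` to the upper tails at the scale `K` of the pieces and
at the scale `R` of the two ends of the tubes. -/
theorem exists_reduction (hτ : IsWeights P τ) (hb : IsTangentFrame (timeConstant P τ) u b)
    (hcurv : FiniteCurvature (timeConstant P τ) u b) {A c₁ z₀ : ℝ} {J : ℕ} (hc₁ : 0 < c₁)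
    (hz₀ : 0 < z₀) (hz₀' : z₀ ≤ 1 / 16) (hJ : 1 ≤ J) :
    ∃ κ > (0 : ℝ), ∃ Q > (0 : ℝ), ∀ (ζ s g π : ℝ) (N K R : ℕ) (v : Space d),
      0 < ζ → ζ ≤ z₀ → v ∈ tangentPlane b u → ‖v‖ ≤ 2 → ‖v - u‖ ≤ A * √ζ →
      0 < s → s ≤ κ → s * N ≤ R → R ≤ 2 * (s * N) → K ≤ R → Q ≤ K * ζ → K ≤ κ * (√s * N) →
      (∀ lev, ζ / 16 ≤ lev → lev ≤ z₀ → ∃ ℓ, P.real (slow P τ b K lev v) ≤ Real.exp (-ℓ) ∧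
        Q * (1 + Real.log (1 / ζ)) ≤ ℓ ∧ g ≤ √(ζ / lev) ^ (d + 1) * ℓ) →
      0 ≤ π →
      (∀ (R' : ℕ) (v' : Space d), R ≤ R' → R' ≤ 2 * R → v' ∈ tangentPlane b u →
        ‖v' - v‖ ≤ c₁ * (√ζ / √s) → P.real (slow P τ b R' (ζ * N / (16 * R')) v') ≤ π) →
      P.real (slow P τ b N ζ v) ≤ 2 * N ^ d * π +
        (J + 1) * Real.exp (-(κ * g * (√s ^ (d - 1) * (N / K) ^ d * ζ ^ (1 / (J : ℝ))))) := by
  obtain ⟨C, hC1, hC⟩ := hτ.exists_ae_bound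
  obtain ⟨C', hC'0, hC'⟩ := hcurv
  have hC1r : (1 : ℝ) ≤ C := by exact_mod_cast hC1
  have hd1 : (1 : ℝ) ≤ d := by exact_mod_cast Nat.one_le_iff_ne_zero.2 (NeZero.ne d)
  have hu := hb.1
  have hBpos := coordBound_pos hu
  set B := coordBound b u with hB
  have hJr : (0 : ℝ) < J := by exact_mod_cast hJ
  -- the constants
  set D : ℝ := 1 + c₁⁻¹ + C' with hD
  have hc₁i : 0 < c₁⁻¹ := inv_pos.2 hc₁
  have hD1 : 1 ≤ D := by linarith
  set c' : ℝ := 1 / (128 * d * D) with hc'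
  have hc'0 : 0 < c' := by positivity
  have hdD : 1 ≤ d * D := one_le_mul_of_one_le_of_one_le hd1 hD1
  have hc'32 : c' ≤ 1 / 128 := by
    rw [hc']; exact div_le_div_of_nonneg_left (by norm_num) (by norm_num) (by linarith)
  have hc'c₁ : 2 * d * c' ≤ c₁ := by
    have h1 : 2 * d * c' = (1 / 64) * D⁻¹ := by rw [hc']; field_simp; norm_num
    rw [h1]
    have h2 : D⁻¹ ≤ c₁ := by
      rw [← inv_inv c₁]; exact inv_anti₀ hc₁i (by linarith)
    have h3 : 0 < D⁻¹ := by positivity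
    linarith
  have hc'C : C' * (4 * d ^ 2 * c' ^ 2) ≤ 1 / 64 := by
    have h1 : 4 * (d : ℝ) ^ 2 * c' ^ 2 = (1 / 4096) * (D⁻¹ * D⁻¹) := by
      rw [hc']; field_simp; norm_num
    rw [h1]
    have h2 : C' * D⁻¹ ≤ 1 := by
      rw [← div_eq_mul_inv, div_le_one (by linarith)]; linarith
    have h3 : D⁻¹ ≤ 1 := inv_le_one_of_one_le₀ hD1
    have h4 : 0 ≤ C' * D⁻¹ := by positivity
    have h5 := mul_le_one₀ h2 (by positivity) h3
    linarith
  set Γ : ℝ := 1 + 4 * C * d / z₀ with hΓ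
  have hΓ1 : 1 ≤ Γ := by rw [hΓ]; have : 0 ≤ 4 * (C : ℝ) * d / z₀ := by positivity
                         linarith
  set κ₀ : ℝ := c' ^ (d - 1) / (160 * (J + 1) ^ 2 * Γ * 10 ^ (d - 1)) with hκ₀
  have hκ₀0 : 0 < κ₀ := by positivity
  set κ : ℝ := min κ₀ (min c' (1 / (96 * (C' * A ^ 2 + 1)))) with hκ
  have hκ0 : 0 < κ := by
    have h : 0 < 1 / (96 * (C' * A ^ 2 + 1)) := by positivity
    exact lt_min hκ₀0 (lt_min hc'0 h)
  have hκκ₀ : κ ≤ κ₀ := min_le_left _ _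
  have hκc' : κ ≤ c' := (min_le_right _ _).trans (min_le_left _ _)
  have hκA : κ ≤ 1 / (96 * (C' * A ^ 2 + 1)) := (min_le_right _ _).trans (min_le_right _ _)
  set Q : ℝ := max (24 * B + 64 * C * d + 1)
    (2 * (1 + Real.log (1280 * (J + 1) ^ 2 * Γ * 10 ^ (d - 1)) + ((d - 1 : ℕ) + 2))) with hQ
  have hQ1 : 24 * B + 64 * C * d + 1 ≤ Q := le_max_left _ _
  have hQ2 : 2 * (1 + Real.log (1280 * (J + 1) ^ 2 * Γ * 10 ^ (d - 1)) + ((d - 1 : ℕ) + 2)) ≤ Q :=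
    le_max_right _ _
  have hCd : 0 ≤ 64 * (C : ℝ) * d := by positivity
  have hQ0 : 0 < Q := lt_of_lt_of_le (by positivity) hQ1
  refine ⟨κ, hκ0, Q, hQ0, ?_⟩
  intro ζ s g π N K R v hζ hζz hv hv2 hvu hs hsκ hR1 hR2 hKR hKζ hKs hp hπ hnear
  clear_value κ Q
  have hζ1 : ζ ≤ 1 := by linarith
  have hs1 : s ≤ 1 / 128 := by linarith
  have hsq1 : √s ≤ 1 := Real.sqrt_le_one.2 (by linarith)
  have hsq0 : 0 < √s := Real.sqrt_pos.2 hs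
  have hsqs : √s * √s = s := Real.mul_self_sqrt hs.le
  have hzq0 : 0 < √ζ := Real.sqrt_pos.2 hζ
  have hzqz : √ζ * √ζ = ζ := Real.mul_self_sqrt hζ.le
  have hzq1 : √ζ ≤ 1 := Real.sqrt_le_one.2 hζ1
  have hζq : ζ ≤ √ζ := hzqz.symm.le.trans (mul_le_of_le_one_left hzq0.le hzq1)
  have hK0 : (0 : ℝ) < K := by
    exact pos_of_mul_pos_left (hQ0.trans_le hKζ) hζ.le
  have hKQ : Q ≤ K := hKζ.trans (mul_le_of_le_one_right hK0.le hζ1)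
  have hKQ' : Q ≤ √ζ * K :=
    hKζ.trans ((mul_comm _ _).le.trans (mul_le_mul_of_nonneg_right hζq hK0.le))
  have hN0 : (0 : ℝ) < N := by
    by_contra! h
    have : κ * (√s * N) ≤ 0 := mul_nonpos_of_nonneg_of_nonpos hκ0.le
      (mul_nonpos_of_nonneg_of_nonpos hsq0.le h)
    linarith
  have hsqN : √s * N ≤ N := mul_le_of_le_one_left hN0.le hsq1
  have hKc' : (K : ℝ) ≤ c' * (√s * N) := hKs.trans (mul_le_mul_of_nonneg_right hκc' (by positivity))
  have hKN : 128 * (K : ℝ) ≤ N := by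
    have := mul_le_mul hc'32 hsqN (by positivity) (by norm_num)
    linarith
  have hsN : s * N ≤ N / 128 := by
    have := mul_le_mul_of_nonneg_right hs1 hN0.le
    linarith
  have hKRr : (K : ℝ) ≤ R := by exact_mod_cast hKR
  have hR0 : (0 : ℝ) < R := by linarith
  have hRN : 64 * (R : ℝ) ≤ N := by linarith
  have hRN' : 64 * R ≤ N := by exact_mod_cast hRN
  have hKpos : 0 < K := by exact_mod_cast hK0
  -- the number of pieces
  set n := (N - 2 * R) / K with hn
  set R' := N - R - n * K with hR'
  have hnK : n * K ≤ N - 2 * R := Nat.div_mul_le_self _ _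
  have hnK' : N - 2 * R < n * K + K := by
    have := Nat.lt_div_mul_add (a := N - 2 * R) hKpos
    rw [← hn] at this; linarith
  have hsum : R + n * K + R' = N := by omega
  have hRR' : R ≤ R' := by omega
  have hR'R : R' ≤ 2 * R := by omega
  have hR'0 : (0 : ℝ) < R' := by
    have : (R : ℝ) ≤ R' := by exact_mod_cast hRR'
    linarith
  have hR'R2 : (R' : ℝ) ≤ 2 * R := by exact_mod_cast hR'R
  have hnKr : (n : ℝ) * K ≤ N := by
    have : n * K ≤ N := by omega
    exact_mod_cast this
  have hn0 : 0 < n := by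
    have : K ≤ N - 2 * R := by
      have : K ≤ R := hKR
      omega
    exact Nat.div_pos this hKpos
  -- the tubes
  set σ := √ζ * K with hσ
  have hσ0 : 0 < σ := by positivity
  set M := ⌊c' * √s * N / K⌋₊ + 1 with hM
  have hMK1 : 1 ≤ c' * √s * N / K := by rw [le_div_iff₀ hK0]; linarith
  have hMl : c' * √s * N / K ≤ M := by
    rw [hM]; push_cast; exact (Nat.lt_floor_add_one _).le
  have hMu : (M : ℝ) ≤ 2 * (c' * √s * N / K) := by
    rw [hM]; push_cast
    linarith [Nat.floor_le (zero_le_one.trans hMK1)]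
  have hσM : σ * M ≤ 2 * c' * (√ζ * √s * N) := by
    refine (mul_le_mul_of_nonneg_left hMu hσ0.le).trans (le_of_eq ?_)
    rw [hσ]; field_simp
  have hσM0 : 0 ≤ σ * M := by positivity
  -- the offsets
  have hoff : ∀ j ∈ tubeIndex d M, ‖tubeOffset b σ j‖ ≤ 2 * d * c' * (√ζ * √s * N) := by
    intro j hj
    refine (norm_tubeOffset_le hσ0.le hj).trans ?_
    have := mul_le_mul_of_nonneg_left hσM (by positivity : (0 : ℝ) ≤ d)
    linarith
  have hoffR : ∀ j ∈ tubeIndex d M, ∀ r : ℝ, (R : ℝ) ≤ r →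
      r⁻¹ * ‖tubeOffset b σ j‖ ≤ c₁ * (√ζ / √s) := by
    intro j hj r hr
    have hr0 : 0 < r := hR0.trans_le hr
    have h1 : r⁻¹ ≤ (s * N)⁻¹ := inv_anti₀ (by positivity) (hR1.trans hr)
    calc r⁻¹ * ‖tubeOffset b σ j‖ ≤ (s * N)⁻¹ * (2 * d * c' * (√ζ * √s * N)) :=
          mul_le_mul h1 (hoff j hj) (norm_nonneg _) (by positivity)
      _ = 2 * d * c' * (√ζ / √s) := by
          rw [show s * (N : ℝ) = √s * √s * N by rw [hsqs]]; field_simp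
      _ ≤ c₁ * (√ζ / √s) := mul_le_mul_of_nonneg_right hc'c₁ (by positivity)
  have hoffsq : ∀ j ∈ tubeIndex d M, ∀ r : ℝ, (R : ℝ) ≤ r →
      ‖tubeOffset b σ j‖ ^ 2 ≤ (4 * d ^ 2 * c' ^ 2 * (ζ * N)) * r := by
    intro j hj r hr
    calc ‖tubeOffset b σ j‖ ^ 2 ≤ (2 * d * c' * (√ζ * √s * N)) ^ 2 :=
          pow_le_pow_left₀ (norm_nonneg _) (hoff j hj) 2
      _ = 4 * d ^ 2 * c' ^ 2 * ((√ζ * √ζ) * N) * ((√s * √s) * N) := by ring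
      _ = (4 * d ^ 2 * c' ^ 2 * (ζ * N)) * (s * N) := by rw [hsqs, hzqz]
      _ ≤ (4 * d ^ 2 * c' ^ 2 * (ζ * N)) * r :=
          mul_le_mul_of_nonneg_left (hR1.trans hr) (by positivity)
  have hvA : ‖v - u‖ ^ 2 ≤ A ^ 2 * ζ := by
    have := pow_le_pow_left₀ (norm_nonneg _) hvu 2
    rw [mul_pow, Real.sq_sqrt hζ.le] at this
    exact this
  have hcurv' : ∀ j ∈ tubeIndex d M,
      R * timeConstant P τ (v + (R : ℝ)⁻¹ • tubeOffset b σ j) +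
        R' * timeConstant P τ (v + (-(R' : ℝ)⁻¹) • tubeOffset b σ j) ≤
          (R + R') * timeConstant P τ v + ζ * N / 4 := by
    intro j hj
    have h1 := mul_timeConstant_le hτ hb hC'0 hC' hv (w := (R : ℝ)⁻¹ • tubeOffset b σ j)
      (add_smul_displacement_mem hv _ _) hR0.le
    have h2 := mul_timeConstant_le hτ hb hC'0 hC' hv (w := (-(R' : ℝ)⁻¹) • tubeOffset b σ j)
      (add_smul_displacement_mem hv _ _) hR'0.le
    have h3 := mul_sq_norm_smul_le hR0 (hoffsq j hj R le_rfl) (c := (R : ℝ)⁻¹)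
      (abs_of_pos (inv_pos.2 hR0))
    have h4 := mul_sq_norm_smul_le hR'0 (hoffsq j hj R' (by exact_mod_cast hRR'))
      (c := -(R' : ℝ)⁻¹) (by rw [abs_neg]; exact abs_of_pos (inv_pos.2 hR'0))
    have h5 : (R + R') * ‖v - u‖ ^ 2 ≤ 6 * (s * N) * (A ^ 2 * ζ) :=
      mul_le_mul (by linarith) hvA (by positivity) (by positivity)
    have h6 : C' * A ^ 2 * s ≤ 1 / 96 := by
      have h7 : s * (96 * (C' * A ^ 2 + 1)) ≤ 1 := by
        have := hsκ.trans hκA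
        rwa [le_div_iff₀ (by positivity)] at this
      linarith
    have h8 : C' * (6 * (s * N) * (A ^ 2 * ζ)) ≤ ζ * N / 16 := by
      have := mul_le_mul_of_nonneg_right h6 (by positivity : 0 ≤ 6 * (ζ * N))
      linarith
    have h9 : C' * (4 * d ^ 2 * c' ^ 2 * (ζ * N)) ≤ ζ * N / 64 := by
      have := mul_le_mul_of_nonneg_right hc'C (by positivity : 0 ≤ ζ * N)
      linarith
    have h10 := mul_le_mul_of_nonneg_left h5 hC'0.le
    have h11 := mul_le_mul_of_nonneg_left h3 hC'0.le
    have h12 := mul_le_mul_of_nonneg_left h4 hC'0.le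
    have h13 : 0 < ζ * N := mul_pos hζ hN0
    linarith
  -- the levels
  set top := min z₀ (ζ * N / (16 * K)) with htop
  have htop0 : 0 < top := lt_min hz₀ (by positivity)
  have htopζ : ζ / 16 ≤ top := by
    refine le_min (by linarith) ?_
    rw [div_le_div_iff₀ (by norm_num) (by positivity)]
    have := mul_le_mul_of_nonneg_left (by linarith : (K : ℝ) ≤ N) hζ.le
    linarith
  set ρ := (top * 16 / ζ) ^ (1 / (J : ℝ)) with hρ
  have hq1 : 1 ≤ top * 16 / ζ := by rw [le_div_iff₀ hζ]; linarith
  have hqu : top * 16 / ζ ≤ 1 / ζ :=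
    div_le_div_of_nonneg_right (by linarith [min_le_left z₀ (ζ * N / (16 * K))]) hζ.le
  have hρ1 : 1 ≤ ρ := Real.one_le_rpow hq1 (by positivity)
  have hρ0 : 0 < ρ := by linarith
  have hρJ : ρ ^ J = top * 16 / ζ := by
    rw [hρ, ← Real.rpow_natCast, ← Real.rpow_mul (by positivity), one_div,
      inv_mul_cancel₀ hJr.ne', Real.rpow_one]
  have hρu : ρ ≤ (ζ ^ (1 / (J : ℝ)))⁻¹ := by
    rw [← Real.inv_rpow hζ.le, ← one_div ζ]
    exact Real.rpow_le_rpow (by positivity) hqu (by positivity)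
  have hρz : ρ ≤ 16 / ζ := by
    have h1 : ρ ≤ top * 16 / ζ := by
      rw [← hρJ]; exact le_self_pow₀ hρ1 (by omega)
    exact h1.trans (hqu.trans (div_le_div_of_nonneg_right (by norm_num) hζ.le))
  set lev : ℕ → ℝ := fun i => ζ / 16 * ρ ^ i with hlev
  have hlevl : ∀ i, ζ / 16 ≤ lev i := fun i =>
    le_mul_of_one_le_right (by positivity) (one_le_pow₀ hρ1)
  have hlevJ : lev J = top := by
    simp only [hlev]; rw [hρJ]; field_simp
  have hlevu : ∀ i ≤ J, lev i ≤ top := by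
    intro i hi
    rw [← hlevJ]
    exact mul_le_mul_of_nonneg_left (pow_le_pow_right₀ hρ1 hi) (by positivity)
  have hlev0 : ∀ i, 0 < lev i := fun i => lt_of_lt_of_le (by positivity) (hlevl i)
  have hlevh : ∀ i ≤ J, √(lev i) * K ≤ √ζ * N / 2 := by
    intro i hi
    have h1 : lev i ≤ ζ * N / (16 * K) := (hlevu i hi).trans (min_le_right _ _)
    exact (mul_le_mul_of_nonneg_right (Real.sqrt_le_sqrt h1) hK0.le).trans
      (sqrt_div_mul_le hζ.le hK0 (by linarith))
  have hlev00 : lev 0 = ζ / 16 := by simp [hlev]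
  have hsq16 : √(ζ / 16) = √ζ / 4 := by
    rw [Real.sqrt_div hζ.le, show (16 : ℝ) = 4 ^ 2 by norm_num, Real.sqrt_sq (by norm_num)]
  set f : ℕ → ℝ := fun i => ζ * N / (16 * (J + 1) * K * lev i * ρ * Γ) with hf
  set del : ℕ → ℝ := fun i => if i < J then lev (i + 1) * K else 4 * C * d * K with hdel
  set c : ℕ → ℕ := fun i => ⌊(2 * (√(lev i) * K) + 2 * B) / σ⌋₊ + 1 with hc
  set x : ℕ → ℝ := fun i => M ^ (d - 1) * f i / ((J + 1) * (5 * c i ^ (d - 1))) with hx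
  have hM0 : 0 < M := Nat.succ_pos _
  have hM0r : (0 : ℝ) < M := by exact_mod_cast hM0
  have hf0 : ∀ i, 0 < f i := fun i => by have := hlev0 i; simp only [hf]; positivity
  have hc0 : ∀ i, 0 < c i := fun i => Nat.succ_pos _
  have hx0 : ∀ i, 0 < x i := fun i => by
    have h1 := hf0 i
    have h2 : (0 : ℝ) < c i := by exact_mod_cast hc0 i
    simp only [hx]; positivity
  have hcu : ∀ i, (c i : ℝ) ≤ 10 * √(lev i / ζ) := by
    intro i
    have h1 : 1 / 4 ≤ √(lev i / ζ) := by
      refine Real.le_sqrt_of_sq_le ?_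
      rw [le_div_iff₀ hζ]; linarith [hlevl i]
    have h2 : (c i : ℝ) ≤ (2 * (√(lev i) * K) + 2 * B) / σ + 1 := by
      simp only [hc]; push_cast
      have h3 : 0 ≤ (2 * (√(lev i) * K) + 2 * B) / σ := by positivity
      linarith [Nat.floor_le h3]
    have h4 : (2 * (√(lev i) * K) + 2 * B) / σ ≤ 2 * √(lev i / ζ) + 1 := by
      rw [div_le_iff₀ hσ0, Real.sqrt_div (hlev0 i).le, hσ]
      have h5 : (2 * (√(lev i) / √ζ) + 1) * (√ζ * K) = 2 * (√(lev i) * K) + √ζ * K := by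
        field_simp
      rw [h5]
      linarith
    linarith
  have hfdel : ∀ i ≤ J, f i * del i ≤ ζ * N / (16 * (J + 1)) ∨ f i ≤ 1 := by
    intro i hi
    have hli := hlev0 i
    rcases hi.lt_or_eq with hlt | rfl
    · left
      have h1 : f i * del i = ζ * N / (16 * (J + 1)) * Γ⁻¹ := by
        simp only [hf, hdel, if_pos hlt, hlev, pow_succ]
        field_simp
      rw [h1]
      exact mul_le_of_le_one_right (by positivity) (inv_le_one_of_one_le₀ hΓ1)
    · rcases min_choice z₀ (ζ * N / (16 * K)) with hmin | hmin
      · left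
        have h1 : f i * del i = ζ * N / (16 * (i + 1)) * (4 * C * d / (z₀ * (ρ * Γ))) := by
          simp only [hf, hdel, lt_irrefl, if_false, hlevJ, htop, hmin]
          field_simp
        rw [h1]
        refine mul_le_of_le_one_right (by positivity) ?_
        rw [div_le_one (by positivity)]
        have h2 : 4 * (C : ℝ) * d ≤ z₀ * Γ := by
          rw [hΓ, mul_add, mul_div_cancel₀ _ hz₀.ne']; linarith
        have h3 : z₀ * Γ ≤ z₀ * (ρ * Γ) :=
          mul_le_mul_of_nonneg_left (le_mul_of_one_le_left (by positivity) hρ1) hz₀.le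
        exact h2.trans h3
      · right
        have h1 : f i = 1 / ((i + 1) * (ρ * Γ)) := by
          simp only [hf, hlevJ, htop, hmin]
          field_simp
        rw [h1, div_le_one (by positivity)]
        exact one_le_mul_of_one_le_of_one_le (by linarith) (one_le_mul_of_one_le_of_one_le hρ1 hΓ1)
  have hNK : (n : ℝ) ≤ N / K := by rw [le_div_iff₀ hK0]; exact hnKr
  have hNK1 : 1 ≤ (N : ℝ) / K := by rw [le_div_iff₀ hK0]; linarith
  have key := prob_slow_le_tubes hτ hu hv (by linarith : ‖v‖ ≤ 3) hC hsum
    (by omega) (by omega) hM0 (by have : 128 * K ≤ N := by exact_mod_cast hKN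
                                  omega) (by omega) hζ.le hζ1 hσ0.le
    (J := J) (lev := lev) (del := del) (f := f) (c := c) (m := fun i => ⌈x i⌉₊)
    (by
      have h1 : (2 * (n : ℝ) + 4) * B ≤ 6 * (N / K) * B :=
        mul_le_mul_of_nonneg_right (by linarith) hBpos.le
      have h2 : 6 * ((N : ℝ) / K) * B ≤ √ζ * N / 4 := by
        have h3 : 6 * ((N : ℝ) / K) * B = 6 * N * B / K := by ring
        rw [h3, div_le_iff₀ hK0]
        have h4 : 24 * B ≤ √ζ * K := by linarith
        have := mul_le_mul_of_nonneg_right h4 hN0.le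
        linarith
      exact h1.trans h2)
    (sqrt_div_mul_le hζ.le hR0 (by linarith)) (sqrt_div_mul_le hζ.le hR'0 (by linarith))
    (by
      refine hσM.trans ?_
      have h1 : √ζ * √s * N ≤ √ζ * N := by
        rw [mul_assoc]; exact mul_le_mul_of_nonneg_left hsqN hzq0.le
      have h2 := mul_le_mul hc'32 h1 (by positivity) (by norm_num)
      linarith)
    (by linarith) hcurv'
    (by
      have h1 : (C : ℝ) * (d * (n + 3)) ≤ C * (d * (4 * (N / K))) := by
        refine mul_le_mul_of_nonneg_left (mul_le_mul_of_nonneg_left ?_ (by linarith)) (by linarith)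
        linarith
      refine h1.trans ?_
      have h3 : (C : ℝ) * (d * (4 * (N / K))) = 4 * C * d * N / K := by ring
      rw [h3, div_le_iff₀ hK0]
      have h4 : 64 * (C : ℝ) * d ≤ K * ζ := by linarith
      have := mul_le_mul_of_nonneg_right h4 hN0.le
      linarith)
    (fun i _ => (hlev0 i).le)
    (by
      rw [hlev00, mul_assoc, mul_comm (K : ℝ)]
      have := mul_le_mul_of_nonneg_left hnKr (by positivity : 0 ≤ ζ / 16)
      linarith)
    hlevh
    (by rw [hlev00, hsq16]; linarith)
    (fun i hi => by simp only [hdel, if_pos hi]; exact le_rfl)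
    (by simp only [hdel, lt_irrefl, if_false]; exact le_rfl)
    (fun i _ => hf0 i) hfdel (fun i _ => hc0 i)
    (fun i _ => by
      simp only [hc]; push_cast
      rw [← div_lt_iff₀ hσ0]
      exact Nat.lt_floor_add_one _)
    (fun i _ => Nat.one_le_iff_ne_zero.2 (Nat.ceil_pos.2 (hx0 i)).ne')
    (fun i _ => by
      have h1 : ((⌈x i⌉₊ : ℕ) : ℝ) - 1 < x i := by
        linarith [Nat.ceil_lt_add_one (hx0 i).le]
      have h2 : (0 : ℝ) < c i := by exact_mod_cast hc0 i
      refine (mul_lt_mul_of_pos_left h1 (by positivity)).trans_le (le_of_eq ?_)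
      simp only [hx]; field_simp)
  refine key.trans (add_le_add ?_ ?_)
  · have hterm : ∀ j ∈ tubeIndex d M,
        P.real (slow P τ b R (ζ * N / (16 * R)) (v + (R : ℝ)⁻¹ • tubeOffset b σ j)) +
          P.real (slow P τ b R' (ζ * N / (16 * R')) (v + (-(R' : ℝ)⁻¹) • tubeOffset b σ j)) ≤
            2 * π := by
      intro j hj
      have h1 := hnear R (v + (R : ℝ)⁻¹ • tubeOffset b σ j) le_rfl (by omega)
        (add_smul_displacement_mem hv _ _) (by
          rw [add_sub_cancel_left, norm_smul, Real.norm_of_nonneg (by positivity)]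
          exact hoffR j hj R le_rfl)
      have h2 := hnear R' (v + (-(R' : ℝ)⁻¹) • tubeOffset b σ j) hRR' hR'R
        (add_smul_displacement_mem hv _ _) (by
          rw [add_sub_cancel_left, norm_smul, norm_neg, Real.norm_of_nonneg (by positivity)]
          exact hoffR j hj R' (by exact_mod_cast hRR'))
      linarith
    refine (Finset.sum_le_sum hterm).trans ?_
    rw [Finset.sum_const, card_tubeIndex, nsmul_eq_mul]
    push_cast
    have hMN : (M : ℝ) ≤ N := by
      refine hMu.trans ?_
      have h1 : c' * √s * N / K ≤ c' * √s * N := div_le_self (by positivity) (by linarith)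
      have h2 := mul_le_mul hc'32 hsqN (by positivity) (by norm_num)
      linarith
    have hN1 : (1 : ℝ) ≤ N := by linarith
    have h3 : (M : ℝ) ^ (d - 1) ≤ N ^ d := (pow_le_pow_left₀ hM0r.le hMN _).trans
      (pow_le_pow_right₀ hN1 (Nat.sub_le _ _))
    have := mul_le_mul_of_nonneg_right h3 (by positivity : 0 ≤ 2 * π)
    linarith
  · have hterm : ∀ i ∈ Finset.range (J + 1), ((n * M ^ (d - 1)).choose ⌈x i⌉₊ : ℝ) *
        P.real (slow P τ b K (lev i) v) ^ ⌈x i⌉₊ ≤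
          Real.exp (-(κ * g * (√s ^ (d - 1) * (N / K) ^ d * ζ ^ (1 / (J : ℝ))))) := by
      intro i hi
      have hi' : i ≤ J := by have := Finset.mem_range.1 hi; omega
      obtain ⟨ℓ, hp1, hp2, hp3⟩ := hp (lev i) (hlevl i) ((hlevu i hi').trans (min_le_left _ _))
      have hlog0 : 0 ≤ Real.log (1 / ζ) := Real.log_nonneg (by rw [le_div_iff₀ hζ]; linarith)
      have hℓ0 : 0 ≤ ℓ := le_trans (by positivity) hp2
      have hd : d - 1 + 1 = d := Nat.sub_add_cancel (Nat.one_le_iff_ne_zero.2 (NeZero.ne d))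
      have hd2 : d - 1 + 2 = d + 1 := by omega
      -- replace `g` by a nonnegative exponent
      have hle := level_estimate (e := d - 1) (J := J) (g := max g 0) (Γ := Γ) (c' := c') (s := s)
        hN0 hK0 hζ hζ1 (hlevl i)
        ((hlevu i hi').trans ((min_le_left _ _).trans (by linarith))) hρ0 hρz hρu hΓ1 hc'0 hs hnKr
        hn0 hMl (hc0 i) (hcu i) rfl
        (by rw [hd2]; exact max_le hp3 (by positivity)) rfl measureReal_nonneg hp1
        hQ2 hp2 hℓ0 (x i) rfl
      refine hle.trans (Real.exp_le_exp.2 (neg_le_neg ?_))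
      rw [hd]
      refine mul_le_mul_of_nonneg_right ?_ (by positivity)
      exact (mul_le_mul_of_nonneg_left (le_max_left g 0) hκ0.le).trans
        (mul_le_mul_of_nonneg_right hκκ₀ (le_max_right _ _))
    refine (Finset.sum_le_sum hterm).trans ?_
    rw [Finset.sum_const, Finset.card_range, nsmul_eq_mul]
    push_cast
    exact le_rfl

end Reduction

section Asymptotics

lemma eventually_const_mul_rpow_le {a b : ℝ} (h : b < a) (C : ℝ) :
    ∀ᶠ ζ : ℝ in 𝓝[>] 0, C * ζ ^ a ≤ ζ ^ b := by
  have h0 : Tendsto (fun ζ : ℝ => C * ζ ^ (a - b)) (𝓝[>] 0) (𝓝 (C * 0)) := by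
    refine Tendsto.const_mul C ?_
    have := (Real.continuousAt_rpow_const (0 : ℝ) (a - b) (Or.inr (sub_pos.2 h).le)).tendsto
    rw [Real.zero_rpow (sub_pos.2 h).ne'] at this
    exact this.mono_left nhdsWithin_le_nhds
  rw [mul_zero] at h0
  filter_upwards [h0.eventually_le_const zero_lt_one, self_mem_nhdsWithin] with ζ h1 hζ
  have hζ : 0 < ζ := hζ
  have h2 : ζ ^ a = ζ ^ (a - b) * ζ ^ b := by rw [← Real.rpow_add hζ]; ring_nf
  rw [h2, ← mul_assoc]
  exact mul_le_of_le_one_left (Real.rpow_nonneg hζ.le _) h1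

lemma eventually_le_one : ∀ᶠ ζ : ℝ in 𝓝[>] 0, ζ ≤ 1 :=
  nhdsWithin_le_nhds (Iic_mem_nhds zero_lt_one)

lemma eventually_log_le_rpow {η : ℝ} (h : 0 < η) (C : ℝ) :
    ∀ᶠ ζ : ℝ in 𝓝[>] 0, C * (1 + Real.log (1 / ζ)) ≤ ζ ^ (-η) := by
  filter_upwards [eventually_const_mul_rpow_le (a := -(η / 2)) (b := -η) (by linarith)
    (|C| * (1 + 2 / η)), self_mem_nhdsWithin, eventually_le_one] with ζ h1 hζ hζ1
  have hζ : 0 < ζ := hζ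
  refine le_trans ?_ h1
  have h2 : Real.log (1 / ζ) ≤ ζ ^ (-(η / 2)) * (2 / η) := by
    refine (Real.log_le_rpow_div (by positivity) (half_pos h)).trans (le_of_eq ?_)
    rw [one_div, Real.inv_rpow hζ.le, Real.rpow_neg hζ.le]
    field_simp
  have h3 : 1 ≤ ζ ^ (-(η / 2)) := Real.one_le_rpow_of_pos_of_le_one_of_nonpos hζ hζ1 (by linarith)
  have h4 : 0 ≤ Real.log (1 / ζ) := Real.log_nonneg (by rw [le_div_iff₀ hζ]; linarith)
  calc C * (1 + Real.log (1 / ζ)) ≤ |C| * (1 + Real.log (1 / ζ)) :=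
        mul_le_mul_of_nonneg_right (le_abs_self C) (by linarith)
    _ ≤ |C| * ((1 + 2 / η) * ζ ^ (-(η / 2))) :=
        mul_le_mul_of_nonneg_left (by linarith) (abs_nonneg C)
    _ = |C| * (1 + 2 / η) * ζ ^ (-(η / 2)) := by ring

lemma rpow_neg_le_natCeil (ζ L : ℝ) : ζ ^ (-L) ≤ ⌈ζ ^ (-L)⌉₊ := Nat.le_ceil _

lemma natCeil_rpow_neg_le {ζ L : ℝ} (hζ : 0 < ζ) (hζ1 : ζ ≤ 1) (hL : 0 ≤ L) :
    (⌈ζ ^ (-L)⌉₊ : ℝ) ≤ 2 * ζ ^ (-L) := by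
  have h3 : 1 ≤ ζ ^ (-L) := Real.one_le_rpow_of_pos_of_le_one_of_nonpos hζ hζ1 (by linarith)
  linarith [Nat.ceil_lt_add_one (zero_le_one.trans h3)]

end Asymptotics

section Pieces

variable {d : ℕ} {Ω : Type*} [MeasurableSpace Ω] [NeZero d]
  {P : Measure Ω} {τ : Edge d → Ω → ℝ≥0}
  {b : OrthonormalBasis (Fin d) ℝ (Space d)} {u : Space d}

/-- The concentration assumption in terms of the relative delay. -/
lemma UpperTailConcentration.exists_slow_le {χ : ℝ} (h : UpperTailConcentration P τ u b χ) :
    ∃ θ > (0 : ℝ), ∃ c > (0 : ℝ), ∃ K₀ : ℕ, ∀ K : ℕ, K₀ ≤ K → ∀ ζ : ℝ, 0 < ζ →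
      (K : ℝ) ^ (χ - 1) ≤ ζ → ζ ≤ 1 → ∀ v ∈ tangentPlane b u,
      ‖v - u‖ < (K : ℝ) ^ ((χ - 1 + c) / 2) →
      P.real (slow P τ b K ζ v) ≤ Real.exp (-(ζ * (K : ℝ) ^ (1 - χ)) ^ θ) := by
  obtain ⟨θ, hθ, c, hc, K₀, hK⟩ := h
  refine ⟨θ, hθ, c, hc, max K₀ 2, fun K hK0 ζ hζ hζ1 hζ2 v hv hvu => ?_⟩
  have hK2 : (2 : ℝ) ≤ K := by exact_mod_cast (le_max_right _ _).trans hK0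
  have hKpos : (0 : ℝ) < K := by linarith
  have hKa : (K : ℝ) ^ Real.logb K ζ = ζ := Real.rpow_logb hKpos (by linarith) hζ
  set a := 1 + Real.logb K ζ with ha
  have h1 : (K : ℝ) ^ a = ζ * K := by rw [ha, Real.rpow_add hKpos, hKa, Real.rpow_one, mul_comm]
  have h2 : (K : ℝ) ^ ((a + 1) / 2) = √ζ * K := by
    rw [ha, show (1 + Real.logb K ζ + 1) / 2 = Real.logb K ζ * (1 / 2) + 1 by ring,
      Real.rpow_add hKpos, Real.rpow_mul hKpos.le, hKa, Real.rpow_one, Real.sqrt_eq_rpow]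
  have h3 : (K : ℝ) ^ (θ * (a - χ)) = (ζ * (K : ℝ) ^ (1 - χ)) ^ θ := by
    rw [mul_comm θ, Real.rpow_mul hKpos.le, ha,
      show 1 + Real.logb K ζ - χ = Real.logb K ζ + (1 - χ) by ring, Real.rpow_add hKpos, hKa]
  have h4 : a ∈ Set.Icc χ 1 := by
    constructor
    · have := (Real.le_logb_iff_rpow_le (by linarith : (1 : ℝ) < K) hζ).2 hζ1
      linarith
    · have := (Real.logb_nonpos_iff (by linarith : (1 : ℝ) < K) hζ).2 hζ2
      linarith
  have h5 := hK K ((le_max_left _ _).trans hK0) a h4 v hv (by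
    rw [← smul_sub, norm_smul, Real.norm_of_nonneg hKpos.le,
      show (χ + 1 + c) / 2 = 1 + (χ - 1 + c) / 2 by ring, Real.rpow_add hKpos, Real.rpow_one]
    exact mul_lt_mul_of_pos_left hvu hKpos)
  rw [h1, h2, h3] at h5
  exact h5

/-- Concentration at the scale `ζ^{-L}` of the pieces, with `L` slightly above `1 / (1 - χ)`. -/
lemma UpperTailConcentration.eventually_slow_le {χ : ℝ} (h : UpperTailConcentration P τ u b χ)
    (hχ : χ ∈ Set.Ioo (0 : ℝ) 1) :
    ∃ c > (0 : ℝ), ∀ L : ℝ, 1 < L * (1 - χ) → L * (1 - χ) < 1 + c → ∃ η > (0 : ℝ), ∀ A : ℝ,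
      ∀ᶠ ζ : ℝ in 𝓝[>] 0, ∀ lev : ℝ, ζ / 16 ≤ lev → lev ≤ 1 → ∀ v ∈ tangentPlane b u,
        ‖v - u‖ ≤ A * √ζ →
        P.real (slow P τ b ⌈ζ ^ (-L)⌉₊ lev v) ≤ Real.exp (-ζ ^ (-η)) := by
  obtain ⟨θ, hθ, c, hc, K₀, hK⟩ := h.exists_slow_le
  obtain ⟨hχ0, hχ1⟩ := hχ
  refine ⟨c, hc, fun L hL1 hL2 => ?_⟩
  have hL0 : 1 < L := by nlinarith
  set η := L * (1 - χ) - 1 with hη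
  have hη0 : 0 < η := by linarith
  refine ⟨η * θ / 2, by positivity, fun A => ?_⟩
  have hLc : -1 < L * (χ - 1 + c) := by nlinarith
  filter_upwards [self_mem_nhdsWithin, eventually_le_one,
    eventually_const_mul_rpow_le (a := 0) (b := -L) (by linarith) K₀,
    eventually_const_mul_rpow_le (a := 1 + η) (b := 1) (by linarith) 16,
    eventually_const_mul_rpow_le (a := -(η / 2)) (b := -η) (by linarith) 16,
    eventually_const_mul_rpow_le (a := 1 / 2) (b := -L * ((χ - 1 + c) / 2))
      (by linarith) ((|A| + 1) * 2 ^ |(χ - 1 + c) / 2|)]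
    with ζ hζ hζ1 h1 h2 h3 h5 lev hlev hlev1 v hv hvu
  have hζ : 0 < ζ := hζ
  rw [Real.rpow_zero, mul_one] at h1
  rw [Real.rpow_one] at h2
  set K := ⌈ζ ^ (-L)⌉₊ with hKdef
  have hKl : ζ ^ (-L) ≤ K := rpow_neg_le_natCeil ζ L
  have hKu : (K : ℝ) ≤ 2 * ζ ^ (-L) := natCeil_rpow_neg_le hζ hζ1 (by linarith)
  have hζL : 0 < ζ ^ (-L) := Real.rpow_pos_of_pos hζ _
  have hK0 : (0 : ℝ) < K := hζL.trans_le hKl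
  have hlev0 : 0 < lev := lt_of_lt_of_le (by positivity) hlev
  have hpow : ζ ^ (-(1 + η)) ≤ (K : ℝ) ^ (1 - χ) := by
    have := Real.rpow_le_rpow hζL.le hKl (by linarith : 0 ≤ 1 - χ)
    rw [← Real.rpow_mul hζ.le] at this
    rwa [show -(1 + η) = -L * (1 - χ) by rw [hη]; ring]
  have hpow' : (K : ℝ) ^ (χ - 1) ≤ ζ ^ (1 + η) := by
    have := inv_anti₀ (Real.rpow_pos_of_pos hζ _) hpow
    rwa [← Real.rpow_neg hK0.le, ← Real.rpow_neg hζ.le, neg_neg, neg_sub] at this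
  refine (hK K ?_ lev hlev0 ?_ hlev1 v hv ?_).trans (Real.exp_le_exp.2 (neg_le_neg ?_))
  · exact_mod_cast h1.trans hKl
  · linarith
  · have hA : ‖v - u‖ < (|A| + 1) * ζ ^ (1 / 2 : ℝ) := by
      rw [← Real.sqrt_eq_rpow]
      refine hvu.trans_lt (mul_lt_mul_of_pos_right ?_ (Real.sqrt_pos.2 hζ))
      linarith [le_abs_self A]
    have h6 : ζ ^ (-L * ((χ - 1 + c) / 2)) ≤ 2 ^ |(χ - 1 + c) / 2| * (K : ℝ) ^ ((χ - 1 + c) / 2) := by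
      rw [Real.rpow_mul hζ.le]
      rcases le_total 0 ((χ - 1 + c) / 2) with hs | hs
      · refine (Real.rpow_le_rpow hζL.le hKl hs).trans (le_mul_of_one_le_left (by positivity) ?_)
        exact Real.one_le_rpow (by norm_num) (abs_nonneg _)
      · have h7 := Real.rpow_le_rpow_of_nonpos (by positivity) (show (K : ℝ) / 2 ≤ ζ ^ (-L) by linarith) hs
        refine h7.trans (le_of_eq ?_)
        rw [Real.div_rpow hK0.le (by norm_num), abs_of_nonpos hs, Real.rpow_neg (by norm_num)]
        field_simp
    have h8 : (0 : ℝ) < 2 ^ |(χ - 1 + c) / 2| := by positivity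
    have h9 : 2 ^ |(χ - 1 + c) / 2| * ((|A| + 1) * ζ ^ (1 / 2 : ℝ)) ≤
        2 ^ |(χ - 1 + c) / 2| * (K : ℝ) ^ ((χ - 1 + c) / 2) := by
      refine le_trans (le_of_eq ?_) (h5.trans h6)
      ring
    exact hA.trans_le (le_of_mul_le_mul_left h9 h8)
  · have h6 : ζ ^ (-(η / 2)) ≤ lev * (K : ℝ) ^ (1 - χ) := by
      have h7 : ζ / 16 * ζ ^ (-(1 + η)) ≤ lev * (K : ℝ) ^ (1 - χ) :=
        mul_le_mul hlev hpow (by positivity) hlev0.le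
      have h8 : ζ * ζ ^ (-(1 + η)) = ζ ^ (-η) := by
        nth_rewrite 1 [← Real.rpow_one ζ]
        rw [← Real.rpow_add hζ]; ring_nf
      linarith
    have h7 := Real.rpow_le_rpow (by positivity) h6 hθ.le
    rwa [← Real.rpow_mul hζ.le, show -(η / 2) * θ = -(η * θ / 2) by ring] at h7

end Pieces

section Iteration

variable {d : ℕ} {Ω : Type*} [MeasurableSpace Ω] [NeZero d]

/-- The upper tail bound `exp (-N^d ζ^E)`, for relative delays `ζ` near zero and `N ≥ ζ^{-E/d}`. -/
def UpperTail (P : Measure Ω) (τ : Edge d → Ω → ℝ≥0) (u : Space d)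
    (b : OrthonormalBasis (Fin d) ℝ (Space d)) (E : ℝ) : Prop :=
  ∀ A : ℝ, ∀ᶠ ζ : ℝ in 𝓝[>] 0, ∀ N : ℕ, ζ ^ (-(E / d)) ≤ N → ∀ v ∈ tangentPlane b u,
    ‖v - u‖ ≤ A * √ζ → P.real (slow P τ b N ζ v) ≤ Real.exp (-(N ^ d * ζ ^ E))

variable {P : Measure Ω} {τ : Edge d → Ω → ℝ≥0}
  {b : OrthonormalBasis (Fin d) ℝ (Space d)} {u : Space d}

lemma UpperTail.mono {E E' : ℝ} (h : UpperTail P τ u b E) (hE : E ≤ E') : UpperTail P τ u b E' := by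
  intro A
  filter_upwards [h A, self_mem_nhdsWithin, eventually_le_one] with ζ h1 hζ hζ1 N hN v hv hvu
  have hζ : 0 < ζ := hζ
  refine (h1 N (le_trans ?_ hN) v hv hvu).trans (Real.exp_le_exp.2 (neg_le_neg ?_))
  · refine Real.rpow_le_rpow_of_exponent_ge hζ hζ1 (neg_le_neg ?_)
    exact div_le_div_of_nonneg_right hE (Nat.cast_nonneg d)
  · exact mul_le_mul_of_nonneg_left (Real.rpow_le_rpow_of_exponent_ge hζ hζ1 hE) (by positivity)

lemma UpperTail.exists_forall {E : ℝ} (h : UpperTail P τ u b E) (A : ℝ) :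
    ∃ ζ₀ > (0 : ℝ), ∀ ζ : ℝ, 0 < ζ → ζ ≤ ζ₀ → ∀ N : ℕ, ζ ^ (-(E / d)) ≤ N →
      ∀ v ∈ tangentPlane b u, ‖v - u‖ ≤ A * √ζ →
      P.real (slow P τ b N ζ v) ≤ Real.exp (-(N ^ d * ζ ^ E)) := by
  obtain ⟨ζ₀, h0, hs⟩ := mem_nhdsGT_iff_exists_Ioc_subset.1 (h A)
  exact ⟨ζ₀, h0, fun ζ h1 h2 => hs ⟨h1, h2⟩⟩

/-- Absorbing polynomial prefactors. -/
lemma eventually_add_exp_le {E η : ℝ} (hη : 0 < η) (J d : ℕ) :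
    ∀ᶠ ζ : ℝ in 𝓝[>] 0, ∀ N : ℕ, 1 ≤ (N : ℝ) ^ d * ζ ^ E → ∀ X Y : ℝ,
      ζ ^ (-η) * (N ^ d * ζ ^ E) ≤ X → ζ ^ (-η) * (N ^ d * ζ ^ E) ≤ Y →
      2 * N ^ d * Real.exp (-X) + (J + 1) * Real.exp (-Y) ≤ Real.exp (-(N ^ d * ζ ^ E)) := by
  filter_upwards [self_mem_nhdsWithin, eventually_le_one,
    eventually_log_le_rpow hη (4 + |E| + 4 * (J + 1))] with ζ hζ hζ1 h1 N hN X Y hX hY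
  have hζ : 0 < ζ := hζ
  set W := (N : ℝ) ^ d * ζ ^ E with hW
  have hW0 : 0 < W := by linarith
  have hlog : 0 ≤ Real.log (1 / ζ) := Real.log_nonneg (by rw [le_div_iff₀ hζ]; linarith)
  have hJ : (0 : ℝ) ≤ J := Nat.cast_nonneg J
  have h2 : 4 + |E| * Real.log (1 / ζ) + 4 * (J + 1) ≤ ζ ^ (-η) := by
    refine le_trans ?_ h1
    nlinarith [abs_nonneg E, mul_nonneg hJ hlog]
  have hE0 : 0 ≤ |E| * Real.log (1 / ζ) := mul_nonneg (abs_nonneg E) hlog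
  have h3 : (4 + |E| * Real.log (1 / ζ) + 4 * (J + 1)) * W ≤ ζ ^ (-η) * W :=
    mul_le_mul_of_nonneg_right h2 hW0.le
  have h4 : 2 * W + |E| * Real.log (1 / ζ) + 4 * (J + 1) ≤ ζ ^ (-η) * W := by
    refine le_trans ?_ h3
    nlinarith [mul_le_mul_of_nonneg_left hN hE0, mul_nonneg hJ hW0.le]
  have hWexp : W ≤ Real.exp W := by linarith [Real.add_one_le_exp W]
  have hNd : (N : ℝ) ^ d ≤ Real.exp (W + |E| * Real.log (1 / ζ)) := by
    have h5 : (N : ℝ) ^ d = W * ζ ^ (-E) := by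
      rw [hW, mul_assoc, ← Real.rpow_add hζ]; simp
    have h6 : ζ ^ (-E) ≤ Real.exp (|E| * Real.log (1 / ζ)) := by
      rw [Real.rpow_def_of_pos hζ]
      refine Real.exp_le_exp.2 ?_
      rw [one_div, Real.log_inv] at hlog ⊢
      have := mul_le_mul_of_nonneg_right (le_abs_self E) hlog
      linarith
    rw [h5, Real.exp_add]
    exact mul_le_mul hWexp h6 (by positivity) (by positivity)
  have hJexp : Real.exp (-(4 * (J + 1))) * (4 * (J + 1)) ≤ 1 := by
    have h5 := Real.add_one_le_exp (4 * ((J : ℝ) + 1))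
    rw [Real.exp_neg, inv_mul_le_one₀ (Real.exp_pos _)]
    linarith
  have hexp0 := Real.exp_pos (-(4 * ((J : ℝ) + 1)))
  have hX' : 2 * N ^ d * Real.exp (-X) ≤ Real.exp (-W) / 2 := by
    have h5 : Real.exp (-X) ≤
        Real.exp (-W) * Real.exp (-(4 * (J + 1))) * Real.exp (-(W + |E| * Real.log (1 / ζ))) := by
      rw [← Real.exp_add, ← Real.exp_add]
      exact Real.exp_le_exp.2 (by linarith)
    have h6 := mul_le_mul hNd h5 (Real.exp_pos _).le (Real.exp_pos _).le
    have h7 : Real.exp (W + |E| * Real.log (1 / ζ)) * (Real.exp (-W) * Real.exp (-(4 * (J + 1))) *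
        Real.exp (-(W + |E| * Real.log (1 / ζ)))) = Real.exp (-W) * Real.exp (-(4 * (J + 1))) := by
      rw [mul_comm, mul_assoc, ← Real.exp_add (-(W + _)), neg_add_cancel, Real.exp_zero, mul_one]
    have h8 : Real.exp (-(4 * ((J : ℝ) + 1))) ≤ 1 / 4 := by nlinarith
    have h9 := mul_le_mul_of_nonneg_left h8 (Real.exp_pos (-W)).le
    linarith
  have hY' : (J + 1) * Real.exp (-Y) ≤ Real.exp (-W) / 2 := by
    have h5 : Real.exp (-Y) ≤ Real.exp (-W) * Real.exp (-(4 * (J + 1))) := by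
      rw [← Real.exp_add]
      exact Real.exp_le_exp.2 (by linarith)
    have h6 := mul_le_mul_of_nonneg_left h5 (by linarith : (0 : ℝ) ≤ J + 1)
    have h7 := mul_le_mul_of_nonneg_left hJexp (Real.exp_pos (-W)).le
    have h8 := (Real.exp_pos (-W))
    linarith
  linarith

/-- One application of the reduction, with scales that are powers of `ζ`. -/
lemma UpperTail.of_scales [IsProbabilityMeasure P] (hτ : IsWeights P τ) (hu : ‖u‖ = 1)
    (hb : IsTangentFrame (timeConstant P τ) u b)
    (hcurv : FiniteCurvature (timeConstant P τ) u b) {L F β γ η η' s₀ c₁ : ℝ} {J : ℕ}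
    (hL : 1 < L) (hβ : 0 < β) (hs₀ : 0 < s₀) (hc₁ : 0 < c₁)
    (hJ : 1 ≤ J) (hη : 0 < η) (hη' : 0 < η') (hF : β < F / d - L)
    (hF' : γ + β * (d - 1 : ℕ) / 2 + L * d + 1 / J < F - η)
    (hpiece : ∀ A : ℝ, ∃ z₀ > (0 : ℝ), z₀ ≤ 1 / 16 ∧ ∀ᶠ ζ : ℝ in 𝓝[>] 0,
      ∀ lev : ℝ, ζ / 16 ≤ lev → lev ≤ z₀ → ∀ v ∈ tangentPlane b u, ‖v - u‖ ≤ A * √ζ → ∃ ℓ,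
        P.real (slow P τ b ⌈ζ ^ (-L)⌉₊ lev v) ≤ Real.exp (-ℓ) ∧ ζ ^ (-η') ≤ ℓ ∧
        ζ ^ γ ≤ √(ζ / lev) ^ (d + 1) * ℓ)
    (hnear : ∀ A : ℝ, ∀ᶠ ζ : ℝ in 𝓝[>] 0, ∀ N : ℕ, ζ ^ (-(F / d)) ≤ N →
      ∀ v ∈ tangentPlane b u, ‖v - u‖ ≤ A * √ζ → ∀ (R : ℕ), ∀ v' ∈ tangentPlane b u,
        s₀ * ζ ^ β * N ≤ R → R ≤ 4 * (s₀ * ζ ^ β * N) → ‖v' - v‖ ≤ c₁ * (√ζ / √(s₀ * ζ ^ β)) →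
        P.real (slow P τ b R (ζ * N / (16 * R)) v') ≤
          Real.exp (-(ζ ^ (-η) * (N ^ d * ζ ^ F)))) :
    UpperTail P τ u b F := by
  have hd0 : (0 : ℝ) < d := by exact_mod_cast Nat.pos_of_ne_zero (NeZero.ne d)
  intro A
  obtain ⟨z₀, hz₀, hz₀', hpieceA⟩ := hpiece A
  obtain ⟨κ, hκ, Q, hQ, H⟩ := exists_reduction hτ hb hcurv (A := A) hc₁ hz₀ hz₀' hJ
  have hm : 0 < min 1 κ := lt_min one_pos hκ
  filter_upwards [self_mem_nhdsWithin, eventually_le_one,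
    nhdsWithin_le_nhds (Iic_mem_nhds hz₀),
    eventually_const_mul_rpow_le (a := 1 / 2) (b := 0) (by norm_num) A,
    eventually_const_mul_rpow_le hβ (s₀ / min 1 κ),
    eventually_const_mul_rpow_le (a := -L) (b := β - F / d) (by linarith) (2 / (s₀ * min 1 κ)),
    eventually_const_mul_rpow_le (a := 0) (b := 1 - L) (by linarith) Q,
    eventually_log_le_rpow hη' Q, eventually_const_mul_rpow_le hF' (2 ^ d / (κ * √s₀ ^ (d - 1))),
    eventually_add_exp_le (E := F) hη J d, hpieceA, hnear A]
    with ζ hζ hζ1 hζz hA hs hsN hQζ hQl hY hend hpie hnea N hN v hv hvu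
  have hζ : 0 < ζ := hζ
  have hζz : ζ ≤ z₀ := hζz
  rw [Real.rpow_zero] at hs hA
  rw [Real.rpow_zero, mul_one] at hQζ
  set s := s₀ * ζ ^ β with hsdef
  have hs0 : 0 < s := by positivity
  set K := ⌈ζ ^ (-L)⌉₊ with hKdef
  have hKl : ζ ^ (-L) ≤ K := rpow_neg_le_natCeil ζ L
  have hKu : (K : ℝ) ≤ 2 * ζ ^ (-L) := natCeil_rpow_neg_le hζ hζ1 (by linarith)
  have hζL : 1 ≤ ζ ^ (-L) := Real.one_le_rpow_of_pos_of_le_one_of_nonpos hζ hζ1 (by linarith)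
  have hK0 : (0 : ℝ) < K := by linarith
  have hsκ : s ≤ min 1 κ := by
    rwa [div_mul_eq_mul_div, div_le_one hm] at hs
  have hs1 : s ≤ 1 := hsκ.trans (min_le_left _ _)
  have hsK : (K : ℝ) ≤ min 1 κ * (s * N) := by
    have h1 : s₀ * ζ ^ (β - F / d) ≤ s * N := by
      rw [sub_eq_add_neg, Real.rpow_add hζ, ← mul_assoc]
      exact mul_le_mul_of_nonneg_left hN hs0.le
    rw [div_mul_eq_mul_div, div_le_iff₀ (by positivity)] at hsN
    have h2 := mul_le_mul_of_nonneg_left h1 hm.le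
    linarith
  have hN0 : (0 : ℝ) < N := lt_of_lt_of_le (Real.rpow_pos_of_pos hζ _) hN
  have hsN0 : 0 < s * N := mul_pos hs0 hN0
  have hKsN : (K : ℝ) ≤ s * N := hsK.trans (mul_le_of_le_one_left hsN0.le (min_le_left _ _))
  have hRu : (⌈s * N⌉₊ : ℝ) ≤ 2 * (s * N) := by
    linarith [Nat.ceil_lt_add_one hsN0.le]
  have hsq : s ≤ √s := Real.le_sqrt_of_sq_le (by rw [sq]; exact mul_le_of_le_one_left hs0.le hs1)
  have hW : 1 ≤ (N : ℝ) ^ d * ζ ^ F := by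
    have h1 := pow_le_pow_left₀ (by positivity) hN d
    rw [← Real.rpow_natCast (ζ ^ (-(F / d))), ← Real.rpow_mul hζ.le, neg_mul,
      div_mul_cancel₀ _ hd0.ne', Real.rpow_neg hζ.le] at h1
    rwa [inv_le_iff_one_le_mul₀ (by positivity)] at h1
  refine (H ζ s (ζ ^ γ) (Real.exp (-(ζ ^ (-η) * (N ^ d * ζ ^ F)))) N K ⌈s * N⌉₊ v hζ hζz hv ?_ hvu
    hs0 (hsκ.trans (min_le_right _ _)) (Nat.le_ceil _) hRu ?_ ?_ ?_ ?_ (Real.exp_pos _).le ?_).trans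
    (hend N hW _ _ le_rfl ?_)
  · have h1 : ‖v‖ ≤ ‖v - u‖ + ‖u‖ := by simpa using norm_add_le (v - u) u
    rw [← Real.sqrt_eq_rpow] at hA
    linarith
  · exact_mod_cast hKsN.trans (Nat.le_ceil _)
  · refine hQζ.trans ?_
    rw [sub_eq_neg_add, Real.rpow_add hζ, Real.rpow_one]
    exact mul_le_mul_of_nonneg_right hKl hζ.le
  · refine hsK.trans (mul_le_mul (min_le_right _ _) ?_ hsN0.le hκ.le)
    exact mul_le_mul_of_nonneg_right hsq hN0.le
  · intro lev h1 h2
    obtain ⟨ℓ, h3, h4, h5⟩ := hpie lev h1 h2 v hv hvu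
    exact ⟨ℓ, h3, hQl.trans h4, h5⟩
  · intro R' v' h1 h2 h3 h4
    refine hnea N hN v hv hvu R' v' h3 ((Nat.le_ceil _).trans (by exact_mod_cast h1)) ?_ h4
    have h5 : (R' : ℝ) ≤ 2 * (⌈s * N⌉₊ : ℝ) := by exact_mod_cast h2
    linarith
  · have hsqs : √s ^ (d - 1) = √s₀ ^ (d - 1) * ζ ^ (β * (d - 1 : ℕ) / 2) := by
      rw [hsdef, Real.sqrt_mul hs₀.le, mul_pow, Real.sqrt_eq_rpow (ζ ^ β), ← Real.rpow_mul hζ.le,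
        ← Real.rpow_natCast (ζ ^ _), ← Real.rpow_mul hζ.le]
      ring_nf
    have hKd : ((K : ℝ) ^ d)⁻¹ ≥ (2 ^ d)⁻¹ * ζ ^ (L * d) := by
      have h1 := inv_anti₀ (by positivity) (pow_le_pow_left₀ hK0.le hKu d)
      refine le_trans (le_of_eq ?_) h1
      rw [mul_pow, mul_inv, ← Real.rpow_natCast (ζ ^ (-L)), ← Real.rpow_mul hζ.le,
        ← Real.rpow_neg hζ.le]
      ring_nf
    have h2 : ζ ^ (-η) * (N ^ d * ζ ^ F) = N ^ d * ζ ^ (F - η) := by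
      rw [sub_eq_neg_add, Real.rpow_add hζ]; ring
    rw [h2, hsqs, div_pow]
    rw [div_mul_eq_mul_div, div_le_iff₀ (by positivity)] at hY
    have h3 : ζ ^ (F - η) ≤ κ * ζ ^ γ * (√s₀ ^ (d - 1) * ζ ^ (β * (d - 1 : ℕ) / 2) *
        ((2 ^ d)⁻¹ * ζ ^ (L * d)) * ζ ^ (1 / (J : ℝ))) := by
      have h4 : ζ ^ (γ + β * (d - 1 : ℕ) / 2 + L * d + 1 / J) = ζ ^ γ * ζ ^ (β * (d - 1 : ℕ) / 2) *
        ζ ^ (L * d) * ζ ^ (1 / (J : ℝ)) := by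
        rw [Real.rpow_add hζ, Real.rpow_add hζ, Real.rpow_add hζ]
      rw [h4] at hY
      have h5 : ζ ^ (F - η) = (2 ^ d)⁻¹ * (2 ^ d * ζ ^ (F - η)) := by
        rw [inv_mul_cancel_left₀ (by positivity)]
      rw [h5]
      refine (mul_le_mul_of_nonneg_left hY (by positivity)).trans (le_of_eq (by ring))
    calc (N : ℝ) ^ d * ζ ^ (F - η) ≤ N ^ d * (κ * ζ ^ γ * (√s₀ ^ (d - 1) *
          ζ ^ (β * (d - 1 : ℕ) / 2) * ((2 ^ d)⁻¹ * ζ ^ (L * d)) * ζ ^ (1 / (J : ℝ)))) :=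
          mul_le_mul_of_nonneg_left h3 (by positivity)
      _ ≤ N ^ d * (κ * ζ ^ γ * (√s₀ ^ (d - 1) *
          ζ ^ (β * (d - 1 : ℕ) / 2) * ((K : ℝ) ^ d)⁻¹ * ζ ^ (1 / (J : ℝ)))) := by gcongr
      _ = _ := by ring

end Iteration

section Bootstrap

variable {d : ℕ} {Ω : Type*} [MeasurableSpace Ω] [NeZero d] {P : Measure Ω}
  {τ : Edge d → Ω → ℝ≥0}
  {b : OrthonormalBasis (Fin d) ℝ (Space d)} {u : Space d} {χ : ℝ}

/-- Large relative delays do not occur. -/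
lemma prob_slow_eq_zero (hu : 0 < (inner ℝ (b 0) u : ℝ)) {C : ℝ≥0}
    (hC : ∀ᵐ ω ∂P, ∀ e, τ e ω ≤ C) {v : Space d} (hv : v ∈ tangentPlane b u) (hv3 : ‖v‖ ≤ 3)
    (hμ : 0 ≤ timeConstant P τ v) {N : ℕ} {ζ : ℝ} (hN : 5 * coordBound b u ≤ N) (hζ1 : 1 ≤ ζ)
    (hζ : 4 * C * d ≤ ζ) : P.real (slow P τ b N ζ v) = 0 := by
  have h0 : P (slow P τ b N ζ v) = 0 := by
    refine measure_mono_null (fun ω hω => ?_) (ae_iff.1 hC)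
    intro h
    have h1 : (N : ℝ) ≤ √ζ * N := le_mul_of_one_le_left (Nat.cast_nonneg N) (Real.one_le_sqrt.2 hζ1)
    refine absurd hω (not_lt.2 ((restrictedTime_cyl_le hu hv hv3 h hN (hN.trans h1)).trans
      (ENNReal.ofReal_le_ofReal ?_)))
    have h2 := mul_le_mul_of_nonneg_right hζ (Nat.cast_nonneg (α := ℝ) N)
    have h3 := mul_nonneg (Nat.cast_nonneg (α := ℝ) N) hμ
    linarith
  rw [Measure.real, h0, ENNReal.toReal_zero]

lemma exists_upperTail [IsProbabilityMeasure P] (hτ : IsWeights P τ) (hu : ‖u‖ = 1)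
    (hb : IsTangentFrame (timeConstant P τ) u b) (hχ : χ ∈ Set.Ioo (0 : ℝ) 1)
    (hconc : UpperTailConcentration P τ u b χ)
    (hcurv : FiniteCurvature (timeConstant P τ) u b) : ∃ E, UpperTail P τ u b E := by
  obtain ⟨c, hc, hslow⟩ := hconc.eventually_slow_le hχ
  obtain ⟨C, hC1, hC⟩ := hτ.exists_ae_bound
  have h1χ : 0 < 1 - χ := sub_pos.2 hχ.2
  have hd1 : (1 : ℝ) ≤ d := by exact_mod_cast Nat.one_le_iff_ne_zero.2 (NeZero.ne d)
  set L := (1 + c / 2) / (1 - χ) with hLdef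
  have hLχ : L * (1 - χ) = 1 + c / 2 := div_mul_cancel₀ _ h1χ.ne'
  have hL : 1 < L := by rw [hLdef, one_lt_div h1χ]; linarith [hχ.1]
  obtain ⟨η', hη', hp⟩ := hslow L (by linarith) (by linarith)
  set s₀ : ℝ := 1 / (64 * (4 * C * d + 1)) with hs₀def
  have hs₀ : 0 < s₀ := by positivity
  have hdsub : ((d - 1 : ℕ) : ℝ) = d - 1 := by
    rw [Nat.cast_sub (Nat.one_le_iff_ne_zero.2 (NeZero.ne d))]; simp
  refine ⟨L * d + d + 2, UpperTail.of_scales hτ hu hb hcurv (L := L) (β := 1) (γ := (d + 1) / 2)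
    (η := 1 / 2) (η' := η') (s₀ := s₀) (c₁ := √s₀) (J := 1) hL one_pos hs₀
    (Real.sqrt_pos.2 hs₀) le_rfl (by norm_num) hη' ?_ ?_
    (fun A => ⟨1 / 16, by norm_num, le_rfl, ?_⟩)
    (fun A => ?_)⟩
  · rw [lt_sub_iff_add_lt, lt_div_iff₀ (by linarith)]; linarith
  · rw [hdsub]; push_cast; linarith
  · filter_upwards [self_mem_nhdsWithin, eventually_le_one, hp A]
      with ζ hζ hζ1 h lev h1 h2 v hv hvu
    have hζ : 0 < ζ := hζ
    refine ⟨ζ ^ (-η'), h lev h1 (by linarith) v hv hvu, le_rfl, ?_⟩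
    have h3 : 1 ≤ ζ ^ (-η') :=
      Real.one_le_rpow_of_pos_of_le_one_of_nonpos hζ hζ1 (by linarith)
    have h4 : ζ ≤ ζ / lev := le_div_self hζ.le (by linarith) (by linarith)
    have h5 : ζ ^ (((d : ℝ) + 1) / 2) = √ζ ^ (d + 1) := by
      rw [Real.sqrt_eq_rpow, ← Real.rpow_natCast, ← Real.rpow_mul hζ.le]
      push_cast; ring_nf
    rw [h5]
    exact (pow_le_pow_left₀ (Real.sqrt_nonneg _) (Real.sqrt_le_sqrt h4) _).trans
      (le_mul_of_one_le_right (by positivity) h3)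
  · filter_upwards [self_mem_nhdsWithin, eventually_le_one,
      eventually_const_mul_rpow_le (a := 1 / 2) (b := 0) (by norm_num) A,
      eventually_const_mul_rpow_le (a := 0) (b := 1 - (L * d + d + 2) / d)
        (by rw [sub_neg, lt_div_iff₀ (by linarith)]
            have := mul_pos (by linarith : 0 < L) (by linarith : (0 : ℝ) < d)
            linarith) (5 * coordBound b u / s₀)]
      with ζ hζ hζ1 hA hB N hN v hv hvu R v' hv' hR hR' hvv
    have hζ : 0 < ζ := hζ
    rw [Real.rpow_one] at hR hR' hvv
    rw [Real.rpow_zero] at hA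
    rw [Real.rpow_zero, mul_one, div_le_iff₀ hs₀] at hB
    have hsz : √ζ / √(s₀ * ζ) * √s₀ = 1 := by
      rw [Real.sqrt_mul hs₀.le]
      have := Real.sqrt_pos.2 hs₀
      have := Real.sqrt_pos.2 hζ
      field_simp
    rw [mul_comm, hsz] at hvv
    rw [← Real.sqrt_eq_rpow] at hA
    have hN0 : (0 : ℝ) < N := lt_of_lt_of_le (Real.rpow_pos_of_pos hζ _) hN
    have hR0 : (0 : ℝ) < R := lt_of_lt_of_le (by positivity) hR
    have hv3 : ‖v'‖ ≤ 3 := by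
      have h1 : v' = (v' - v) + ((v - u) + u) := by abel
      rw [h1]
      refine (norm_add_le _ _).trans ?_
      linarith [norm_add_le (v - u) u]
    have hlev : 4 * C * d + 1 ≤ ζ * N / (16 * R) := by
      rw [le_div_iff₀ (by positivity)]
      have h1 : s₀ * (64 * (4 * C * d + 1)) = 1 := by
        rw [hs₀def]; exact one_div_mul_cancel (by positivity)
      have h2 := mul_le_mul_of_nonneg_left hR' (by positivity : 0 ≤ 16 * (4 * (C : ℝ) * d + 1))
      have h3 : 16 * (4 * (C : ℝ) * d + 1) * (4 * (s₀ * ζ * N)) =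
        s₀ * (64 * (4 * C * d + 1)) * (ζ * N) := by ring
      rw [h3, h1] at h2
      linarith
    have hCd : 0 ≤ 4 * (C : ℝ) * d := by positivity
    rw [prob_slow_eq_zero hb.1 hC hv' hv3 (timeConstant_nonneg hτ _) ?_ (by linarith) (by linarith)]
    · exact (Real.exp_pos _).le
    · refine hB.trans (le_trans ?_ hR)
      rw [sub_eq_add_neg, Real.rpow_add hζ, Real.rpow_one]
      have := mul_le_mul_of_nonneg_left hN (by positivity : 0 ≤ s₀ * ζ)
      linarith

/-- The bound on the pieces obtained by interpolation. -/
lemma UpperTail.piece_le {E r L η' ζ lev : ℝ} {v : Space d}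
    (hr0 : 0 ≤ r) (hr1 : r ≤ 1) (hr : r * E = (d + 1) / 2) (hη' : 0 < η') (hζ : 0 < ζ)
    (hζ1 : ζ ≤ 1) (h1 : ζ / 16 ≤ lev)
    (hA1 : P.real (slow P τ b ⌈ζ ^ (-L)⌉₊ lev v) ≤ Real.exp (-ζ ^ (-η')))
    (hE : lev ^ (-(E / d)) ≤ ⌈ζ ^ (-L)⌉₊ →
      P.real (slow P τ b ⌈ζ ^ (-L)⌉₊ lev v) ≤ Real.exp (-(⌈ζ ^ (-L)⌉₊ ^ d * lev ^ E))) :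
    ∃ ℓ, P.real (slow P τ b ⌈ζ ^ (-L)⌉₊ lev v) ≤ Real.exp (-ℓ) ∧ ζ ^ (-η') ≤ ℓ ∧
        ζ ^ (r * (E - L * d)) ≤ √(ζ / lev) ^ (d + 1) * ℓ := by
  have hd0 : (0 : ℝ) < d := by exact_mod_cast Nat.pos_of_ne_zero (NeZero.ne d)
  have hlev : 0 < lev := lt_of_lt_of_le (by positivity) h1
  have hℓ1 : 1 ≤ ζ ^ (-η') := Real.one_le_rpow_of_pos_of_le_one_of_nonpos hζ hζ1 (by linarith)
  have hKl : ζ ^ (-L) ≤ ⌈ζ ^ (-L)⌉₊ := rpow_neg_le_natCeil ζ L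
  set K := ⌈ζ ^ (-L)⌉₊
  have hζL : 0 < ζ ^ (-L) := Real.rpow_pos_of_pos hζ _
  have hK0 : (0 : ℝ) < K := hζL.trans_le hKl
  refine ⟨max (ζ ^ (-η')) (K ^ d * lev ^ E), ?_, le_max_left _ _, ?_⟩
  · rcases le_or_gt (lev ^ (-(E / d))) (K : ℝ) with h | h
    · rcases max_choice (ζ ^ (-η')) ((K : ℝ) ^ d * lev ^ E) with h' | h' <;> rw [h']
      · exact hA1
      · exact hE h
    · rw [max_eq_left]
      · exact hA1
      · refine le_trans ?_ hℓ1
        have h3 := pow_le_pow_left₀ hK0.le h.le d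
        rw [← Real.rpow_natCast (lev ^ _), ← Real.rpow_mul hlev.le, neg_mul,
          div_mul_cancel₀ _ hd0.ne', Real.rpow_neg hlev.le] at h3
        have h4 : 0 < lev ^ E := Real.rpow_pos_of_pos hlev _
        calc (K : ℝ) ^ d * lev ^ E ≤ (lev ^ E)⁻¹ * lev ^ E := mul_le_mul_of_nonneg_right h3 h4.le
          _ = 1 := inv_mul_cancel₀ h4.ne'
  · set ℓ := max (ζ ^ (-η')) ((K : ℝ) ^ d * lev ^ E)
    have hℓ : 1 ≤ ℓ := hℓ1.trans (le_max_left _ _)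
    have h3 : ((K : ℝ) ^ d * lev ^ E) ^ r ≤ ℓ :=
      (Real.rpow_le_rpow (by positivity) (le_max_right _ _) hr0).trans
        ((Real.rpow_le_rpow_of_exponent_le hℓ hr1).trans (Real.rpow_one _).le)
    have h4 : √(ζ / lev) ^ (d + 1) = (ζ / lev) ^ (r * E) := by
      rw [Real.sqrt_eq_rpow, ← Real.rpow_natCast, ← Real.rpow_mul (by positivity), hr]
      push_cast; ring_nf
    have h5 : (ζ ^ (-(L * d)) * lev ^ E) ^ r ≤ ((K : ℝ) ^ d * lev ^ E) ^ r := by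
      refine Real.rpow_le_rpow (by positivity) (mul_le_mul_of_nonneg_right ?_ (by positivity)) hr0
      have := pow_le_pow_left₀ hζL.le hKl d
      rwa [← Real.rpow_natCast (ζ ^ _), ← Real.rpow_mul hζ.le, neg_mul] at this
    calc ζ ^ (r * (E - L * d)) = (ζ / lev) ^ (r * E) * (ζ ^ (-(L * d)) * lev ^ E) ^ r := by
          rw [Real.mul_rpow (by positivity) (by positivity), ← Real.rpow_mul hζ.le,
            ← Real.rpow_mul hlev.le, Real.div_rpow hζ.le hlev.le, mul_comm E,
            show r * (E - L * d) = r * E + -(L * d) * r by ring, Real.rpow_add hζ]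
          have : 0 < lev ^ (r * E) := Real.rpow_pos_of_pos hlev _
          field_simp
      _ ≤ √(ζ / lev) ^ (d + 1) * ℓ := by
          rw [h4]
          exact mul_le_mul_of_nonneg_left (h5.trans h3) (by positivity)

lemma UpperTail.improve [IsProbabilityMeasure P] (hd : 2 ≤ d) (hτ : IsWeights P τ) (hu : ‖u‖ = 1)
    (hb : IsTangentFrame (timeConstant P τ) u b) (hχ : χ ∈ Set.Ioo (0 : ℝ) 1)
    (hconc : UpperTailConcentration P τ u b χ)
    (hcurv : FiniteCurvature (timeConstant P τ) u b) {E₁ : ℝ} (hE₁ : d / (1 - χ) < E₁) :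
    ∃ κ > (0 : ℝ), ∀ E, E₁ ≤ E → UpperTail P τ u b E → UpperTail P τ u b (E - κ) := by
  obtain ⟨c, hc, hslow⟩ := hconc.eventually_slow_le hχ
  have h1χ : 0 < 1 - χ := sub_pos.2 hχ.2
  have hd2 : (2 : ℝ) ≤ d := by exact_mod_cast hd
  have hd0 : (0 : ℝ) < d := by linarith
  have hdsub : ((d - 1 : ℕ) : ℝ) = d - 1 := by rw [Nat.cast_sub (by omega)]; simp
  rw [div_lt_iff₀ h1χ] at hE₁
  set y := min (c / 2) ((E₁ * (1 - χ) / d - 1) / 2) with hy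
  have hE₁' : 1 < E₁ * (1 - χ) / d := by rwa [one_lt_div hd0]
  have hy0 : 0 < y := lt_min (by linarith) (by linarith)
  have hyc : y ≤ c / 2 := min_le_left _ _
  have hyE : 1 + y < E₁ * (1 - χ) / d := by
    have : y ≤ (E₁ * (1 - χ) / d - 1) / 2 := min_le_right _ _
    linarith
  set L := (1 + y) / (1 - χ) with hLdef
  have hLχ : L * (1 - χ) = 1 + y := div_mul_cancel₀ _ h1χ.ne'
  have hL : 1 < L := by rw [hLdef, one_lt_div h1χ]; linarith [hχ.1]
  have hLd : L * d < E₁ := by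
    rw [lt_div_iff₀ hd0] at hyE
    rw [hLdef, div_mul_eq_mul_div, div_lt_iff₀ h1χ]
    exact hyE
  obtain ⟨η', hη', hp⟩ := hslow L (by linarith) (by linarith)
  set gap := E₁ - L * d with hgap
  have hgap0 : 0 < gap := by linarith
  have hLd' : (d : ℝ) < L * d := by
    have := mul_lt_mul_of_pos_right hL hd0
    linarith
  have hE₁d : d < E₁ := hLd'.trans hLd
  set β := min (1 / 2) (gap / (16 * d)) with hβ
  have hβ0 : 0 < β := lt_min (by norm_num) (by positivity)
  have hβ1 : β ≤ 1 / 2 := min_le_left _ _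
  have hβd : β * d ≤ gap / 16 := by
    have := mul_le_mul_of_nonneg_right (min_le_right (1 / 2) (gap / (16 * d))) hd0.le
    rw [← hβ] at this
    refine this.trans (le_of_eq ?_)
    field_simp
  set κ := min (gap / 32) (β * (E₁ - d) / 4) with hκ
  have hκ0 : 0 < κ := lt_min (by positivity)
    (div_pos (mul_pos hβ0 (by linarith)) (by norm_num))
  have hκgap : κ ≤ gap / 32 := min_le_left _ _
  have hκβ : κ ≤ β * (E₁ - d) / 4 := min_le_right _ _
  set J := ⌈16 / gap⌉₊ with hJ
  have hJgap : 16 / gap ≤ J := Nat.le_ceil _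
  have hJ0 : (0 : ℝ) < J := lt_of_lt_of_le (by positivity) hJgap
  have hJ1 : 1 / (J : ℝ) ≤ gap / 16 := by
    rw [div_le_iff₀ hJ0]
    rw [div_le_iff₀ hgap0] at hJgap
    linarith
  refine ⟨κ, hκ0, fun E hE h => ?_⟩
  have hE0 : 0 < E := by linarith
  set r := (d + 1) / (2 * E) with hr
  have hr0 : 0 ≤ r := by positivity
  have hr34 : r ≤ 3 / 4 := by
    rw [hr, div_le_iff₀ (by positivity)]; linarith
  have hrE : r * E = (d + 1) / 2 := by rw [hr]; field_simp
  have hκE : 4 * κ ≤ β * (E - d) := by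
    have := mul_le_mul_of_nonneg_left hE hβ0.le
    linarith
  have hF' : r * (E - L * d) + β * (d - 1 : ℕ) / 2 + L * d + 1 / J < E - κ - κ := by
    have h1 : r * (E - L * d) ≤ 3 / 4 * (E - L * d) :=
      mul_le_mul_of_nonneg_right hr34 (by linarith)
    rw [hdsub]
    linarith
  refine UpperTail.of_scales hτ hu hb hcurv (L := L) (β := β) (γ := r * (E - L * d))
    (η := κ) (η' := η') (s₀ := 1) (c₁ := 1) (J := J) hL hβ0 one_pos one_pos
    (by exact_mod_cast hJ0) hκ0 hη' ?_ hF' (fun A => ?_) (fun A => ?_)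
  · rw [lt_sub_iff_add_lt, lt_div_iff₀ hd0]; linarith
  · obtain ⟨ζ₀, hζ₀, hV⟩ := h.exists_forall (4 * |A|)
    refine ⟨min (1 / 16) ζ₀, lt_min (by norm_num) hζ₀, min_le_left _ _, ?_⟩
    filter_upwards [self_mem_nhdsWithin, eventually_le_one, hp A]
      with ζ hζ hζ1 h0 lev h1 h2 v hv hvu
    have hζ : 0 < ζ := hζ
    have h3 : lev ≤ 1 / 16 := h2.trans (min_le_left _ _)
    refine UpperTail.piece_le hr0 (by linarith) hrE hη' hζ hζ1 h1
      (h0 lev h1 (by linarith) v hv hvu) fun hK => hV lev (by linarith) (h2.trans (min_le_right _ _))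
        _ hK v hv (hvu.trans ?_)
    have h4 : √ζ ≤ 4 * √lev := by
      have : √ζ ≤ √(4 ^ 2 * lev) := Real.sqrt_le_sqrt (by linarith)
      rwa [Real.sqrt_mul (by norm_num), Real.sqrt_sq (by norm_num)] at this
    calc A * √ζ ≤ |A| * √ζ := mul_le_mul_of_nonneg_right (le_abs_self A) (Real.sqrt_nonneg _)
      _ ≤ |A| * (4 * √lev) := mul_le_mul_of_nonneg_left h4 (abs_nonneg A)
      _ = 4 * |A| * √lev := by ring
  · obtain ⟨ζ₀, hζ₀, hV⟩ := h.exists_forall (8 * (|A| + 1))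
    filter_upwards [self_mem_nhdsWithin, eventually_le_one,
      eventually_const_mul_rpow_le (a := 1 - β) (b := 0) (by linarith) (1 / ζ₀),
      eventually_const_mul_rpow_le (a := -((1 - β) * (E / d))) (b := β - (E - κ) / d)
        (by rw [sub_mul, one_mul, neg_sub, ← sub_pos]
            have : β * (E / d) - E / d - (β - (E - κ) / d) = (β * (E - d) - κ) / d := by
              field_simp; ring
            rw [this]
            exact div_pos (by linarith) hd0) (64 ^ (E / d)),
      eventually_const_mul_rpow_le (a := E - κ - κ) (b := d + (1 - β) * (E - d)) (by linarith)
        (16 ^ d * 64 ^ (E - d))]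
      with ζ hζ hζ1 hl hN' hX N hN v hv hvu R v' hv' hR hR' hvv
    have hζ : 0 < ζ := hζ
    rw [one_mul] at hR hR' hvv
    rw [one_mul] at hvv
    rw [Real.rpow_zero, div_mul_eq_mul_div, one_mul, div_le_one hζ₀] at hl
    have hN0 : (0 : ℝ) < N := lt_of_lt_of_le (Real.rpow_pos_of_pos hζ _) hN
    have hζβ : 0 < ζ ^ β := Real.rpow_pos_of_pos hζ _
    have hζβ1 : ζ ^ β ≤ 1 := Real.rpow_le_one hζ.le hζ1 hβ0.le
    have hR0 : (0 : ℝ) < R := lt_of_lt_of_le (by positivity) hR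
    set lev := ζ * N / (16 * R) with hlev
    set t := ζ ^ (1 - β) with ht
    have ht0 : 0 < t := Real.rpow_pos_of_pos hζ _
    have htζ : t * ζ ^ β = ζ := by rw [ht, ← Real.rpow_add hζ, sub_add_cancel, Real.rpow_one]
    have hlev1 : t / 64 ≤ lev := by
      rw [hlev, div_le_div_iff₀ (by norm_num) (by positivity), ← htζ]
      have := mul_le_mul_of_nonneg_left hR' ht0.le
      linarith
    have hlev2 : lev ≤ t := by
      rw [hlev, div_le_iff₀ (by positivity), ← htζ]
      have := mul_le_mul_of_nonneg_left hR ht0.le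
      have := mul_pos ht0 hR0
      linarith
    have hlev0 : 0 < lev := lt_of_lt_of_le (by positivity) hlev1
    have hscale : lev ^ (-(E / d)) ≤ R := by
      calc lev ^ (-(E / d)) ≤ (t / 64) ^ (-(E / d)) :=
            Real.rpow_le_rpow_of_nonpos (by positivity) hlev1 (neg_nonpos.2 (by positivity))
        _ = 64 ^ (E / d) * ζ ^ (-((1 - β) * (E / d))) := by
            rw [Real.div_rpow ht0.le (by norm_num), Real.rpow_neg (by norm_num : (0 : ℝ) ≤ 64), ht,
              ← Real.rpow_mul hζ.le, div_inv_eq_mul, mul_comm, mul_neg]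
        _ ≤ ζ ^ (β - (E - κ) / d) := hN'
        _ = ζ ^ β * ζ ^ (-((E - κ) / d)) := by rw [sub_eq_add_neg, Real.rpow_add hζ]
        _ ≤ ζ ^ β * N := mul_le_mul_of_nonneg_left hN hζβ.le
        _ ≤ R := hR
    have hclose : ‖v' - u‖ ≤ 8 * (|A| + 1) * √lev := by
      have h1 : √t / 8 ≤ √lev := by
        have := Real.sqrt_le_sqrt hlev1
        rwa [Real.sqrt_div ht0.le, show (64 : ℝ) = 8 ^ 2 by norm_num,
          Real.sqrt_sq (by norm_num)] at this
      have h2 : √ζ / √(ζ ^ β) = √t := by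
        rw [← Real.sqrt_div hζ.le]
        congr 1
        rw [div_eq_iff hζβ.ne', htζ]
      have h3 : √ζ ≤ √t := Real.sqrt_le_sqrt (by
        rw [← htζ]; exact mul_le_of_le_one_right ht0.le hζβ1)
      rw [h2] at hvv
      have h4 : ‖v' - u‖ ≤ ‖v' - v‖ + ‖v - u‖ := by simpa using norm_add_le (v' - v) (v - u)
      have h5 : A * √ζ ≤ |A| * √t := mul_le_mul (le_abs_self A) h3 (Real.sqrt_nonneg _)
        (abs_nonneg A)
      have h6 := mul_le_mul_of_nonneg_left h1 (by positivity : 0 ≤ 8 * (|A| + 1))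
      linarith
    refine (hV lev hlev0 (hlev2.trans hl) R hscale v' hv' hclose).trans
      (Real.exp_le_exp.2 (neg_le_neg ?_))
    have hRl : (R : ℝ) * lev = ζ * N / 16 := by rw [hlev]; field_simp
    have h1 : (R : ℝ) ^ d * lev ^ E = (ζ * N / 16) ^ d * lev ^ (E - d) := by
      rw [← hRl, mul_pow, mul_assoc, ← Real.rpow_natCast lev, ← Real.rpow_add hlev0]
      ring_nf
    have h2 : (t / 64) ^ (E - d) ≤ lev ^ (E - d) :=
      Real.rpow_le_rpow (by positivity) hlev1 (by linarith)
    have h3 : (t / 64) ^ (E - d) = ζ ^ ((1 - β) * (E - d)) / 64 ^ (E - d) := by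
      rw [Real.div_rpow ht0.le (by norm_num), ht, ← Real.rpow_mul hζ.le]
    have h4 : ζ ^ (-κ) * (N ^ d * ζ ^ (E - κ)) = N ^ d * ζ ^ (E - κ - κ) := by
      rw [sub_eq_add_neg (E - κ) κ, Real.rpow_add hζ]; ring
    rw [h1, h4]
    refine le_trans ?_ (mul_le_mul_of_nonneg_left h2 (by positivity))
    rw [h3, div_pow, mul_pow, ← mul_div_assoc, le_div_iff₀ (by positivity), div_mul_eq_mul_div,
      le_div_iff₀ (by positivity)]
    rw [Real.rpow_add hζ, Real.rpow_natCast] at hX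
    have := mul_le_mul_of_nonneg_left hX (by positivity : 0 ≤ (N : ℝ) ^ d)
    linarith

/-- The upper tail bound holds with every exponent above `d / (1 - χ)`. -/
theorem upperTail_of_lt [IsProbabilityMeasure P] (hd : 2 ≤ d) (hτ : IsWeights P τ) (hu : ‖u‖ = 1)
    (hb : IsTangentFrame (timeConstant P τ) u b) (hχ : χ ∈ Set.Ioo (0 : ℝ) 1)
    (hconc : UpperTailConcentration P τ u b χ)
    (hcurv : FiniteCurvature (timeConstant P τ) u b) {E : ℝ} (hE : d / (1 - χ) < E) :
    UpperTail P τ u b E := by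
  obtain ⟨E₀, h₀⟩ := exists_upperTail hτ hu hb hχ hconc hcurv
  obtain ⟨κ, hκ, hstep⟩ := UpperTail.improve hd hτ hu hb hχ hconc hcurv hE
  have key : ∀ n : ℕ, UpperTail P τ u b (max E (E₀ - n * κ)) := by
    intro n
    induction n with
    | zero => exact h₀.mono (by simp)
    | succ n ih =>
      refine (hstep _ (le_max_left _ _) ih).mono ?_
      rw [sub_le_iff_le_add]
      refine max_le (by linarith [le_max_left E (E₀ - (n + 1 : ℕ) * κ)]) ?_
      have := le_max_right E (E₀ - (n + 1 : ℕ) * κ)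
      push_cast at this ⊢
      linarith
  obtain ⟨n, hn⟩ := exists_nat_gt ((E₀ - E) / κ)
  rw [div_lt_iff₀ hκ] at hn
  have := key n
  rwa [max_eq_left (by linarith)] at this

end Bootstrap

section Conclusion

variable {d : ℕ} {Ω : Type*} [MeasurableSpace Ω]

lemma restrictedTime_anti (t : Edge d → ℝ≥0) {A A' : Set (Space d)} (h : A ⊆ A') (x y : Space d) :
    restrictedTime t A' x y ≤ restrictedTime t A x y :=
  le_iInf₂ fun γ hγ => iInf₂_le γ fun z hz => h (hγ z hz)

variable [NeZero d]

lemma cyl_mono (b : OrthonormalBasis (Fin d) ℝ (Space d)) (v : Space d) {I I' : Set ℝ} {h h' : ℝ}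
    (hI : I ⊆ I') (hh : h ≤ h') : cyl b v I h ⊆ cyl b v I' h' := by
  rintro x ⟨y, h0, hy, rfl⟩
  exact ⟨y, hI h0, fun i hi => (hy i hi).trans hh, rfl⟩

variable {P : Measure Ω} {τ : Edge d → Ω → ℝ≥0}
  {b : OrthonormalBasis (Fin d) ℝ (Space d)} {u : Space d} {χ : ℝ}

lemma subset_slow {N : ℕ} {ζ x h : ℝ} {v : Space d} {A : Set (Space d)}
    (hA : cyl b v Set.univ h ⊆ A) (hx : ζ * N ≤ x) (hh : √ζ * N ≤ h) :
    {ω | ENNReal.ofReal (N * timeConstant P τ v + x) <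
      restrictedTime (fun e => τ e ω) A 0 ((N : ℝ) • v)} ⊆ slow P τ b N ζ v := fun ω hω =>
  lt_of_le_of_lt (ENNReal.ofReal_le_ofReal (by linarith)) (lt_of_lt_of_le hω
    (restrictedTime_anti _ ((cyl_mono b v (Set.subset_univ _) hh).trans hA) _ _))

lemma UpperTail.exists_rpow_le [IsProbabilityMeasure P] (hχ : χ ∈ Set.Ioo (0 : ℝ) 1)
    (H : ∀ E, d / (1 - χ) < E → UpperTail P τ u b E) {ε : ℝ} (hε : 0 < ε) :
    ∃ δ > (0 : ℝ), ∃ N₀ : ℕ, ∀ N : ℕ, N₀ ≤ N → ∀ a ∈ Set.Icc (χ + ε) 1,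
      ∀ v ∈ tangentPlane b u, ‖(N : ℝ) • v - (N : ℝ) • u‖ < (N : ℝ) ^ ((χ + 1 + δ) / 2) →
        P.real {ω | ENNReal.ofReal (N * timeConstant P τ v + (N : ℝ) ^ a) <
            restrictedTime (fun e => τ e ω)
              (cyl b v Set.univ ((N : ℝ) ^ ((a + 1) / 2))) 0 ((N : ℝ) • v)}
          ≤ Real.exp (-(N : ℝ) ^ (d * (1 - ε) / (1 - χ) * (a - χ))) := by
  refine ⟨ε / 2, half_pos hε, ?_⟩
  rcases lt_or_ge 1 (χ + ε) with hχε | hχε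
  · exact ⟨0, fun N _ a ha => absurd (ha.1.trans ha.2) (not_le.2 hχε)⟩
  have h1χ : 0 < 1 - χ := sub_pos.2 hχ.2
  have hε1 : ε < 1 := by linarith [hχ.1]
  have hd0 : (0 : ℝ) < d := by exact_mod_cast Nat.pos_of_ne_zero (NeZero.ne d)
  set D := d / (1 - χ) with hD
  have hDχ : D * (1 - χ) = d := div_mul_cancel₀ _ h1χ.ne'
  have hD0 : 0 < D := by positivity
  set E := D + D * ε ^ 2 with hE
  have hE0 : 0 < E := by positivity
  have hexp : ∀ a, d * (1 - ε) / (1 - χ) * (a - χ) = D * (1 - ε) * (a - χ) := fun a => by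
    rw [hD]; ring
  obtain ⟨ζ₀, hζ₀, hV⟩ := (H E (by rw [hE]; linarith [(by positivity : 0 < D * ε ^ 2)])).exists_forall 1
  have t1 : Tendsto (fun N : ℕ => (N : ℝ) ^ (-(1 - χ - ε / 2) / 2)) atTop (𝓝 0) := by
    have := (tendsto_rpow_neg_atTop (y := (1 - χ - ε / 2) / 2) (by linarith)).comp
      tendsto_natCast_atTop_atTop
    simpa only [neg_div, Function.comp_def] using this
  have t2 : Tendsto (fun N : ℕ => (N : ℝ) ^ (d * ε)) atTop atTop :=
    (tendsto_rpow_atTop (by positivity)).comp tendsto_natCast_atTop_atTop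
  obtain ⟨N₀, hN₀⟩ := eventually_atTop.1 ((t1.eventually_le_const (Real.sqrt_pos.2 hζ₀)).and
    ((t2.eventually_ge_atTop ((ζ₀ ^ E)⁻¹)).and
      ((tendsto_natCast_atTop_atTop.eventually_ge_atTop (ζ₀ ^ (-(E / d)))).and
        (eventually_ge_atTop 1))))
  refine ⟨N₀, fun N hN a ha v hv hvu => ?_⟩
  obtain ⟨h1, h2, h3, h4⟩ := hN₀ N hN
  have hN1 : (1 : ℝ) ≤ N := by exact_mod_cast h4
  have hN0 : (0 : ℝ) < N := by linarith
  rw [hexp]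
  have hvu' : ‖v - u‖ ≤ (N : ℝ) ^ (-(1 - χ - ε / 2) / 2) := by
    rw [← smul_sub, norm_smul, Real.norm_of_nonneg hN0.le,
      show (χ + 1 + ε / 2) / 2 = 1 + -(1 - χ - ε / 2) / 2 by ring, Real.rpow_add hN0,
      Real.rpow_one] at hvu
    exact (lt_of_mul_lt_mul_left hvu hN0.le).le
  set ζ := (N : ℝ) ^ (a - 1) with hζ
  have hζ0 : 0 < ζ := Real.rpow_pos_of_pos hN0 _
  have hζN : ζ * N = (N : ℝ) ^ a := by
    rw [hζ, Real.rpow_sub_one hN0.ne', div_mul_cancel₀ _ hN0.ne']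
  have hζs : √ζ = (N : ℝ) ^ ((a - 1) / 2) := by
    rw [Real.sqrt_eq_rpow, hζ, ← Real.rpow_mul hN0.le]; ring_nf
  have hζsN : √ζ * N = (N : ℝ) ^ ((a + 1) / 2) := by
    rw [hζs, show (a + 1) / 2 = (a - 1) / 2 + 1 by ring, Real.rpow_add hN0, Real.rpow_one]
  have key : ∀ z, 0 < z → z ≤ ζ → z ≤ ζ₀ → (N : ℝ) ^ (-(1 - χ - ε / 2) / 2) ≤ √z →
      z ^ (-(E / d)) ≤ N → (N : ℝ) ^ (D * (1 - ε) * (a - χ)) ≤ N ^ d * z ^ E →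
      P.real {ω | ENNReal.ofReal (N * timeConstant P τ v + (N : ℝ) ^ a) <
        restrictedTime (fun e => τ e ω)
          (cyl b v Set.univ ((N : ℝ) ^ ((a + 1) / 2))) 0 ((N : ℝ) • v)} ≤
        Real.exp (-(N : ℝ) ^ (D * (1 - ε) * (a - χ))) := by
    intro z hz hzζ hzζ₀ hclose hscale hle
    refine (measureReal_mono (subset_slow subset_rfl ?_ ?_) (measure_ne_top _ _)).trans
      ((hV z hz hzζ₀ N hscale v hv (by rw [one_mul]; exact hvu'.trans hclose)).trans
        (Real.exp_le_exp.2 (neg_le_neg hle)))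
    · rw [← hζN]; exact mul_le_mul_of_nonneg_right hzζ hN0.le
    · rw [← hζsN]; exact mul_le_mul_of_nonneg_right (Real.sqrt_le_sqrt hzζ) hN0.le
  rcases le_total ζ ζ₀ with hcase | hcase
  · have haχ : D * ε ^ 2 * (1 - a) ≤ D * ε * (a - χ) := by
      have h5 : ε * (1 - a) ≤ a - χ := by nlinarith [ha.1, ha.2, hχ.1]
      have := mul_le_mul_of_nonneg_left h5 (by positivity : 0 ≤ D * ε)
      linarith
    have hEa : E * (1 - a) ≤ d - D * (1 - ε) * (a - χ) := by
      rw [hE, ← hDχ]; linarith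
    have haχ0 : 0 ≤ D * (1 - ε) * (a - χ) :=
      mul_nonneg (mul_nonneg hD0.le (by linarith)) (by linarith [ha.1])
    refine key ζ hζ0 le_rfl hcase ?_ ?_ ?_
    · rw [hζs]
      exact Real.rpow_le_rpow_of_exponent_le hN1 (by linarith [ha.1])
    · rw [hζ, ← Real.rpow_mul hN0.le]
      refine (Real.rpow_le_rpow_of_exponent_le hN1 ?_).trans (Real.rpow_one _).le
      rw [← neg_mul_neg, neg_sub, neg_neg, ← mul_div_assoc, div_le_one hd0]
      linarith
    · rw [hζ, ← Real.rpow_mul hN0.le, ← Real.rpow_natCast, ← Real.rpow_add hN0]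
      exact Real.rpow_le_rpow_of_exponent_le hN1 (by linarith)
  · refine key ζ₀ hζ₀ hcase le_rfl h1 h3 ?_
    have h5 : (N : ℝ) ^ (D * (1 - ε) * (a - χ)) ≤ (N : ℝ) ^ (d - d * ε) := by
      refine Real.rpow_le_rpow_of_exponent_le hN1 ?_
      have := mul_le_mul_of_nonneg_left (by linarith [ha.2] : a - χ ≤ 1 - χ)
        (mul_nonneg hD0.le (by linarith : 0 ≤ 1 - ε))
      have h6 : D * (1 - ε) * (1 - χ) = d - d * ε := by rw [← hDχ]; ring
      linarith
    have hz : 0 < ζ₀ ^ E := Real.rpow_pos_of_pos hζ₀ _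
    have h6 : 1 ≤ (N : ℝ) ^ (d * ε) * ζ₀ ^ E := (inv_le_iff_one_le_mul₀ hz).1 h2
    calc (N : ℝ) ^ (D * (1 - ε) * (a - χ)) ≤ (N : ℝ) ^ (d - d * ε) := h5
      _ ≤ (N : ℝ) ^ (d - d * ε) * ((N : ℝ) ^ (d * ε) * ζ₀ ^ E) :=
          le_mul_of_one_le_right (by positivity) h6
      _ = N ^ d * ζ₀ ^ E := by
          rw [← mul_assoc, ← Real.rpow_add hN0, sub_add_cancel, Real.rpow_natCast]

lemma UpperTail.exists_limsup_le [IsProbabilityMeasure P] {E : ℝ} (h : UpperTail P τ u b E) :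
    ∃ ζ₀ > (0 : ℝ), ∀ ζ : ℝ, 0 < ζ → ζ < ζ₀ →
      limsup (fun N : ℕ => ((((N : ℝ) ^ d)⁻¹ : ℝ) : EReal) *
          ENNReal.log (P {ω | ENNReal.ofReal (N * timeConstant P τ u + ζ * N) <
            passageTime (fun e => τ e ω) 0 ((N : ℝ) • u)})) atTop
        ≤ ((-(ζ ^ E) : ℝ) : EReal) := by
  obtain ⟨ζ₀, hζ₀, hV⟩ := h.exists_forall 0
  refine ⟨ζ₀, hζ₀, fun ζ hζ hζζ => limsup_le_of_le (by isBoundedDefault) ?_⟩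
  filter_upwards [tendsto_natCast_atTop_atTop.eventually_ge_atTop (ζ ^ (-(E / d))),
    eventually_gt_atTop 0] with N hN hN0
  have hNd : (0 : ℝ) < (N : ℝ) ^ d := by positivity
  have h1 := hV ζ hζ hζζ.le N hN u (by simp [tangentPlane]) (by simp)
  have h2 : P {ω | ENNReal.ofReal (N * timeConstant P τ u + ζ * N) <
      passageTime (fun e => τ e ω) 0 ((N : ℝ) • u)} ≤
      ENNReal.ofReal (Real.exp (-(N ^ d * ζ ^ E))) := by
    refine (measure_mono (subset_slow (b := b) (h := √ζ * N) (Set.subset_univ _) le_rfl le_rfl)).trans ?_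
    exact ENNReal.le_ofReal_iff_toReal_le (measure_ne_top _ _) (Real.exp_pos _).le |>.2 h1
  have h3 := ENNReal.log_monotone h2
  rw [ENNReal.log_ofReal_of_pos (Real.exp_pos _), Real.log_exp] at h3
  refine (mul_le_mul_of_nonneg_left h3 (EReal.coe_nonneg.2 (inv_nonneg.2 hNd.le))).trans ?_
  rw [← EReal.coe_mul]
  refine EReal.coe_le_coe (le_of_eq ?_)
  field_simp

end Conclusion

end FPP

theorem mainTheorem1 (d : ℕ) [NeZero d] (hd : 2 ≤ d)
    {Ω : Type*} [MeasurableSpace Ω] (P : Measure Ω) [IsProbabilityMeasure P]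
    (τ : FPP.Edge d → Ω → ℝ≥0) (hτ : FPP.IsWeights P τ)
    (u : FPP.Space d) (hu : ‖u‖ = 1)
    (b : OrthonormalBasis (Fin d) ℝ (FPP.Space d))
    (hb : FPP.IsTangentFrame (FPP.timeConstant P τ) u b)
    (χ : ℝ) (hχ : χ ∈ Set.Ioo (0 : ℝ) 1)
    (hconc : FPP.UpperTailConcentration P τ u b χ)
    (hcurv : FPP.FiniteCurvature (FPP.timeConstant P τ) u b) :
    -- (1) in tilted cylinders
    (∀ ε > (0 : ℝ), ∃ δ > (0 : ℝ), ∃ N₀ : ℕ, ∀ N : ℕ, N₀ ≤ N → ∀ a ∈ Set.Icc (χ + ε) 1,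
      ∀ v ∈ FPP.tangentPlane b u,
        ‖(N : ℝ) • v - (N : ℝ) • u‖ < (N : ℝ) ^ ((χ + 1 + δ) / 2) →
        P.real {ω | ENNReal.ofReal (N * FPP.timeConstant P τ v + (N : ℝ) ^ a) <
            FPP.restrictedTime (fun e => τ e ω)
              (FPP.cyl b v Set.univ ((N : ℝ) ^ ((a + 1) / 2))) 0 ((N : ℝ) • v)}
          ≤ Real.exp (-(N : ℝ) ^ (d * (1 - ε) / (1 - χ) * (a - χ)))) ∧
    -- (1) for the unrestricted passage time
    (∀ ε > (0 : ℝ), ∃ N₀ : ℕ, ∀ N : ℕ, N₀ ≤ N → ∀ a ∈ Set.Icc (χ + ε) 1,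
        P.real {ω | ENNReal.ofReal (N * FPP.timeConstant P τ u + (N : ℝ) ^ a) <
            FPP.passageTime (fun e => τ e ω) 0 ((N : ℝ) • u)}
          ≤ Real.exp (-(N : ℝ) ^ (d * (1 - ε) / (1 - χ) * (a - χ)))) ∧
    -- (2) the rate function near zero
    (∀ ε > (0 : ℝ), ∃ ζ₀ > (0 : ℝ), ∀ ζ : ℝ, 0 < ζ → ζ < ζ₀ →
      limsup (fun N : ℕ => ((((N : ℝ) ^ d)⁻¹ : ℝ) : EReal) *
          ENNReal.log (P {ω | ENNReal.ofReal (N * FPP.timeConstant P τ u + ζ * N) <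
            FPP.passageTime (fun e => τ e ω) 0 ((N : ℝ) • u)})) atTop
        ≤ ((-(ζ ^ ((1 + ε) * (d / (1 - χ)))) : ℝ) : EReal)) := by

  have H : ∀ E, d / (1 - χ) < E → FPP.UpperTail P τ u b E := fun E hE =>
    FPP.upperTail_of_lt hd hτ hu hb hχ hconc hcurv hE
  have h1 := fun ε (hε : (0 : ℝ) < ε) => FPP.UpperTail.exists_rpow_le hχ H hε
  refine ⟨h1, fun ε hε => ?_, fun ε hε => FPP.UpperTail.exists_limsup_le (H _ ?_)⟩
  · obtain ⟨δ, hδ, N₀, hN⟩ := h1 ε hε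
    refine ⟨max N₀ 1, fun N hN' a ha => ?_⟩
    have hN0 : (0 : ℝ) < N := by exact_mod_cast (le_max_right _ _).trans hN'
    refine le_trans (measureReal_mono (fun ω hω => ?_) (measure_ne_top _ _))
      (hN N ((le_max_left _ _).trans hN') a ha u (by simp [FPP.tangentPlane])
        (by rw [sub_self, norm_zero]; exact Real.rpow_pos_of_pos hN0 _))
    exact lt_of_lt_of_le hω (FPP.restrictedTime_anti _ (Set.subset_univ _) _ _)
  · have h1χ : 0 < 1 - χ := sub_pos.2 hχ.2
    have hd0 : (0 : ℝ) < d := by exact_mod_cast (by omega : 0 < d)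
    have := div_pos hd0 h1χ
    nlinarith
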